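/- **Setting.** Consider episodic POMDPs with finite nonempty state, observation and action spaces $\mathcal S,\mathcal O,\mathcal A$, horizon $H$, initial distribution $\mu_1$, emissions $\mathbb O_h(o|s)$ and transitions $\mathbb T_h(s'|s,a)$, and with a known reward $r_h(o_h,a_h)\in[0,1]$. Let $1\le m\le H$. For a history $\tau_h=(o_1,a_1,\dots,o_h,a_h)$ and a test $t=(o_{h+1:h+W},a_{h+1:h+W-1})$ let $\mathbb P(t|\tau_h)$ be the probability of seeing $o_{h+1:h+W}$ after $\tau_h$ when $a_{h+1:h+W-1}$ are executed ($0$ if $\tau_h$ is unreachable). Let $D_h=(\mathbb P(t|\tau_h))_{t,\tau_h}$, $d_{\mathrm{PSR},h}=\operatorname{rank}D_h$ and $d_{\mathrm{PSR}}=\max_{0\le h\le H-1} d_{\mathrm{PSR},h}$. A set $\mathcal U_{h+1}$ of tests is a *core test set* if the rows of $D_h$ indexed by it have rank $d_{\mathrm{PSR},h}$. A POMDP is *$m$-step decodable* if there are functions $\phi_{\mathrm{dec},h}$ with $s_h=\phi_{\mathrm{dec},h}\big((o,a)_{\max\{h-m+1,1\}:h-1},o_h\big)$ for all $h\in[H]$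 along every latent-state/trajectory path of positive probability. Let $\mathcal U=\mathcal O\times(\mathcal A\times\mathcal O)^{m-1}$ be the set of $m$-step futures, whose set of action sequences is $\mathcal U_A=\mathcal A^{m-1}$. A POMDP is *$\alpha$-regular* ($\alpha>0$) if for each $0\le h\le H-m$ there are $d_{\mathrm{PSR},h}$ histories of length $h$ such that the matrix $K_h$ with columns $[\mathbb P(u|\tau_h)]_{u\in\mathcal U}$, for $\tau_h$ among these histories, has linearly independent columns and $\|K_h^\dagger\|_{1\mapsto1}\le 1/\alpha$. For a class $\mathcal F$ of models, an $\epsilon$-bracket of size $N$ is a family of pairs of functions $(g_1^i,g_2^i)_{i\le N}$ of (policy, trajectory) with $\sum_{\tau_H}|g^i_1(\pi,\tau_H)-g^i_2(\pi,\tau_H)|\le\epsilon$ for all $i,\pi$, such that each $f\in\mathcal F$ has an $i$ with $g_1^i(\pi,\tau_H)\le\mathbb P_f^\pi(\tau_H)\le g_2^i(\pi,\tau_H)$ for all $\pi,\tau_H$; $\mathcal N_{\mathcal F}(\epsilon)$ is the least such $N$. **Algorithm (CRANE up to step $H-m$).** Given $\mathcal F$, $\beta$ and $K$, start with $\mathcal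 B^1=\mathcal F$. In iteration $k=1,\dots,K$ choose $(f^k,\pi^k)\in\arg\max_{f\in\mathcal B^k,\pi}V_f^\pi$ over all history-dependent policies. Then for each $h\in\{0,\dots,H-m\}$ and $u\in\mathcal A^{m-1}$ collect one trajectory of the true model with the policy that follows $\pi^k$ in steps $1,\dots,h-1$, acts uniformly in step $h$ (if $h\ge1$), plays $u$ in steps $h+1,\dots,h+m-1$ and acts uniformly afterwards. Let $\mathcal B^{k+1}$ be the set of all $f\in\mathcal F$ whose log-likelihood on all data collected so far is at least its supremum over $\mathcal F$ minus $\beta$. Output the uniform mixture $\widehat\pi$ of $\pi^1,\dots,\pi^K$. Put $\epsilon_{\mathrm b}=1/(KH|\mathcal A|^{m-1})$ and $\beta=c\log\big(\mathcal N_{\mathcal F}(\epsilon_{\mathrm b})KH|\mathcal A|^{m-1}/\delta\big)$. **Corollary.** (0) For every $m$-step decodable POMDP and every $0\le h\le H-m$, $\mathcal U$ is a core test set $\mathcal U_{h+1}$. Moreover there are an absolute constant $c>0$, an absolute constant $c_0>0$ and absolute polynomials such that the following holds for all $\delta\in(0,1]$, $\epsilon>0$, $\alpha>0$. Let the true model $f^*$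 be $m$-step decodable, let $f^*\in\mathcal F$, and let all $f\in\mathcal F$ be $\alpha$-regular. With $\log^+x=\max\{0,\log x\}$, if the integer $K\ge1$ satisfies the condition in the respective case, then, with probability at least $1-\delta$, $V^{\widehat\pi}\ge V^*-\epsilon$. (i) Tabular: $\mathcal F$ is a class of POMDPs on $\mathcal S,\mathcal O,\mathcal A$, each of which is $m$-step decodable or, more generally, has $\mathcal U$ as a core test set $\mathcal U_{h+1}$ for all $0\le h\le H-m$; and $$K\ge\epsilon^{-2}\,\mathrm{poly}\big(d_{\mathrm{PSR}},|\mathcal A|^m,1/\alpha,|\mathcal O|,|\mathcal S|,H,\log(1/\delta),\log^+(1/\epsilon)\big),$$ where $d_{\mathrm{PSR}}$ is that of $f^*$. (ii) Low-rank: $\mathcal F$ is a class of $m$-step decodable POMDPs with $\mathbb T_{h;f}(s'|s,a)=\psi_{h;f}(s')^\top\phi_{h;f}(s,a)$, where $\phi_{h;f},\psi_{h;f}$ have values in $\mathbb R^{d_{\mathrm{trans}}}$ and $\|\phi_{h;f}(s,a)\|_\infty,\|\psi_{h;f}(s)\|_\infty\le1$; $\mathcal Y_\Phi,\mathcal Y_\Psi,\mathcal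 Y_{\mathbb O},\mathcal Y_\mu$ are the $\ell_\infty$-covering numbers of the families $(\phi_{h;f}(s,a))$, $(\psi_{h;f}(s))$, $(\mathbb O_{h;f}(o|s))$, $(\mu_{1;f}(s))$, $f\in\mathcal F$; $\epsilon_{\mathrm{LR}}=c_0\epsilon_{\mathrm b}/(|\mathcal O|^{H+2}|\mathcal A|^H)$; and $$K\ge\epsilon^{-2}\,\mathrm{poly}\big(d_{\mathrm{trans}},|\mathcal A|^m,1/\alpha,\log\mathcal Y_\Phi(\tfrac{\epsilon_{\mathrm{LR}}}{d_{\mathrm{trans}}}),\log\mathcal Y_\Psi(\tfrac{\epsilon_{\mathrm{LR}}}{d_{\mathrm{trans}}}),\log\mathcal Y_{\mathbb O}(\epsilon_{\mathrm{LR}}),\log\mathcal Y_\mu(\epsilon_{\mathrm{LR}}),H,\log|\mathcal O|,\log(1/\delta),\log^+(1/\epsilon)\big).$$ (iii) Linear: $\mathcal F$ is as in (i), and all $f\in\mathcal F$ have the form $\mathbb T_{h;f}(s'|s,a)=\psi_h(s')^\top B_{h,1}\phi_h(s,a)$, $\mathbb O_{h;f}(o|s)=\overline\psi_h(o)^\top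 B_{h,2}\overline\phi_h(s)$, $\mu_{1;f}(s)=\theta^\top\widehat\phi(s)$ with given features $\phi_h(s,a)\in\mathbb R^{d_1}$, $\psi_h(s)\in\mathbb R^{d_2}$, $\overline\phi_h(s)\in\mathbb R^{d_3}$, $\overline\psi_h(o)\in\mathbb R^{d_4}$, $\widehat\phi(s)\in\mathbb R^{d_5}$ of sup norm at most $1$ and parameters $B_{h,1},B_{h,2},\theta$ with entries in $[-1,1]$; $d_{\mathrm{lin}}=\max_i d_i$; and $$K\ge\epsilon^{-2}\,\mathrm{poly}\big(d_{\mathrm{lin}},|\mathcal A|^m,1/\alpha,H,\log|\mathcal O|,\log(1/\delta),\log^+(1/\epsilon)\big).$$ -/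

import Mathlib

universe u v w

/-!
# Episodic POMDPs as predictive state representations, and the algorithm CRANE

Conventions. Spaces of states `S`, observations `O`, actions `A` are finite; `H` is the horizon.
Steps are numbered from `0` to `H - 1`. A history of length `h` (the observations and actions of the
first `h` steps) is a list, or a function `Fin h → O × A` where a finite index type is needed.
-/

namespace PSR

/-! ### Models -/

/-- The dynamics of an episodic POMDP: initial distribution `μ`, emission kernels `E h s o`
(probability of observing `o` in state `s` at step `h`), and transition kernels `T h s a s'`
(probability of moving from `s` to `s'` under `a` after step `h`). In an episode of length `H` only
the kernels with `h < H` are used. -/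
structure POMDP (S O A : Type*) [Fintype S] [Fintype O] where
  μ : S → ℝ
  E : ℕ → S → O → ℝ
  T : ℕ → S → A → S → ℝ
  μ_nonneg : ∀ s, 0 ≤ μ s
  μ_sum : ∑ s, μ s = 1
  E_nonneg : ∀ h s o, 0 ≤ E h s o
  E_sum : ∀ h s, ∑ o, E h s o = 1
  T_nonneg : ∀ h s a s', 0 ≤ T h s a s'
  T_sum : ∀ h s a, ∑ s', T h s a s' = 1

/-- A policy: a distribution over actions for every past history and current observation. -/
structure Policy (O A : Type*) [Fintype A] where
  act : List (O × A) → O → A → ℝ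
  act_nonneg : ∀ τ o a, 0 ≤ act τ o a
  act_sum : ∀ τ o, ∑ a, act τ o a = 1

/-- Trajectories of a whole episode. -/
abbrev Traj (O A : Type*) (H : ℕ) := Fin H → O × A

/-- A test: observations and actions, in turn, ending with an observation. The test `(w, o)` has
length `w.length + 1` and prescribes `w.length` actions. -/
abbrev Test (O A : Type*) := List (O × A) × O

section Model

variable {S O A : Type*} [Fintype S] [Fintype O]

/-- One Bayes-filter recursion: from unnormalized beliefs `b` at step `h`, the unnormalized beliefs
after the given observations and (executed) actions. -/
def POMDP.filter (M : POMDP S O A) : ℕ → (S → ℝ) → List (O × A) → S → ℝ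
  | _, b, [] => b
  | h, b, (o, a) :: τ => M.filter (h + 1) (fun s' => ∑ s, b s * M.E h s o * M.T h s a s') τ

/-- `M.belief τ s` is the probability that the observations of `τ` occur and that the next state
is `s`, when the actions of `τ` are executed. -/
def POMDP.belief (M : POMDP S O A) (τ : List (O × A)) : S → ℝ := M.filter 0 M.μ τ

/-- The probability of the observations of `τ` when the actions of `τ` are executed. -/
def POMDP.prob (M : POMDP S O A) (τ : List (O × A)) : ℝ := ∑ s, M.belief τ s

/-- The probability that a test succeeds when it is started in state `s` at step `h`. -/
def POMDP.testFrom (M : POMDP S O A) : ℕ → S → List (O × A) → O → ℝ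
  | h, s, [], o => M.E h s o
  | h, s, (o', a) :: w, o => M.E h s o' * ∑ s', M.T h s a s' * M.testFrom (h + 1) s' w o

/-- `ℙ(t | τ)`, the success probability of the test `t` after the history `τ`; it is `0` if `τ` is
unreachable (division by zero). -/
noncomputable def POMDP.testProb (M : POMDP S O A) (τ : List (O × A)) (t : Test O A) : ℝ :=
  (∑ s, M.belief τ s * M.testFrom τ.length s t.1 t.2) / M.prob τ

/-! ### System dynamics matrices, core test sets, core matrices -/

/-- The tests that can be run after `h` steps of an episode of length `H`. (Tests that run beyond
the end only see the dummy observation and add nothing to the row space.) -/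
def tests (O A : Type*) (H h : ℕ) : Set (Test O A) := {t | h + t.1.length < H}

/-- The rows indexed by the tests in `U` of the system dynamics matrix after `h` steps; columns are
indexed by all histories of length `h`. -/
noncomputable def POMDP.dynMatrix (M : POMDP S O A) (h : ℕ) (U : Set (Test O A)) :
    Matrix U (Fin h → O × A) ℝ :=
  Matrix.of fun t τ => M.testProb (List.ofFn τ) t.1

/-- `m`-step decodability: whenever history `τ`, current state `s` and observation `o` occur together
with positive probability (when the actions of `τ` are executed), `s` is a function, depending on
the step, of `o` and of the last `m - 1` observations and actions (all of them if there are
fewer). -/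
def POMDP.IsDecodable (M : POMDP S O A) (H m : ℕ) : Prop :=
  ∃ dec : ℕ → List (O × A) → O → S, ∀ h < H, ∀ τ : List (O × A), τ.length = h → ∀ o s,
    0 < M.belief τ s * M.E h s o → s = dec h (τ.rtake (m - 1)) o

variable [Fintype A]

/-- The rank of the system dynamics matrix `D_h`. -/
noncomputable def POMDP.psrRankAt (M : POMDP S O A) (H h : ℕ) : ℕ :=
  (M.dynMatrix h (tests O A H h)).rank

/-- The PSR rank `d_PSR`, the maximum of the ranks of the matrices `D_h`. -/
noncomputable def POMDP.psrRank (M : POMDP S O A) (H : ℕ) : ℕ :=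
  (Finset.range H).sup (M.psrRankAt H)

/-- `U` is a core test set for the tests started after `h` steps. -/
def POMDP.IsCoreTestSet (M : POMDP S O A) (H h : ℕ) (U : Set (Test O A)) : Prop :=
  U ⊆ tests O A H h ∧ (M.dynMatrix h U).rank = M.psrRankAt H h

/-- The index type of the `m`-step futures, `(O × A)^(m-1) × O`. -/
abbrev Future (O A : Type*) (m : ℕ) := (Fin (m - 1) → O × A) × O

/-- An `m`-step future as a test. -/
def Future.toTest {O A : Type*} {m : ℕ} (u : Future O A m) : Test O A := (List.ofFn u.1, u.2)

/-- The set of all `m`-step futures. -/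
def futures (O A : Type*) (m : ℕ) : Set (Test O A) :=
  Set.range (Future.toTest : Future O A m → Test O A)

/-- The `m`-step futures form a core test set at every step at which they fit into the episode. -/
def POMDP.FuturesAreCore (M : POMDP S O A) (H m : ℕ) : Prop :=
  ∀ h, h + m ≤ H → M.IsCoreTestSet H h (futures O A m)

/-- The matrix whose columns are the predictive states (with the `m`-step futures as tests) after
the histories `c 0, c 1, …`. -/
noncomputable def POMDP.coreMatrix (M : POMDP S O A) (m h : ℕ) {d : ℕ}
    (c : Fin d → Fin h → O × A) : Matrix (Future O A m) (Fin d) ℝ :=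
  Matrix.of fun u i => M.testProb (List.ofFn (c i)) u.toTest

/-- The Moore-Penrose pseudoinverse of a matrix with linearly independent columns. -/
noncomputable def pinv {ι : Type*} [Fintype ι] {d : ℕ} (K : Matrix ι (Fin d) ℝ) :
    Matrix (Fin d) ι ℝ :=
  (K.transpose * K)⁻¹ * K.transpose

/-- The operator norm of `B` from `ℓ¹` to `ℓ¹` is at most `C`. -/
def OneNormLE {ι κ : Type*} [Fintype ι] [Fintype κ] (B : Matrix κ ι ℝ) (C : ℝ) : Prop :=
  ∀ x : ι → ℝ, ∑ k, |B.mulVec x k| ≤ C * ∑ i, |x i|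

/-- `α`-regularity: at every step there are `rank D_h` histories (minimum core histories) whose
predictive states are linearly independent, with `‖K_h†‖₁₋₁ ≤ 1/α` for the matrix `K_h` of these
predictive states. (The core matrix is the one with the smallest such norm among the finitely many
choices of core histories, so that this is the bound for the core matrix.) -/
def POMDP.IsRegular (M : POMDP S O A) (H m : ℕ) (α : ℝ) : Prop :=
  ∀ h, h + m ≤ H → ∃ c : Fin (M.psrRankAt H h) → Fin h → O × A,
    LinearIndependent ℝ (M.coreMatrix m h c).transpose ∧
      OneNormLE (pinv (M.coreMatrix m h c)) (1 / α)

end Model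

/-! ### Low-rank and linear POMDPs -/

/-- A POMDP together with a factorization `T h s a s' = ⟨ψ h s', φ h s a⟩` of its transition kernels
through features of dimension `d`, normalized by `‖φ‖_∞ ≤ 1` and `‖ψ‖_∞ ≤ 1`. -/
structure LowRankPOMDP (S O A : Type*) [Fintype S] [Fintype O] (H d : ℕ) extends POMDP S O A where
  φ : ℕ → S → A → Fin d → ℝ
  ψ : ℕ → S → Fin d → ℝ
  T_eq : ∀ h < H, ∀ s a s', T h s a s' = ψ h s' ⬝ᵥ φ h s a
  φ_le : ∀ h < H, ∀ s a i, |φ h s a i| ≤ 1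
  ψ_le : ∀ h < H, ∀ s i, |ψ h s i| ≤ 1

/-- Given features for linear POMDPs, bounded by `1` in sup norm. -/
structure LinearFeatures (S O A : Type*) (H d₁ d₂ d₃ d₄ d₅ : ℕ) where
  φT : ℕ → S → A → Fin d₁ → ℝ
  ψT : ℕ → S → Fin d₂ → ℝ
  φE : ℕ → S → Fin d₃ → ℝ
  ψE : ℕ → O → Fin d₄ → ℝ
  φμ : S → Fin d₅ → ℝ
  φT_le : ∀ h < H, ∀ s a i, |φT h s a i| ≤ 1
  ψT_le : ∀ h < H, ∀ s i, |ψT h s i| ≤ 1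
  φE_le : ∀ h < H, ∀ s i, |φE h s i| ≤ 1
  ψE_le : ∀ h < H, ∀ o i, |ψE h o i| ≤ 1
  φμ_le : ∀ s i, |φμ s i| ≤ 1

/-- The POMDP is linear with respect to the given features: transitions, emissions and the initial
distribution are given by parameters `B₁`, `B₂`, `θ` all of whose entries are at most `1` in
absolute value. -/
def POMDP.IsLinear {S O A : Type*} [Fintype S] [Fintype O] {H d₁ d₂ d₃ d₄ d₅ : ℕ}
    (M : POMDP S O A) (feat : LinearFeatures S O A H d₁ d₂ d₃ d₄ d₅) : Prop :=
  ∃ (B₁ : ℕ → Matrix (Fin d₂) (Fin d₁) ℝ) (B₂ : ℕ → Matrix (Fin d₄) (Fin d₃) ℝ) (θ : Fin d₅ → ℝ),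
    (∀ h < H, ∀ i j, |B₁ h i j| ≤ 1) ∧ (∀ h < H, ∀ i j, |B₂ h i j| ≤ 1) ∧ (∀ i, |θ i| ≤ 1) ∧
    (∀ h < H, ∀ s a s', M.T h s a s' = feat.ψT h s' ⬝ᵥ (B₁ h).mulVec (feat.φT h s a)) ∧
    (∀ h < H, ∀ s o, M.E h s o = feat.ψE h o ⬝ᵥ (B₂ h).mulVec (feat.φE h s)) ∧
    (∀ s, M.μ s = θ ⬝ᵥ feat.φμ s)

/-! ### Values -/

section Learning

variable {S O A : Type*} [Fintype S] [Fintype O] [Fintype A]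

/-- `π(τ_H)`, the probability that `π` picks the actions of `τ`, given its observations. -/
noncomputable def Policy.prob {H : ℕ} (π : Policy O A) (τ : Traj O A H) : ℝ :=
  ∏ h : Fin H, π.act ((List.ofFn τ).take h) (τ h).1 (τ h).2

/-- `ℙ^π(τ_H)`, the probability of a trajectory under a model and a policy. -/
noncomputable def POMDP.trajProb {H : ℕ} (M : POMDP S O A) (π : Policy O A) (τ : Traj O A H) : ℝ :=
  M.prob (List.ofFn τ) * π.prob τ

/-- The expected cumulative reward for a distribution `p` of trajectories. -/
noncomputable def expReward {H : ℕ} (r : ℕ → O → A → ℝ) (p : Traj O A H → ℝ) : ℝ :=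
  ∑ τ, p τ * ∑ h : Fin H, r h (τ h).1 (τ h).2

/-- The value of a policy under a model. -/
noncomputable def POMDP.value (M : POMDP S O A) (H : ℕ) (r : ℕ → O → A → ℝ) (π : Policy O A) : ℝ :=
  expReward r fun τ : Traj O A H => M.trajProb π τ

/-- The optimal value `V^*`. -/
noncomputable def POMDP.optValue (M : POMDP S O A) (H : ℕ) (r : ℕ → O → A → ℝ) : ℝ :=
  ⨆ π : Policy O A, M.value H r π

/-- The value of the uniform mixture of the policies `π 0, …, π (K - 1)`, which picks one of them
uniformly at random and executes it for the whole episode. -/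
noncomputable def POMDP.mixtureValue (M : POMDP S O A) (H : ℕ) (r : ℕ → O → A → ℝ) {K : ℕ}
    (π : Fin K → Policy O A) : ℝ :=
  expReward r fun τ : Traj O A H => (∑ k, M.trajProb (π k) τ) / K

/-! ### The `ε`-bracket number -/

/-- There is a size-`N` `ε`-bracket for the trajectory distributions of the models in `F`. -/
def HasBracket (F : Set (POMDP S O A)) (H : ℕ) (ε : ℝ) (N : ℕ) : Prop :=
  ∃ g₁ g₂ : Fin N → Policy O A → Traj O A H → ℝ,
    (∀ i π, ∑ τ, |g₁ i π τ - g₂ i π τ| ≤ ε) ∧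
    ∀ M ∈ F, ∃ i, ∀ π τ, g₁ i π τ ≤ M.trajProb π τ ∧ M.trajProb π τ ≤ g₂ i π τ

/-- The `ε`-bracket number. -/
noncomputable def bracketNumber (F : Set (POMDP S O A)) (H : ℕ) (ε : ℝ) : ℕ :=
  sInf {N | HasBracket F H ε N}

/-! ### The algorithm CRANE -/

/-- In every iteration one trajectory is collected for each `h ∈ {0, …, H - m}` and each action
sequence of the `m`-step futures. -/
abbrev Query (A : Type*) (H m : ℕ) := Fin (H - m + 1) × (Fin (m - 1) → A)

/-- The trajectories collected in one iteration. -/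
abbrev Batch (O A : Type*) (H m : ℕ) := Query A H m → Traj O A H

open Classical in
/-- The exploration policy for the query `(h, u)`: follow `π` in the first `h - 1` steps, act
uniformly at random in the `h`-th step, execute the action sequence `u` in the next `m - 1` steps,
and act uniformly at random from then on. -/
noncomputable def explore [Nonempty A] {H m : ℕ} (π : Policy O A) (q : Query A H m) :
    Policy O A where
  act τ o a :=
    if τ.length + 1 < q.1 then π.act τ o a
    else if hu : (q.1 : ℕ) ≤ τ.length ∧ τ.length - q.1 < m - 1 then
      if a = q.2 ⟨τ.length - q.1, hu.2⟩ then 1 else 0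
    else 1 / Fintype.card A
  act_nonneg τ o a := by
    split_ifs
    · exact π.act_nonneg _ _ _
    · exact zero_le_one
    · exact le_rfl
    · positivity
  act_sum τ o := by
    split_ifs
    · exact π.act_sum _ _
    · simp
    · simp

/-- A run of the algorithm is described by the choice of a model `f^k` and a policy `π^k` as
functions of the trajectories of the previous iterations. -/
abbrev Selector (S O A : Type*) [Fintype S] [Fintype O] [Fintype A] (H m : ℕ) :=
  List (Batch O A H m) → POMDP S O A × Policy O A

variable [Nonempty A] {H m : ℕ}

/-- The policy used in iteration `k` for the query `q` when the data are `D`. -/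
noncomputable def Selector.queryPolicy (sel : Selector S O A H m) (D : List (Batch O A H m))
    (k : ℕ) (q : Query A H m) : Policy O A :=
  explore (sel (D.take k)).2 q

/-- The log-likelihood of the model `f` on the data `D`; it is `⊥` if `D` is impossible under
`f`. -/
noncomputable def Selector.logLik (sel : Selector S O A H m) (D : List (Batch O A H m))
    (f : POMDP S O A) : EReal :=
  ∑ k : Fin D.length, ∑ q,
    ENNReal.log (ENNReal.ofReal (f.trajProb (sel.queryPolicy D k q) (D.get k q)))

/-- The confidence set: the models whose log-likelihood is within `β` of the maximum over `F`. -/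
def Selector.confSet (sel : Selector S O A H m) (F : Set (POMDP S O A)) (β : ℝ)
    (D : List (Batch O A H m)) : Set (POMDP S O A) :=
  {f | f ∈ F ∧ ∀ f' ∈ F, sel.logLik D f' ≤ sel.logLik D f + (β : EReal)}

/-- Optimistic planning: after the data `D`, the selected pair maximizes the value over all models
in the confidence set and all policies. -/
def Selector.IsOptimistic (sel : Selector S O A H m) (F : Set (POMDP S O A)) (r : ℕ → O → A → ℝ)
    (β : ℝ) (D : List (Batch O A H m)) : Prop :=
  (sel D).1 ∈ sel.confSet F β D ∧
    ∀ f ∈ sel.confSet F β D, ∀ π, f.value H r π ≤ (sel D).1.value H r (sel D).2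

/-- The probability that the trajectories collected in `K` iterations are `ω`, if `M` is the true
model: given the past, the trajectories of an iteration are drawn independently. -/
noncomputable def Selector.runProb (sel : Selector S O A H m) (M : POMDP S O A) {K : ℕ}
    (ω : Fin K → Batch O A H m) : ℝ :=
  ∏ k : Fin K, ∏ q, M.trajProb (sel.queryPolicy (List.ofFn ω) k q) (ω k q)

/-- `sel` is an execution of CRANE for `K` iterations with class `F` and parameter `β`, when the
true model is `M`: on all runs that can occur, every selection is optimistic. -/
def Selector.IsCrane (sel : Selector S O A H m) (M : POMDP S O A) (F : Set (POMDP S O A))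
    (r : ℕ → O → A → ℝ) (β : ℝ) (K : ℕ) : Prop :=
  ∀ ω : Fin K → Batch O A H m, 0 < sel.runProb M ω →
    ∀ k : Fin K, sel.IsOptimistic F r β ((List.ofFn ω).take k)

/-- The policy `π^k` of iteration `k` on the run `ω`. -/
def Selector.policyAt (sel : Selector S O A H m) {K : ℕ} (ω : Fin K → Batch O A H m) (k : Fin K) :
    Policy O A :=
  (sel ((List.ofFn ω).take k)).2

open Classical in
/-- The probability that the uniform mixture of the policies of `K` iterations is `ε`-optimal. -/
noncomputable def Selector.successProb (sel : Selector S O A H m) (M : POMDP S O A)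
    (r : ℕ → O → A → ℝ) (K : ℕ) (ε : ℝ) : ℝ :=
  ∑ ω : Fin K → Batch O A H m,
    if M.optValue H r - ε ≤ M.mixtureValue H r (sel.policyAt ω) then sel.runProb M ω else 0

variable (A H m) in
/-- The accuracy `ε_b = 1 / (K H |U_A|)`, where `|U_A| = |A|^(m-1)`. -/
noncomputable def bracketScale (K : ℕ) : ℝ := 1 / (K * H * (Fintype.card A : ℝ) ^ (m - 1))

variable (H m) in
/-- The confidence parameter `β = c log (N_F(ε_b) K H |U_A| / δ)`. -/
noncomputable def craneBeta (F : Set (POMDP S O A)) (c δ : ℝ) (K : ℕ) : ℝ :=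
  c * Real.log (bracketNumber F H (bracketScale A H m K) * K * H *
    (Fintype.card A : ℝ) ^ (m - 1) / δ)

variable (H m) in
/-- Every execution of CRANE (up to step `H - m`) for `K` iterations with the above `β` returns an
`ε`-optimal policy with probability at least `1 - δ`, if `M` is the true model. -/
def CraneSucceeds (M : POMDP S O A) (F : Set (POMDP S O A)) (r : ℕ → O → A → ℝ)
    (c δ ε : ℝ) (K : ℕ) : Prop :=
  ∀ sel : Selector S O A H m, sel.IsCrane M F r (craneBeta H m F c δ K) K →
    1 - δ ≤ sel.successProb M r K ε

end Learning

/-! ### Logarithmic covering numbers for classes of low-rank POMDPs -/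

/-- The logarithm of the `ℓ_∞`-covering number at scale `ε` of a totally bounded set. -/
noncomputable def logCover {X : Type*} [PseudoEMetricSpace X] (ε : ℝ) (Y : Set X) : ℝ :=
  Real.log (Metric.externalCoveringNumber ε.toNNReal Y).toNat

section LowRank

variable {S O A : Type*} [Fintype S] [Fintype O] {H d : ℕ}

/-- The feature map `Φ_f` as a function of the step, the state and the action. -/
def LowRankPOMDP.phiFun (f : LowRankPOMDP S O A H d) : Fin H → S → A → Fin d → ℝ :=
  fun h => f.φ h

/-- The feature map `Ψ_f` as a function of the step and the state. -/
def LowRankPOMDP.psiFun (f : LowRankPOMDP S O A H d) : Fin H → S → Fin d → ℝ := fun h => f.ψ h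

/-- The emission `𝕆_f` as a function of the step, the state and the observation. -/
def LowRankPOMDP.emFun (f : LowRankPOMDP S O A H d) : Fin H → S → O → ℝ := fun h => f.E h

/-- The initial distribution of `f`. -/
def LowRankPOMDP.muFun (f : LowRankPOMDP S O A H d) : S → ℝ := f.μ

end LowRank

end PSR

/-!
**Core tests.** Under `m`-step decodability the state in which an `m`-step future ends is a function
of this future. A longer test therefore succeeds with the probability of its first `m` steps, times
a factor that does not depend on the history; a shorter test is a sum of `m`-step futures. Hence the
rows of the `m`-step futures satisfy no linear relation between the columns that the whole dynamics
matrix does not satisfy (`POMDP.IsDecodable.futuresAreCore`).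

**Sample complexity.** All three guarantees follow from `craneSucceeds_of_le`: CRANE with `c = 4`
succeeds as soon as `K ε²` is at least a fixed power of a bound `Y` for all relevant quantities,
provided that the logarithm of the bracket number is polynomial in `Y` and linear in `log K`. Its
ingredients are as follows.

* *Maximum likelihood* (`Selector.exists_good_event`). For the upper end of each bracket, the square
  root of the likelihood ratio to the true model, compensated by the Hellinger distance, is a
  supermartingale. Markov's inequality and a union bound over brackets and iterations show that,
  outside an event of probability `δ`, the true model stays in every confidence set, and every model
  in a confidence set is close to it, in squared total variation, on all past exploration policies.
* *Observable operators* (`CoreData.sum_abs_sub_le`). By regularity, the probabilities of the futures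
  after any history are combinations of those after the core histories, with coefficients bounded
  in `ℓ¹`. This gives operators that update the vector of future probabilities by one observation
  and action. Telescoping bounds the total variation distance of two models under a policy by the
  averages under this policy of the one-step errors of these operators, and these errors are
  controlled by the total variation under the exploration policies (`CoreData.sum_seq_err_le`).
* *Elliptical potential* (`sum_avg_abs_le`). The one-step error after a history is a sum of absolute
  values of linear functionals in at most `d_PSR` coordinates of the history. The sum over
  exponentially many functionals is replaced, up to factors in the dimension, by a sum over a
  barycentric spanner of them (`exists_spanner`). Small errors on past policies then imply small
  errors on average on the next one.
* *Optimism* turns the resulting bound for `∑ₖ TV(f^k, f^*)` under `π^k` into a regret bound.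

**Bracket numbers.** A partition of the class into cells of similar models gives brackets
(`hasBracket_of_cells`). In the tabular and the linear case the kernels of all models lie in a space
whose dimension is the number of parameters. The cells come from rounding the coefficients with
respect to a barycentric spanner that consists of members of the class; differences within a cell
are then combinations of probability kernels, so that they are small in total variation whatever
the number of states is. In the low-rank case, cells come from the given covers, which only control
the entries of the kernels. A bound without the number of states holds since, for decodable
models, the filter has at most one nonzero summand per observation and is stable in the sup norm
(`POMDP.IsDecodable.abs_belief_sub_le`).
-/

namespace PSR

/-! ### Sums over histories of a fixed length -/

/-- The sum of `g` over all lists of length `n`. -/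
noncomputable def sumLists {X : Type*} [Fintype X] (n : ℕ) (g : List X → ℝ) : ℝ :=
  ∑ f : Fin n → X, g (List.ofFn f)

section SumLists

variable {X : Type*} [Fintype X]

@[simp]
lemma sumLists_zero (g : List X → ℝ) : sumLists 0 g = g [] := by
  simp [sumLists]

lemma sumLists_succ (n : ℕ) (g : List X → ℝ) :
    sumLists (n + 1) g = ∑ x, sumLists n fun l => g (x :: l) := by
  unfold sumLists
  rw [← (Fin.consEquiv fun _ : Fin (n + 1) => X).sum_comp, Fintype.sum_prod_type]
  simp [Fin.consEquiv, List.ofFn_succ]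

lemma sumLists_add (n k : ℕ) (g : List X → ℝ) :
    sumLists (n + k) g = sumLists n fun a => sumLists k fun b => g (a ++ b) := by
  induction n generalizing g with
  | zero => simp
  | succ n ih =>
    rw [Nat.add_right_comm, sumLists_succ, sumLists_succ]
    simp [ih]

lemma sumLists_eq_sub_one {n : ℕ} (hn : 1 ≤ n) (g : List X → ℝ) :
    sumLists n g = sumLists (n - 1) fun a => sumLists 1 fun b => g (a ++ b) := by
  rw [← sumLists_add, Nat.sub_add_cancel hn]

lemma sumLists_congr {n : ℕ} {g g' : List X → ℝ} (h : ∀ l, l.length = n → g l = g' l) :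
    sumLists n g = sumLists n g' :=
  Finset.sum_congr rfl fun f _ => h _ (by simp)

lemma sumLists_le_sumLists {n : ℕ} {g g' : List X → ℝ} (h : ∀ l, l.length = n → g l ≤ g' l) :
    sumLists n g ≤ sumLists n g' :=
  Finset.sum_le_sum fun f _ => h _ (by simp)

lemma sumLists_nonneg {n : ℕ} {g : List X → ℝ} (h : ∀ l, l.length = n → 0 ≤ g l) :
    0 ≤ sumLists n g :=
  Finset.sum_nonneg fun f _ => h _ (by simp)

lemma mul_sumLists (n : ℕ) (a : ℝ) (g : List X → ℝ) :
    a * sumLists n g = sumLists n fun l => a * g l :=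
  Finset.mul_sum _ _ _

lemma sumLists_add_distrib (n : ℕ) (g g' : List X → ℝ) :
    sumLists n (fun l => g l + g' l) = sumLists n g + sumLists n g' :=
  Finset.sum_add_distrib

lemma sumLists_sum {ι : Type*} (s : Finset ι) (n : ℕ) (g : ι → List X → ℝ) :
    sumLists n (fun l => ∑ i ∈ s, g i l) = ∑ i ∈ s, sumLists n (g i) :=
  Finset.sum_comm

lemma abs_sumLists_le (n : ℕ) (g : List X → ℝ) :
    |sumLists n g| ≤ sumLists n fun l => |g l| :=
  Finset.abs_sum_le_sum_abs _ _

end SumLists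

/-! ### Policies along a history, and processes of observations -/

section Policy

variable {O A : Type*} [Fintype A]

lemma Policy.act_le_one (π : Policy O A) (τ : List (O × A)) (o : O) (a : A) :
    π.act τ o a ≤ 1 := by
  rw [← π.act_sum τ o]
  exact Finset.single_le_sum (fun a _ => π.act_nonneg τ o a) (Finset.mem_univ a)

/-- The probability that `π`, after the history `τ`, picks the actions of `l` when it sees the
observations of `l`. -/
def Policy.seq (π : Policy O A) : List (O × A) → List (O × A) → ℝ
  | _, [] => 1
  | τ, x :: l => π.act τ x.1 x.2 * π.seq (τ ++ [x]) l

@[simp]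
lemma Policy.seq_nil (π : Policy O A) (τ : List (O × A)) : π.seq τ [] = 1 := rfl

@[simp]
lemma Policy.seq_cons (π : Policy O A) (τ l : List (O × A)) (x : O × A) :
    π.seq τ (x :: l) = π.act τ x.1 x.2 * π.seq (τ ++ [x]) l := rfl

lemma Policy.seq_append (π : Policy O A) (τ l l' : List (O × A)) :
    π.seq τ (l ++ l') = π.seq τ l * π.seq (τ ++ l) l' := by
  induction l generalizing τ with
  | nil => simp
  | cons x l ih => simp [ih, mul_assoc]

lemma Policy.seq_nonneg (π : Policy O A) (τ l : List (O × A)) : 0 ≤ π.seq τ l := by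
  induction l generalizing τ with
  | nil => simp
  | cons x l ih => exact mul_nonneg (π.act_nonneg _ _ _) (ih _)

lemma Policy.seq_le_one (π : Policy O A) (τ l : List (O × A)) : π.seq τ l ≤ 1 := by
  induction l generalizing τ with
  | nil => simp
  | cons x l ih => exact mul_le_one₀ (π.act_le_one _ _ _) (π.seq_nonneg _ _) (ih _)

lemma Policy.seq_ofFn (π : Policy O A) (τ : List (O × A)) {n : ℕ} (f : Fin n → O × A) :
    π.seq τ (List.ofFn f) =
      ∏ h : Fin n, π.act (τ ++ (List.ofFn f).take h) (f h).1 (f h).2 := by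
  induction n generalizing τ with
  | zero => simp
  | succ n ih => simp [List.ofFn_succ, Fin.prod_univ_succ, ih]

lemma Policy.prob_eq_seq (π : Policy O A) {H : ℕ} (τ : Traj O A H) :
    π.prob τ = π.seq [] (List.ofFn τ) := by
  simp [Policy.prob, Policy.seq_ofFn]

end Policy

variable {O A : Type*} [Fintype O]

/-- A (signed) process of observations: `q l` does not depend on the last action of `l`, and the
values at the continuations of `l` by one action and all observations add up to `q l`. -/
structure IsProcess (q : List (O × A) → ℝ) : Prop where
  indep : ∀ l o a a', q (l ++ [(o, a)]) = q (l ++ [(o, a')])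
  sum : ∀ l a, ∑ o, q (l ++ [(o, a)]) = q l

namespace IsProcess

variable {q q' : List (O × A) → ℝ}

lemma sub (hq : IsProcess q) (hq' : IsProcess q') : IsProcess fun l => q l - q' l where
  indep l o a a' := by rw [hq.indep l o a a', hq'.indep l o a a']
  sum l a := by rw [Finset.sum_sub_distrib, hq.sum, hq'.sum]

lemma shift_div (hq : IsProcess q) (c : List (O × A)) (r : ℝ) :
    IsProcess fun l => q (c ++ l) / r where
  indep l o a a' := by
    rw [← List.append_assoc, ← List.append_assoc, hq.indep _ o a a']
  sum l a := by
    simp only [← List.append_assoc]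
    rw [← Finset.sum_div, hq.sum]

lemma shift (hq : IsProcess q) (c : List (O × A)) : IsProcess fun l => q (c ++ l) := by
  simpa using hq.shift_div c 1

variable [Fintype A] [Nonempty A]

/-- Under any policy, a process has constant total mass. -/
lemma sum_seq (hq : IsProcess q) (π : Policy O A) (τ : List (O × A)) (n : ℕ) :
    sumLists n (fun l => π.seq τ l * q l) = q [] := by
  induction n generalizing q τ with
  | zero => simp
  | succ n ih =>
    rw [sumLists_succ]
    have h1 : ∀ x : O × A, sumLists n (fun l => π.seq τ (x :: l) * q (x :: l)) =
        π.act τ x.1 x.2 * q [x] := by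
      intro x
      have := ih (q := fun l => q ([x] ++ l)) (hq.shift [x]) (τ ++ [x])
      simp only [Policy.seq_cons, mul_assoc]
      rw [← mul_sumLists]
      simpa using congrArg (π.act τ x.1 x.2 * ·) this
    simp only [h1]
    rw [Fintype.sum_prod_type]
    obtain ⟨a₀⟩ := ‹Nonempty A›
    calc ∑ o, ∑ a, π.act τ o a * q [(o, a)] = ∑ o, q [(o, a₀)] := by
          refine Finset.sum_congr rfl fun o _ => ?_
          have : ∀ a, q [(o, a)] = q [(o, a₀)] := fun a => hq.indep [] o a a₀
          simp only [this, ← Finset.sum_mul, π.act_sum, one_mul]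
      _ = q [] := hq.sum [] a₀

/-- Truncating the horizon decreases the total variation of a process under a policy. -/
lemma sum_seq_abs_le (hq : IsProcess q) (π : Policy O A) (n k : ℕ) :
    sumLists n (fun l => π.seq [] l * |q l|) ≤ sumLists (n + k) fun l => π.seq [] l * |q l| := by
  rw [sumLists_add]
  refine sumLists_le_sumLists fun l _ => ?_
  simp only [Policy.seq_append, mul_assoc, List.nil_append]
  rw [← mul_sumLists]
  refine mul_le_mul_of_nonneg_left ?_ (π.seq_nonneg _ _)
  have h := (hq.shift l).sum_seq π l k
  simp only [List.append_nil] at h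
  rw [← h]
  refine (abs_sumLists_le _ _).trans (le_of_eq (sumLists_congr fun b _ => ?_))
  rw [abs_mul, abs_of_nonneg (π.seq_nonneg _ _)]

end IsProcess

/-- The total weight that a policy gives to all histories of length `n` is the number of sequences
of `n` observations. -/
lemma Policy.sum_seq_eq_pow [Fintype A] (π : Policy O A) (τ : List (O × A)) (n : ℕ) :
    sumLists n (fun l => π.seq τ l) = (Fintype.card O : ℝ) ^ n := by
  induction n generalizing τ with
  | zero => simp
  | succ n ih =>
    rw [sumLists_succ]
    simp only [Policy.seq_cons, ← mul_sumLists, ih, ← Finset.sum_mul]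
    rw [Fintype.sum_prod_type]
    simp [π.act_sum, pow_succ, mul_comm]

/-! ### Observation probabilities of a model -/

section Model

variable {S O A : Type*} [Fintype S] [Fintype O] (M : POMDP S O A)

namespace POMDP

lemma filter_append (h : ℕ) (b : S → ℝ) (l l' : List (O × A)) :
    M.filter h b (l ++ l') = M.filter (h + l.length) (M.filter h b l) l' := by
  induction l generalizing h b with
  | nil => simp [filter]
  | cons x l ih => simp [filter, ih, add_assoc, add_comm 1]

lemma filter_smul (h : ℕ) (r : ℝ) (b : S → ℝ) (l : List (O × A)) :
    M.filter h (fun s => r * b s) l = fun s => r * M.filter h b l s := by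
  induction l generalizing h b with
  | nil => rfl
  | cons x l ih =>
    simp only [filter, mul_assoc, ← Finset.mul_sum]
    simpa only [mul_assoc] using ih (h + 1) fun s' => ∑ s, b s * M.E h s x.1 * M.T h s x.2 s'

lemma belief_append (l l' : List (O × A)) :
    M.belief (l ++ l') = M.filter l.length (M.belief l) l' := by
  simp [belief, filter_append]

lemma belief_concat (l : List (O × A)) (o : O) (a : A) (s' : S) :
    M.belief (l ++ [(o, a)]) s' =
      ∑ s, M.belief l s * M.E l.length s o * M.T l.length s a s' := by
  simp [belief_append, filter]

lemma belief_nonneg (l : List (O × A)) (s : S) : 0 ≤ M.belief l s := by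
  induction l using List.reverseRecOn generalizing s with
  | nil => exact M.μ_nonneg s
  | append_singleton l x ih =>
    rw [belief_concat]
    exact Finset.sum_nonneg fun s' _ =>
      mul_nonneg (mul_nonneg (ih s') (M.E_nonneg _ _ _)) (M.T_nonneg _ _ _ _)

lemma prob_nonneg (l : List (O × A)) : 0 ≤ M.prob l :=
  Finset.sum_nonneg fun s _ => M.belief_nonneg l s

@[simp]
lemma prob_nil : M.prob [] = 1 := M.μ_sum

lemma prob_concat (l : List (O × A)) (o : O) (a : A) :
    M.prob (l ++ [(o, a)]) = ∑ s, M.belief l s * M.E l.length s o := by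
  simp only [prob, belief_concat]
  rw [Finset.sum_comm]
  simp [← Finset.mul_sum, M.T_sum]

lemma isProcess_prob : IsProcess M.prob where
  indep l o a a' := by rw [prob_concat, prob_concat]
  sum l a := by
    simp only [prob_concat]
    rw [Finset.sum_comm]
    simp [← Finset.mul_sum, M.E_sum, prob]

lemma prob_append_eq_zero {l : List (O × A)} (h : M.prob l = 0) (l' : List (O × A)) :
    M.prob (l ++ l') = 0 := by
  have hb : M.belief l = fun s => 0 * M.belief l s := by
    ext s
    rw [zero_mul]
    exact (Finset.sum_eq_zero_iff_of_nonneg fun s _ => M.belief_nonneg l s).1 h s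
      (Finset.mem_univ s)
  rw [prob, belief_append, hb, filter_smul]
  simp

lemma sum_mul_testFrom (h : ℕ) (b : S → ℝ) (w : List (O × A)) (o : O) :
    ∑ s, b s * M.testFrom h s w o = ∑ s, M.filter h b w s * M.E (h + w.length) s o := by
  induction w generalizing h b with
  | nil => simp [testFrom, filter]
  | cons x w ih =>
    simp only [testFrom, filter, List.length_cons]
    rw [← add_assoc, add_right_comm, ← ih]
    simp only [Finset.mul_sum, Finset.sum_mul]
    rw [Finset.sum_comm]
    refine Finset.sum_congr rfl fun s' _ => Finset.sum_congr rfl fun s _ => by ring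

lemma testProb_eq (τ w : List (O × A)) (o : O) (a : A) :
    M.testProb τ (w, o) = M.prob (τ ++ (w ++ [(o, a)])) / M.prob τ := by
  rw [testProb, sum_mul_testFrom, ← List.append_assoc, prob_concat, belief_append,
    List.length_append]

lemma prob_mul_testProb (τ w : List (O × A)) (o : O) (a : A) :
    M.prob τ * M.testProb τ (w, o) = M.prob (τ ++ (w ++ [(o, a)])) := by
  rw [M.testProb_eq τ w o a]
  rcases eq_or_ne (M.prob τ) 0 with h | h
  · simp [h, M.prob_append_eq_zero h]
  · exact mul_div_cancel₀ _ h

lemma prob_le_one [Nonempty A] (l : List (O × A)) : M.prob l ≤ 1 := by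
  induction l using List.reverseRecOn with
  | nil => simp
  | append_singleton l x ih =>
    refine le_trans ?_ ih
    rw [← M.isProcess_prob.sum l x.2]
    exact Finset.single_le_sum (f := fun o => M.prob (l ++ [(o, x.2)]))
      (fun o _ => M.prob_nonneg _) (Finset.mem_univ x.1)

end POMDP

end Model

/-! ### Core tests -/

section Core

variable {S O A : Type*} [Fintype S] [Fintype O] [Fintype A] {M : POMDP S O A} {H m h : ℕ}

/-- The rank of the rows `U` only depends on the linear relations between their columns. -/
lemma POMDP.isCoreTestSet_iff {U : Set (Test O A)} :
    M.IsCoreTestSet H h U ↔ U ⊆ tests O A H h ∧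
      ∀ y : (Fin h → O × A) → ℝ, (∀ t ∈ U, ∑ τ, M.testProb (List.ofFn τ) t * y τ = 0) →
        ∀ t ∈ tests O A H h, ∑ τ, M.testProb (List.ofFn τ) t * y τ = 0 := by
  refine and_congr_right fun hU => ?_
  have mem_ker : ∀ (V : Set (Test O A)) (y : (Fin h → O × A) → ℝ),
      y ∈ LinearMap.ker (M.dynMatrix h V).mulVecLin ↔
        ∀ t ∈ V, ∑ τ, M.testProb (List.ofFn τ) t * y τ = 0 := by
    intro V y
    simp [LinearMap.mem_ker, funext_iff, dynMatrix, Matrix.mulVec, dotProduct]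
  have hle : LinearMap.ker (M.dynMatrix h (tests O A H h)).mulVecLin ≤
      LinearMap.ker (M.dynMatrix h U).mulVecLin := fun y hy =>
    (mem_ker _ _).2 fun t ht => (mem_ker _ _).1 hy t (hU ht)
  have h1 := (M.dynMatrix h (tests O A H h)).mulVecLin.finrank_range_add_finrank_ker
  have h2 := (M.dynMatrix h U).mulVecLin.finrank_range_add_finrank_ker
  rw [psrRankAt, Matrix.rank, Matrix.rank]
  constructor
  · intro heq y hy t ht
    have := Submodule.eq_of_le_of_finrank_eq hle (by omega)
    exact (mem_ker _ _).1 (this ▸ (mem_ker _ _).2 hy) t ht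
  · intro hk
    have : LinearMap.ker (M.dynMatrix h (tests O A H h)).mulVecLin =
        LinearMap.ker (M.dynMatrix h U).mulVecLin :=
      le_antisymm hle fun y hy => (mem_ker _ _).2 (hk y ((mem_ker _ _).1 hy))
    rw [this] at h1
    omega

/-- Under decodability, the state in which an `m`-step future ends is a function of this future, so
a longer test succeeds with the probability of its first `m` steps, times a factor that does not
depend on the history. Shorter tests are sums of `m`-step futures. -/
theorem POMDP.IsDecodable.futuresAreCore [Nonempty A] (hm : 1 ≤ m) (hdec : M.IsDecodable H m) :
    M.FuturesAreCore H m := by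
  obtain ⟨a₀⟩ := ‹Nonempty A›
  intro h hh
  refine isCoreTestSet_iff.2 ⟨?_, fun y hy => ?_⟩
  · rintro _ ⟨u, rfl⟩
    simp only [tests, Future.toTest, Set.mem_ofPred_eq, List.length_ofFn]
    omega
  obtain ⟨dec, hdec⟩ := hdec
  -- a linear relation `y` between the columns, evaluated at all continuations of the histories
  let Q : List (O × A) → ℝ := fun l =>
    ∑ τ : Fin h → O × A, M.prob (List.ofFn τ ++ l) / M.prob (List.ofFn τ) * y τ
  have hQ : IsProcess Q := by
    refine ⟨fun l o a a' => ?_, fun l a => ?_⟩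
    · refine Finset.sum_congr rfl fun τ _ => ?_
      rw [(M.isProcess_prob.shift_div _ _).indep l o a a']
    · simp only [Q]
      rw [Finset.sum_comm]
      refine Finset.sum_congr rfl fun τ _ => ?_
      rw [← Finset.sum_mul, (M.isProcess_prob.shift_div _ _).sum]
  have hQt : ∀ w o a, ∑ τ, M.testProb (List.ofFn τ) (w, o) * y τ = Q (w ++ [(o, a)]) := by
    intro w o a
    simp only [M.testProb_eq _ w o a, Q]
  have hQm : ∀ w o a, w.length = m - 1 → Q (w ++ [(o, a)]) = 0 := by
    intro w o a hw
    rw [← hQt]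
    refine hy _ ⟨(fun i => w.get (i.cast hw.symm), o), ?_⟩
    simp only [Future.toTest, Prod.mk.injEq, and_true]
    conv_rhs => rw [← List.ofFn_get w]
    rw [List.ofFn_congr hw.symm]
    rfl
  have hQshort : ∀ k l, l.length + k = m → Q l = 0 := by
    intro k
    induction k with
    | zero =>
      intro l hl
      obtain ⟨w, x, rfl⟩ := (List.eq_nil_or_concat l).resolve_left
        (by rintro rfl; simp at hl; omega)
      rw [List.concat_eq_append]
      exact hQm w x.1 x.2 (by simp at hl; omega)
    | succ k ih =>
      intro l hl
      rw [← hQ.sum l a₀]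
      exact Finset.sum_eq_zero fun o _ => ih _ (by simp; omega)
  have hQall : ∀ l : List (O × A), Q l = 0 := by
    intro l
    rcases le_or_gt l.length m with hl | hl
    · exact hQshort (m - l.length) l (by omega)
    obtain ⟨w, x, l', rfl, hw⟩ : ∃ w x l', l = w ++ [x] ++ l' ∧ w.length = m - 1 := by
      have hlt : m - 1 < l.length := by omega
      refine ⟨l.take (m - 1), l[m - 1], l.drop m, ?_, by simp; omega⟩
      rw [← List.take_succ_eq_append_getElem hlt]
      simp [Nat.sub_add_cancel hm]
    obtain ⟨o, a⟩ := x
    set s₀ := dec (h + (m - 1)) w o with hs₀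
    -- after the first `m` steps, only the state `s₀` is possible
    have key : ∀ τ : Fin h → O × A, M.prob (List.ofFn τ ++ (w ++ [(o, a)] ++ l')) =
        M.prob (List.ofFn τ ++ (w ++ [(o, a)])) *
          ∑ s, M.filter (h + m) (M.T (h + (m - 1)) s₀ a) l' s := by
      intro τ
      have hlen : (List.ofFn τ ++ w).length = h + (m - 1) := by simp [hw]
      have hz : ∀ s, s ≠ s₀ →
          M.belief (List.ofFn τ ++ w) s * M.E (h + (m - 1)) s o = 0 := by
        intro s hs
        by_contra hne
        refine hs ?_
        have := hdec (h + (m - 1)) (by omega) (List.ofFn τ ++ w) hlen o s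
          (lt_of_le_of_ne (mul_nonneg (M.belief_nonneg _ _) (M.E_nonneg _ _ _)) (Ne.symm hne))
        rw [this, List.rtake, hlen]
        simp [hs₀]
      have hp : M.prob (List.ofFn τ ++ (w ++ [(o, a)])) =
          M.belief (List.ofFn τ ++ w) s₀ * M.E (h + (m - 1)) s₀ o := by
        rw [← List.append_assoc, prob_concat, hlen]
        exact Finset.sum_eq_single s₀ (fun s _ hs => hz s hs) (by simp)
      have hb : M.belief (List.ofFn τ ++ (w ++ [(o, a)])) =
          fun s' => M.prob (List.ofFn τ ++ (w ++ [(o, a)])) * M.T (h + (m - 1)) s₀ a s' := by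
        ext s'
        rw [hp, ← List.append_assoc, belief_concat, hlen]
        refine Finset.sum_eq_single s₀ (fun s _ hs => ?_) (by simp)
        rw [hz s hs, zero_mul]
      rw [← List.append_assoc, prob, belief_append, hb, filter_smul, Finset.mul_sum]
      have : (List.ofFn τ ++ (w ++ [(o, a)])).length = h + m := by simp [hw]; omega
      rw [this]
    have h0 := hQm w o a hw
    simp only [Q] at h0 ⊢
    rw [← zero_mul (∑ s, M.filter (h + m) (M.T (h + (m - 1)) s₀ a) l' s), ← h0, Finset.sum_mul]
    refine Finset.sum_congr rfl fun τ _ => ?_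
    rw [key τ]
    ring
  rintro ⟨w, o⟩ -
  rw [hQt w o a₀, hQall]

/-- The vector of the probabilities to see `τ` and then an `m`-step future. The last action is
irrelevant for a process. -/
noncomputable def futVec [Nonempty A] (p : List (O × A) → ℝ) (τ : List (O × A))
    (u : Future O A m) : ℝ :=
  p (τ ++ (List.ofFn u.1 ++ [(u.2, Classical.arbitrary A)]))

lemma pinv_mul_self {ι : Type*} [Fintype ι] {d : ℕ} {K : Matrix ι (Fin d) ℝ}
    (hK : LinearIndependent ℝ K.transpose) : pinv K * K = 1 := by
  rw [pinv, Matrix.mul_assoc]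
  apply Matrix.nonsing_inv_mul
  rw [← Matrix.isUnit_iff_isUnit_det, ← Matrix.mulVec_injective_iff_isUnit]
  have h1 : Function.Injective K.mulVec := by
    rw [Matrix.mulVec_injective_iff]
    exact hK
  intro v w hvw
  apply h1
  rw [← sub_eq_zero, ← Matrix.mulVec_sub] at hvw ⊢
  have : v - w ∈ LinearMap.ker (K.transpose * K).mulVecLin := hvw
  rw [Matrix.ker_mulVecLin_transpose_mul_self] at this
  simpa using this

/-- In a regular model whose `m`-step futures are core tests, the future after any history is a
combination of the futures after at most `psrRank` core histories, whose coefficients depend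
on the predictive state of the history through a matrix of small norm. -/
theorem POMDP.IsRegular.exists_core [Nonempty A] {α : ℝ} (hm : 1 ≤ m) (hreg : M.IsRegular H m α)
    (hcore : M.FuturesAreCore H m) (hh : h + m ≤ H) :
    ∃ d ≤ M.psrRank H, ∃ (c : Fin d → List (O × A)) (P : Matrix (Fin d) (Future O A m) ℝ),
      (∀ i, (c i).length = h) ∧ OneNormLE P (1 / α) ∧
      ∀ τ, τ.length = h → ∀ l, l ≠ [] → h + l.length ≤ H →
        M.prob (τ ++ l) =
          ∑ i, (P.mulVec (futVec M.prob τ)) i * (M.prob (c i ++ l) / M.prob (c i)) := by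
  obtain ⟨c, hlin, hnorm⟩ := hreg h hh
  classical
  obtain ⟨hsub, hker⟩ := isCoreTestSet_iff.1 (hcore h hh)
  set K := M.coreMatrix m h c with hK
  refine ⟨M.psrRankAt H h, Finset.le_sup (f := M.psrRankAt H) (by simp; omega),
    fun i => List.ofFn (c i), pinv K, by simp, hnorm, ?_⟩
  -- the span of all predictive states has dimension `psrRankAt`
  let D : Matrix (Future O A m) (Fin h → O × A) ℝ :=
    Matrix.of fun u τ => M.testProb (List.ofFn τ) u.toTest
  have hDrank : Module.finrank ℝ (LinearMap.range D.mulVecLin) = M.psrRankAt H h := by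
    have h1 := D.mulVecLin.finrank_range_add_finrank_ker
    have h2 := (M.dynMatrix h (tests O A H h)).mulVecLin.finrank_range_add_finrank_ker
    have : LinearMap.ker D.mulVecLin =
        LinearMap.ker (M.dynMatrix h (tests O A H h)).mulVecLin := by
      ext y
      simp only [LinearMap.mem_ker, Matrix.mulVecLin_apply, funext_iff, Pi.zero_apply,
        Matrix.mulVec, dotProduct, D, Matrix.of_apply, dynMatrix, Subtype.forall]
      constructor
      · intro hy
        refine hker y ?_
        rintro _ ⟨u, rfl⟩
        exact hy u
      · exact fun hy u => hy _ (hsub ⟨u, rfl⟩)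
    rw [this] at h1
    rw [psrRankAt, Matrix.rank]
    omega
  have hspan : Submodule.span ℝ (Set.range K.transpose) = LinearMap.range D.mulVecLin := by
    refine Submodule.eq_of_le_of_finrank_eq ?_ ?_
    · rw [Submodule.span_le]
      rintro _ ⟨i, rfl⟩
      exact ⟨Pi.single (c i) 1, by ext u; simp [D, hK, coreMatrix]⟩
    · rw [hDrank, finrank_span_eq_card hlin, Fintype.card_fin]
  intro τ hτ l hl hlH
  obtain ⟨w, ⟨o, a⟩, rfl⟩ := (List.eq_nil_or_concat l).resolve_left hl
  rw [List.concat_eq_append] at hlH ⊢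
  obtain ⟨τ, rfl⟩ : ∃ f : Fin h → O × A, List.ofFn f = τ := by
    subst hτ
    exact ⟨τ.get, List.ofFn_get τ⟩
  let q : Future O A m → ℝ := fun u => M.testProb (List.ofFn τ) u.toTest
  obtain ⟨y, hy⟩ : ∃ y, K.mulVec y = q := by
    have : q ∈ Submodule.span ℝ (Set.range K.transpose) := by
      rw [hspan]
      exact ⟨Pi.single τ 1, by ext u; simp [D, q]⟩
    have hq : q ∈ LinearMap.range K.mulVecLin := by
      rw [Matrix.range_mulVecLin]
      exact this
    simpa using hq
  have hPq : (pinv K).mulVec q = y := by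
    rw [← hy, Matrix.mulVec_mulVec, pinv_mul_self hlin, Matrix.one_mulVec]
  have hfut : futVec M.prob (List.ofFn τ) = M.prob (List.ofFn τ) • q := by
    ext u
    exact (M.prob_mul_testProb _ _ _ _).symm
  -- the linear relation between the columns holds for all tests
  have hrel := hker (Pi.single τ 1 - ∑ i, y i • Pi.single (c i) 1) ?_ (w, o)
    (by simp [tests] at hlH ⊢; omega)
  · simp only [Pi.sub_apply, Finset.sum_apply, Pi.smul_apply, smul_eq_mul, mul_sub,
      Finset.sum_sub_distrib, Finset.mul_sum] at hrel
    rw [Finset.sum_comm] at hrel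
    simp only [Pi.single_apply, mul_ite, mul_one, mul_zero, Finset.sum_ite_eq',
      Finset.mem_univ, if_true, sub_eq_zero] at hrel
    rw [← M.prob_mul_testProb _ w o a, hrel, hfut, Matrix.mulVec_smul, hPq, Finset.mul_sum]
    refine Finset.sum_congr rfl fun i _ => ?_
    rw [M.testProb_eq _ w o a, Pi.smul_apply, smul_eq_mul]
    ring
  · rintro _ ⟨u, rfl⟩
    simp only [Pi.sub_apply, Finset.sum_apply, Pi.smul_apply, smul_eq_mul, mul_sub,
      Finset.sum_sub_distrib, Finset.mul_sum]
    rw [Finset.sum_comm]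
    simp only [Pi.single_apply, mul_ite, mul_one, mul_zero, Finset.sum_ite_eq',
      Finset.mem_univ, if_true, sub_eq_zero]
    exact (congrFun hy u).symm

end Core

/-! ### Observable operators and the decomposition of the total variation distance -/

section Futures

lemma exists_eq_ofFn_append {O A : Type*} {m : ℕ} {l : List (O × A)} (hm : 1 ≤ m)
    (hl : l.length = m) :
    ∃ (u : Future O A m) (a : A), l = List.ofFn u.1 ++ [(u.2, a)] := by
  obtain ⟨w, x, rfl⟩ := (List.eq_nil_or_concat l).resolve_left
    (by rintro rfl; simp at hl; omega)
  rw [List.concat_eq_append] at hl ⊢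
  have hw : w.length = m - 1 := by simp at hl; omega
  refine ⟨(fun i => w.get (i.cast hw.symm), x.1), x.2, ?_⟩
  congr 1
  conv_lhs => rw [← List.ofFn_get w]
  rw [List.ofFn_congr hw]

variable {O A : Type*} [Fintype O] [Fintype A] {m : ℕ}

lemma sum_future (F : List (O × A) → O → ℝ) :
    ∑ u : Future O A m, F (List.ofFn u.1) u.2 = sumLists (m - 1) fun l => ∑ o, F l o := by
  rw [Fintype.sum_prod_type]
  rfl

lemma IsProcess.sumLists_eq [Nonempty A] {q : List (O × A) → ℝ} (hq : IsProcess q) (n : ℕ) :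
    sumLists n q = (Fintype.card A : ℝ) ^ n * q [] := by
  induction n with
  | zero => simp
  | succ n ih =>
    rw [sumLists_add]
    have : ∀ l, sumLists 1 (fun b => q (l ++ b)) = Fintype.card A * q l := by
      intro l
      rw [sumLists_succ, Fintype.sum_prod_type, Finset.sum_comm]
      simp [hq.sum]
    simp only [this, ← mul_sumLists, ih]
    ring

variable [Nonempty A]

lemma IsProcess.sum_future_eq {q : List (O × A) → ℝ} (hq : IsProcess q) (τ : List (O × A)) :
    ∑ u : Future O A m, futVec q τ u = (Fintype.card A : ℝ) ^ (m - 1) * q τ := by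
  have h := sum_future (m := m)
    fun l o => q (τ ++ (l ++ [(o, Classical.arbitrary A)]))
  simp only [← List.append_assoc] at h
  unfold futVec
  simp only [← List.append_assoc]
  rw [h]
  simp only [hq.sum]
  rw [(hq.shift τ).sumLists_eq]
  simp

lemma IsProcess.sum_cons_future_eq (hm : 1 ≤ m) {q : List (O × A) → ℝ} (hq : IsProcess q)
    (τ : List (O × A)) :
    ∑ x, ∑ u : Future O A m, futVec q (τ ++ [x]) u = (Fintype.card A : ℝ) ^ m * q τ := by
  simp only [hq.sum_future_eq, ← Finset.mul_sum]
  rw [Fintype.sum_prod_type, Finset.sum_comm]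
  simp only [hq.sum, Finset.sum_const, Finset.card_univ, nsmul_eq_mul]
  rw [← mul_assoc, ← pow_succ, Nat.sub_add_cancel hm]

/-- The `m`-step future that a list of observations and actions begins with. -/
noncomputable def futOf [Nonempty O] (m : ℕ) (l : List (O × A)) : Future O A m :=
  (fun i => l.getD i (Classical.arbitrary _), (l.getD (m - 1) (Classical.arbitrary _)).1)

omit [Fintype O] [Fintype A] in
lemma futOf_append [Nonempty O] (u : Future O A m) (a : A) :
    futOf m (List.ofFn u.1 ++ [(u.2, a)]) = u := by
  ext i <;> simp [futOf]

omit [Fintype A] in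
lemma futVec_futOf [Nonempty O] {q : List (O × A) → ℝ} (hq : IsProcess q) (hm : 1 ≤ m)
    (τ : List (O × A)) {l : List (O × A)} (hl : l.length = m) :
    futVec q τ (futOf m l) = q (τ ++ l) := by
  obtain ⟨u, a, rfl⟩ := exists_eq_ofFn_append hm hl
  rw [futOf_append, futVec]
  simpa [List.append_assoc] using
    (hq.shift (τ ++ List.ofFn u.1)).indep [] u.2 (Classical.arbitrary A) a

lemma sum_seq_futOf_le [Nonempty O] (hm : 1 ≤ m) (π : Policy O A) (τ : List (O × A))
    (v : Future O A m → ℝ) :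
    sumLists m (fun l => π.seq τ l * |v (futOf m l)|) ≤ ∑ u, |v u| := by
  obtain ⟨n, rfl⟩ : ∃ n, m = n + 1 := ⟨m - 1, by omega⟩
  rw [sumLists_add, ← Finset.univ_product_univ, Finset.sum_product]
  refine Finset.sum_le_sum fun f _ => ?_
  beta_reduce
  rw [sumLists_succ, Fintype.sum_prod_type]
  refine Finset.sum_le_sum fun o _ => ?_
  have h : ∀ a, futOf (n + 1) (List.ofFn f ++ [(o, a)]) = (f, o) := fun a =>
    futOf_append (m := n + 1) (f, o) a
  simp only [sumLists_zero, Policy.seq_append, Policy.seq_cons, Policy.seq_nil, mul_one, h]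
  rw [← Finset.sum_mul, ← Finset.mul_sum, π.act_sum, mul_one]
  exact mul_le_of_le_one_left (abs_nonneg _) (π.seq_le_one _ _)

end Futures

/-- Core histories `c` after `h` steps, with a matrix `P` of norm at most `C` that turns the vector
of probabilities of futures after any history `τ` into coefficients with which the futures after
`τ` are combinations of those after the core histories. (The condition `eq` is void when no
`m`-step future fits into the rest of the episode.) -/
structure CoreData {O A : Type*} [Fintype O] [Fintype A] [Nonempty A] (p : List (O × A) → ℝ)
    (H m h : ℕ) (C : ℝ) where
  d : ℕ
  c : Fin d → List (O × A)
  P : Matrix (Fin d) (Future O A m) ℝ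
  length_c : ∀ i, (c i).length = h
  norm_le : OneNormLE P C
  eq : h + m ≤ H → ∀ τ, τ.length = h → ∀ l, l ≠ [] → h + l.length ≤ H →
    p (τ ++ l) = ∑ i, P.mulVec (futVec p τ) i * (p (c i ++ l) / p (c i))

namespace CoreData

variable {S O A : Type*} [Fintype S] [Fintype O] [Fintype A] [Nonempty A]
  {f M : POMDP S O A} {H m h : ℕ} {C : ℝ}

lemma sum_seq_le (D : CoreData f.prob H m h C) (π : Policy O A) (τ : List (O × A)) (n : ℕ)
    (i : Fin D.d) :
    sumLists n (fun l => π.seq τ l * (f.prob (D.c i ++ l) / f.prob (D.c i))) ≤ 1 := by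
  rw [(f.isProcess_prob.shift_div (D.c i) _).sum_seq π τ n, List.append_nil]
  exact div_self_le_one _

/-- The observable operator for the observation and action `x`. -/
noncomputable def op (D : CoreData f.prob H m h C) (x : O × A) (v : Future O A m → ℝ)
    (u : Future O A m) : ℝ :=
  ∑ i, D.P.mulVec v i * (futVec f.prob (D.c i ++ [x]) u / f.prob (D.c i))

lemma op_sub (D : CoreData f.prob H m h C) (x : O × A) (v w : Future O A m → ℝ)
    (u : Future O A m) : D.op x (v - w) u = D.op x v u - D.op x w u := by
  simp [op, Matrix.mulVec_sub, sub_mul, Finset.sum_sub_distrib]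

lemma op_sum (D : CoreData f.prob H m h C) (x : O × A) {ι : Type*} (s : Finset ι) (r : ι → ℝ)
    (v : ι → Future O A m → ℝ) (u : Future O A m) :
    D.op x (∑ i ∈ s, r i • v i) u = ∑ i ∈ s, r i * D.op x (v i) u := by
  simp only [op, Matrix.mulVec_sum, Matrix.mulVec_smul, Finset.sum_apply, Pi.smul_apply,
    smul_eq_mul, Finset.mul_sum, Finset.sum_mul]
  rw [Finset.sum_comm]
  simp only [mul_assoc]

lemma op_futVec (D : CoreData f.prob H m h C) (hm : 1 ≤ m) (hh : h + 1 + m ≤ H) (x : O × A)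
    {τ : List (O × A)} (hτ : τ.length = h) :
    D.op x (futVec f.prob τ) = futVec f.prob (τ ++ [x]) := by
  ext u
  rw [op, futVec, List.append_assoc, D.eq (by omega) τ hτ _ (by simp) (by simp; omega)]
  simp only [futVec, List.append_assoc]

/-- All observable operators together are bounded from `ℓ¹` to `ℓ¹`. -/
lemma sum_op_le (D : CoreData f.prob H m h C) (hm : 1 ≤ m) (v : Future O A m → ℝ) :
    ∑ x, ∑ u, |D.op x v u| ≤ (Fintype.card A : ℝ) ^ m * C * ∑ u, |v u| := by
  have hA : (0 : ℝ) ≤ (Fintype.card A : ℝ) ^ m := by positivity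
  have key : ∀ i, ∑ x, ∑ u : Future O A m, futVec f.prob (D.c i ++ [x]) u / f.prob (D.c i) ≤
      (Fintype.card A : ℝ) ^ m := by
    intro i
    simp only [← Finset.sum_div]
    rw [f.isProcess_prob.sum_cons_future_eq hm, mul_div_assoc]
    exact mul_le_of_le_one_right hA (div_self_le_one _)
  calc ∑ x, ∑ u, |D.op x v u|
      ≤ ∑ x, ∑ u, ∑ i, |D.P.mulVec v i| * (futVec f.prob (D.c i ++ [x]) u / f.prob (D.c i)) := by
        refine Finset.sum_le_sum fun x _ => Finset.sum_le_sum fun u _ => ?_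
        refine (Finset.abs_sum_le_sum_abs _ _).trans (le_of_eq ?_)
        refine Finset.sum_congr rfl fun i _ => ?_
        rw [abs_mul, abs_of_nonneg (div_nonneg (f.prob_nonneg _) (f.prob_nonneg _) :
          0 ≤ futVec f.prob (D.c i ++ [x]) u / f.prob (D.c i))]
    _ = ∑ i, |D.P.mulVec v i| *
          ∑ x, ∑ u, futVec f.prob (D.c i ++ [x]) u / f.prob (D.c i) := by
        simp only [Finset.mul_sum]
        rw [Finset.sum_comm]
        simp_rw [Finset.sum_comm (s := (Finset.univ : Finset (Future O A m)))]
        rw [Finset.sum_comm]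
    _ ≤ ∑ i, |D.P.mulVec v i| * (Fintype.card A : ℝ) ^ m :=
        Finset.sum_le_sum fun i _ => mul_le_mul_of_nonneg_left (key i) (abs_nonneg _)
    _ ≤ _ := by
        rw [← Finset.sum_mul, mul_comm, mul_assoc]
        exact mul_le_mul_of_nonneg_left (D.norm_le v) hA

variable [Nonempty O]

/-- The linear functional that gives the probability of the rest `l` of the episode, as a
function of the probabilities of the `m`-step futures. -/
noncomputable def ext (D : CoreData f.prob H m h C) (l : List (O × A)) :
    (Future O A m → ℝ) →ₗ[ℝ] ℝ :=
  if h + m = H then LinearMap.proj (futOf m l)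
  else ∑ i, (f.prob (D.c i ++ l) / f.prob (D.c i)) • (LinearMap.proj i ∘ₗ D.P.mulVecLin)

lemma ext_of_eq (D : CoreData f.prob H m h C) (hh : h + m = H) (l : List (O × A))
    (v : Future O A m → ℝ) : D.ext l v = v (futOf m l) := by
  simp [ext, hh]

lemma ext_of_ne (D : CoreData f.prob H m h C) (hh : h + m ≠ H) (l : List (O × A))
    (v : Future O A m → ℝ) :
    D.ext l v = ∑ i, D.P.mulVec v i * (f.prob (D.c i ++ l) / f.prob (D.c i)) := by
  simp [ext, hh, mul_comm]

lemma ext_futVec (D : CoreData f.prob H m h C) (hm : 1 ≤ m) (hh : h + m ≤ H)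
    {τ l : List (O × A)} (hτ : τ.length = h) (hl : h + l.length = H) :
    D.ext l (futVec f.prob τ) = f.prob (τ ++ l) := by
  by_cases h' : h + m = H
  · rw [D.ext_of_eq h', futVec_futOf f.isProcess_prob hm _ (by omega)]
  · rw [D.ext_of_ne h', D.eq hh τ hτ l (by rintro rfl; simp at hl; omega) hl.le]

/-- Since the futures after the core histories are those of `f`, the probability of the rest of the
episode can be computed after an application of the operator for its first step. -/
lemma ext_cons (D : CoreData f.prob H m h C) (D' : CoreData f.prob H m (h + 1) C) (hm : 1 ≤ m)
    (hh : h + 1 + m ≤ H) {l : List (O × A)} (hl : h + 1 + l.length = H) (x : O × A)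
    (v : Future O A m → ℝ) : D.ext (x :: l) v = D'.ext l (D.op x v) := by
  have hop : D.op x v = ∑ i, (D.P.mulVec v i / f.prob (D.c i)) •
      futVec f.prob (D.c i ++ [x]) := by
    ext u
    simp only [op, Finset.sum_apply, Pi.smul_apply, smul_eq_mul]
    exact Finset.sum_congr rfl fun i _ => by ring
  rw [D.ext_of_ne (by omega), hop, map_sum]
  refine Finset.sum_congr rfl fun i _ => ?_
  rw [map_smul, D'.ext_futVec hm hh (by simp [D.length_c]) hl, smul_eq_mul]
  simp only [List.append_assoc, List.singleton_append]
  ring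

lemma sum_seq_ext_le (D : CoreData f.prob H m h C) (hm : 1 ≤ m) (hC : 0 ≤ C) {n : ℕ}
    (hn : h + (n + m) = H) (π : Policy O A) (τ : List (O × A)) (v : Future O A m → ℝ) :
    sumLists (n + m) (fun l => π.seq τ l * |D.ext l v|) ≤ (1 + C) * ∑ u, |v u| := by
  have hv : 0 ≤ ∑ u, |v u| := Finset.sum_nonneg fun u _ => abs_nonneg _
  rcases Nat.eq_zero_or_pos n with rfl | hpos
  · simp only [D.ext_of_eq (by omega), zero_add]
    refine (sum_seq_futOf_le hm π τ v).trans ?_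
    nlinarith
  · simp only [D.ext_of_ne (by omega)]
    calc sumLists (n + m) (fun l => π.seq τ l *
          |∑ i, D.P.mulVec v i * (f.prob (D.c i ++ l) / f.prob (D.c i))|)
        ≤ sumLists (n + m) (fun l => ∑ i, |D.P.mulVec v i| *
            (π.seq τ l * (f.prob (D.c i ++ l) / f.prob (D.c i)))) := by
          refine sumLists_le_sumLists fun l _ => ?_
          refine (mul_le_mul_of_nonneg_left (Finset.abs_sum_le_sum_abs _ _)
            (π.seq_nonneg _ _)).trans (le_of_eq ?_)
          rw [Finset.mul_sum]
          refine Finset.sum_congr rfl fun i _ => ?_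
          rw [abs_mul, abs_of_nonneg (div_nonneg (f.prob_nonneg _) (f.prob_nonneg _))]
          ring
      _ ≤ ∑ i, |D.P.mulVec v i| := by
          rw [sumLists_sum]
          refine Finset.sum_le_sum fun i _ => ?_
          rw [← mul_sumLists]
          exact mul_le_of_le_one_right (abs_nonneg _) (D.sum_seq_le π τ _ i)
      _ ≤ C * ∑ u, |v u| := D.norm_le v
      _ ≤ _ := by nlinarith

/-- The one-step error after the history `τ` of the observable operators of `f`, when they are
applied to the futures of `M`. -/
noncomputable def err (D : CoreData f.prob H m h C) (M : POMDP S O A) (τ : List (O × A)) : ℝ :=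
  ∑ x, ∑ u, |D.op x (futVec M.prob τ) u - futVec M.prob (τ ++ [x]) u|

/-- Telescoping: after `τ`, the extrapolation by `f` of the futures of `M` deviates from `M` by no more
than the accumulated one-step errors. -/
lemma sum_ext_sub_le (D : ∀ h, CoreData f.prob H m h C) (hm : 1 ≤ m) (hC : 0 ≤ C)
    (π : Policy O A) {e : ℕ → List (O × A) → ℝ} (he : ∀ j τ, e j τ = (D j).err M τ)
    (n h : ℕ) (hn : h + (n + m) = H) (τ : List (O × A)) (hτ : τ.length = h) :
    sumLists (n + m) (fun l => π.seq τ l *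
        |(D h).ext l (futVec M.prob τ) - M.prob (τ ++ l)|) ≤
      (1 + C) * ∑ j ∈ Finset.range n,
        sumLists j fun l => π.seq τ l * e (h + j) (τ ++ l) := by
  induction n generalizing h τ with
  | zero =>
    refine le_of_eq ?_
    rw [Finset.range_zero, Finset.sum_empty, mul_zero]
    refine Finset.sum_eq_zero fun g _ => ?_
    beta_reduce
    rw [(D h).ext_of_eq (by omega), futVec_futOf M.isProcess_prob hm _ (by simp)]
    simp
  | succ n ih =>
    rw [Nat.add_right_comm, sumLists_succ, Finset.sum_range_succ']
    have hx : ∀ x, sumLists (n + m) (fun l => π.seq τ (x :: l) *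
        |(D h).ext (x :: l) (futVec M.prob τ) - M.prob (τ ++ x :: l)|) ≤
        (1 + C) * ((∑ u, |(D h).op x (futVec M.prob τ) u - futVec M.prob (τ ++ [x]) u|) +
          ∑ j ∈ Finset.range n, sumLists j fun l =>
            π.seq τ (x :: l) * e (h + (j + 1)) (τ ++ x :: l)) := by
      intro x
      set v := (D h).op x (futVec M.prob τ) with hv
      set v' := futVec (m := m) M.prob (τ ++ [x]) with hv'
      have h1 := (D (h + 1)).sum_seq_ext_le hm hC (n := n) (by omega) π (τ ++ [x]) (v - v')
      have h2 := ih (h + 1) (by omega) (τ ++ [x]) (by simp [hτ])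
      have h3 : sumLists (n + m) (fun l => π.seq (τ ++ [x]) l *
          |(D h).ext (x :: l) (futVec M.prob τ) - M.prob (τ ++ x :: l)|) ≤
          sumLists (n + m) (fun l => π.seq (τ ++ [x]) l * |(D (h + 1)).ext l (v - v')|) +
          sumLists (n + m) (fun l => π.seq (τ ++ [x]) l *
            |(D (h + 1)).ext l v' - M.prob (τ ++ [x] ++ l)|) := by
        rw [← sumLists_add_distrib]
        refine sumLists_le_sumLists fun l hl => ?_
        rw [(D h).ext_cons (D (h + 1)) hm (by omega) (by omega), ← mul_add]
        refine mul_le_mul_of_nonneg_left ?_ (π.seq_nonneg _ _)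
        rw [map_sub, List.append_assoc, List.singleton_append]
        exact abs_sub_le _ _ _
      have h4 : ∑ j ∈ Finset.range n, sumLists j (fun l =>
            π.seq τ (x :: l) * e (h + (j + 1)) (τ ++ x :: l)) =
          π.act τ x.1 x.2 * ∑ j ∈ Finset.range n, sumLists j fun l =>
            π.seq (τ ++ [x]) l * e (h + 1 + j) (τ ++ [x] ++ l) := by
        rw [Finset.mul_sum]
        refine Finset.sum_congr rfl fun j _ => ?_
        rw [mul_sumLists]
        refine sumLists_congr fun l _ => ?_
        rw [Policy.seq_cons, mul_assoc, List.append_assoc, List.singleton_append]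
        rw [show h + (j + 1) = h + 1 + j by omega]
      rw [h4]
      simp only [Policy.seq_cons, mul_assoc]
      rw [← mul_sumLists]
      have ha := π.act_nonneg τ x.1 x.2
      have ha' := π.act_le_one τ x.1 x.2
      have hs : 0 ≤ ∑ u, |(v - v') u| := Finset.sum_nonneg fun u _ => abs_nonneg _
      refine (mul_le_mul_of_nonneg_left (h3.trans (add_le_add h1 h2)) ha).trans ?_
      rw [mul_add, mul_add, mul_left_comm _ (1 + C), mul_left_comm _ (1 + C)]
      gcongr
      exact mul_le_of_le_one_left hs ha'
    refine (Finset.sum_le_sum fun x _ => hx x).trans (le_of_eq ?_)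
    rw [← Finset.mul_sum, Finset.sum_add_distrib, add_comm (∑ x, _), Finset.sum_comm]
    congr 2
    · refine Finset.sum_congr rfl fun j _ => ?_
      rw [sumLists_succ]
    · simp [he, err]

/-- The total variation distance between two models under a policy is controlled by the one-step
errors of the observable operators of one model on the futures of the other. -/
theorem sum_abs_sub_le (D : ∀ h, CoreData f.prob H m h C) (hm : 1 ≤ m) (hmH : m ≤ H) (hC : 0 ≤ C)
    (M : POMDP S O A) (π : Policy O A) :
    sumLists H (fun l => π.seq [] l * |f.prob l - M.prob l|) ≤
      (1 + C) * (∑ u : Future O A m, |futVec f.prob [] u - futVec M.prob [] u| +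
        ∑ j ∈ Finset.range (H - m), sumLists j fun l => π.seq [] l * (D j).err M l) := by
  have h1 := (D 0).sum_seq_ext_le hm hC (n := H - m) (by omega) π []
    (futVec f.prob [] - futVec M.prob [])
  obtain ⟨e, he⟩ : ∃ e : ℕ → List (O × A) → ℝ, ∀ j τ, e j τ = (D j).err M τ :=
    ⟨_, fun _ _ => rfl⟩
  have h2 := sum_ext_sub_le D hm hC π he (H - m) 0 (by omega) [] rfl
  rw [Nat.sub_add_cancel hmH] at h1 h2
  simp only [List.nil_append, zero_add] at h2
  simp only [← he]
  rw [mul_add]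
  refine le_trans ?_ (add_le_add h1 h2)
  rw [← sumLists_add_distrib]
  refine sumLists_le_sumLists fun l hl => ?_
  rw [← mul_add]
  refine mul_le_mul_of_nonneg_left ?_ (π.seq_nonneg _ _)
  rw [map_sub, (D 0).ext_futVec hm (by omega) rfl (by omega), List.nil_append]
  exact abs_sub_le _ _ _

end CoreData

/-! ### Errors under the exploration policies -/

section Explore

variable {S O A : Type*} [Fintype S] [Fintype O] [Fintype A] [Nonempty A] {H m : ℕ}

/-- The total variation distance (without the factor `1/2`) of the trajectories of two models under
a policy. -/
noncomputable def tvDist (H : ℕ) (f M : POMDP S O A) (π : Policy O A) : ℝ :=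
  sumLists H fun l => π.seq [] l * |f.prob l - M.prob l|

omit [Nonempty A] in
lemma tvDist_nonneg (f M : POMDP S O A) (π : Policy O A) : 0 ≤ tvDist H f M π :=
  sumLists_nonneg fun _ _ => mul_nonneg (π.seq_nonneg _ _) (abs_nonneg _)

omit [Fintype O] in
lemma explore_act_of_lt (π : Policy O A) (q : Query A H m) (τ : List (O × A)) (o : O) (a : A)
    (hτ : τ.length + 1 < q.1) : (explore π q).act τ o a = π.act τ o a := by
  simp [explore, hτ]

omit [Fintype O] in
lemma explore_seq_of_lt (π : Policy O A) (q : Query A H m) (τ : List (O × A))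
    (hτ : τ.length < q.1) : (explore π q).seq [] τ = π.seq [] τ := by
  induction τ using List.reverseRecOn with
  | nil => rfl
  | append_singleton τ x ih =>
    simp only [List.length_append, List.length_singleton] at hτ
    rw [Policy.seq_append, Policy.seq_append, ih (by omega), Policy.seq_cons, Policy.seq_cons,
      explore_act_of_lt _ _ _ _ _ (by simpa using hτ)]
    simp

omit [Fintype O] in
lemma explore_seq_concat (π : Policy O A) (q : Query A H m) (τ : List (O × A)) (x : O × A)
    (hτ : τ.length + 1 = q.1) :
    (explore π q).seq [] (τ ++ [x]) = π.seq [] τ * (1 / Fintype.card A) := by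
  have h1 : ¬ τ.length + 1 < q.1 := by omega
  have h2 : ¬ ((q.1 : ℕ) ≤ τ.length ∧ τ.length - q.1 < m - 1) := by omega
  rw [Policy.seq_append, explore_seq_of_lt _ _ _ (by omega)]
  simp [explore, h1, h2]

omit [Fintype O] in
lemma le_card_mul_explore_seq (π : Policy O A) (q : Query A H m) (τ : List (O × A))
    (hτ : τ.length = q.1) :
    π.seq [] τ ≤ Fintype.card A * (explore π q).seq [] τ := by
  have hA : (1 : ℝ) ≤ Fintype.card A := by exact_mod_cast Fintype.card_pos
  rcases List.eq_nil_or_concat τ with rfl | ⟨τ, x, rfl⟩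
  · simpa using hA
  · rw [List.concat_eq_append] at hτ ⊢
    rw [explore_seq_concat π q τ x (by simpa using hτ), Policy.seq_append]
    rw [mul_left_comm, mul_one_div_cancel (by positivity)]
    exact mul_le_mul_of_nonneg_left (π.seq_le_one _ _) (π.seq_nonneg _ _)

omit [Fintype O] in
lemma explore_seq_ofFn (π : Policy O A) (h : Fin (H - m + 1)) (τ : List (O × A))
    (hτ : τ.length = h) (g : Fin (m - 1) → O × A) :
    (explore π (h, fun i => (g i).2) : Policy O A).seq τ (List.ofFn g) = 1 := by
  rw [Policy.seq_ofFn]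
  refine Finset.prod_eq_one fun i _ => ?_
  have hlen : (τ ++ (List.ofFn g).take i).length = h + i := by
    simp [hτ, i.2.le]
  have h1 : ¬ ((h : ℕ) + i + 1 < (h : ℕ)) := by omega
  simp [explore, hlen, h1]

omit [Fintype O] in
lemma explore_act_of_le (π : Policy O A) (q : Query A H m) (τ : List (O × A)) (o : O) (a : A)
    (hτ : q.1 + (m - 1) = τ.length) : (explore π q).act τ o a = 1 / Fintype.card A := by
  have h1 : ¬ (τ.length + 1 < (q.1 : ℕ)) := by omega
  have h2 : ¬ ((q.1 : ℕ) ≤ τ.length ∧ τ.length - q.1 < m - 1) := by omega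
  simp [explore, h1, h2]

/-- The exploration policies of all action sequences together see every `m`-step future. -/
lemma sum_future_le_sum_explore (hm : 1 ≤ m) (π : Policy O A) {q : List (O × A) → ℝ}
    (hq : IsProcess q) (h : Fin (H - m + 1)) (τ : List (O × A)) (hτ : τ.length = h) :
    ∑ v : Future O A m, |futVec q τ v| ≤
      ∑ u : Fin (m - 1) → A, sumLists m fun l => (explore π (h, u)).seq τ l * |q (τ ++ l)| := by
  have key : ∀ (u : Fin (m - 1) → A) (l : List (O × A)), l.length = m - 1 →
      sumLists 1 (fun b => (explore π (h, u)).seq τ (l ++ b) * |q (τ ++ (l ++ b))|) =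
        (explore π (h, u)).seq τ l *
          ∑ o, |q (τ ++ (l ++ [(o, Classical.arbitrary A)]))| := by
    intro u l hl
    rw [sumLists_succ, Fintype.sum_prod_type, Finset.mul_sum]
    refine Finset.sum_congr rfl fun o _ => ?_
    have h1 : ∀ a, q (τ ++ (l ++ [(o, a)])) = q (τ ++ (l ++ [(o, Classical.arbitrary A)])) := by
      intro a
      rw [← List.append_assoc, ← List.append_assoc, hq.indep _ o a]
    have h2 : ∀ a, (explore π (h, u)).act (τ ++ l) o a = 1 / Fintype.card A := fun a =>
      explore_act_of_le _ _ _ _ _ (by simp [hτ, hl])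
    simp only [sumLists_zero, Policy.seq_append, Policy.seq_cons, Policy.seq_nil, mul_one, h1, h2,
      Finset.sum_const, Finset.card_univ, nsmul_eq_mul]
    field_simp
  have hsplit : ∀ u : Fin (m - 1) → A,
      sumLists m (fun l => (explore π (h, u)).seq τ l * |q (τ ++ l)|) =
      sumLists (m - 1) fun l => (explore π (h, u)).seq τ l *
          ∑ o, |q (τ ++ (l ++ [(o, Classical.arbitrary A)]))| := by
    intro u
    exact (sumLists_eq_sub_one hm _).trans (sumLists_congr fun l hl => key u l hl)
  simp only [hsplit]
  unfold futVec
  rw [sum_future fun l o => |q (τ ++ (l ++ [(o, Classical.arbitrary A)]))|]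
  rw [← sumLists_sum]
  refine Finset.sum_le_sum fun g _ => ?_
  beta_reduce
  rw [← Finset.sum_mul]
  refine le_mul_of_one_le_left (Finset.sum_nonneg fun o _ => abs_nonneg _) ?_
  rw [← explore_seq_ofFn π h τ hτ g]
  exact Finset.single_le_sum (f := fun u => (explore π (h, u)).seq τ (List.ofFn g))
    (fun u _ => Policy.seq_nonneg _ _ _) (Finset.mem_univ _)

/-- If a weight `ρ` on histories of length `h` is dominated by the exploration policies up to a
factor `|A|`, the `ρ`-average of the distance of the futures is controlled by the total variation
distances under these policies. -/
lemma sum_mul_sum_future_le (hm : 1 ≤ m) (hmH : m ≤ H) (π : Policy O A) (f M : POMDP S O A)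
    (h : Fin (H - m + 1)) (ρ : List (O × A) → ℝ)
    (hρ : ∀ (u : Fin (m - 1) → A) (τ : List (O × A)), τ.length = h →
      ρ τ ≤ Fintype.card A * (explore π (h, u)).seq [] τ) :
    sumLists (h : ℕ) (fun τ => ρ τ *
        ∑ v : Future O A m, |futVec f.prob τ v - futVec M.prob τ v|) ≤
      Fintype.card A * ∑ u : Fin (m - 1) → A, tvDist H f M (explore π (h, u)) := by
  have hp := f.isProcess_prob.sub M.isProcess_prob
  have h1 : ∀ u : Fin (m - 1) → A, sumLists (h : ℕ) (fun τ => (explore π (h, u)).seq [] τ *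
      sumLists m fun l => (explore π (h, u)).seq τ l * |f.prob (τ ++ l) - M.prob (τ ++ l)|) ≤
      tvDist H f M (explore π (h, u)) := by
    intro u
    have h2 := hp.sum_seq_abs_le (explore π (h, u)) (h + m) (H - m - h)
    rw [show (h : ℕ) + m + (H - m - h) = H by omega] at h2
    refine le_trans (le_of_eq ?_) h2
    rw [sumLists_add]
    refine sumLists_congr fun τ _ => ?_
    simp only [Policy.seq_append, mul_assoc, List.nil_append]
    rw [mul_sumLists]
  refine le_trans ?_ (mul_le_mul_of_nonneg_left (Finset.sum_le_sum fun u _ => h1 u)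
    (Nat.cast_nonneg _))
  rw [← sumLists_sum, mul_sumLists]
  refine sumLists_le_sumLists fun τ hτ => ?_
  by_cases hρτ : 0 ≤ ρ τ
  · calc _ ≤ ρ τ * ∑ u : Fin (m - 1) → A, sumLists m fun l =>
          (explore π (h, u)).seq τ l * |f.prob (τ ++ l) - M.prob (τ ++ l)| :=
        mul_le_mul_of_nonneg_left (sum_future_le_sum_explore hm π hp h τ hτ) hρτ
      _ ≤ _ := by
        rw [Finset.mul_sum, Finset.mul_sum]
        refine Finset.sum_le_sum fun u _ => ?_
        rw [← mul_assoc]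
        exact mul_le_mul_of_nonneg_right (hρ u τ hτ)
          (sumLists_nonneg fun _ _ => mul_nonneg (Policy.seq_nonneg _ _ _) (abs_nonneg _))
  · refine le_trans (mul_nonpos_of_nonpos_of_nonneg (not_le.1 hρτ).le
      (Finset.sum_nonneg fun _ _ => abs_nonneg _)) ?_
    exact mul_nonneg (Nat.cast_nonneg _) (Finset.sum_nonneg fun u _ => mul_nonneg
      (Policy.seq_nonneg _ _ _)
      (sumLists_nonneg fun _ _ => mul_nonneg (Policy.seq_nonneg _ _ _) (abs_nonneg _)))

/-- The sum over all action sequences of the total variation distances under the exploration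
policies for step `h`. -/
noncomputable def queryDist (H m : ℕ) (f M : POMDP S O A) (π : Policy O A)
    (h : Fin (H - m + 1)) : ℝ :=
  ∑ u : Fin (m - 1) → A, tvDist H f M (explore π (h, u))

lemma sum_seq_future_le (hm : 1 ≤ m) (hmH : m ≤ H) (π : Policy O A) (f M : POMDP S O A)
    (h : Fin (H - m + 1)) :
    sumLists (h : ℕ) (fun τ => π.seq [] τ *
        ∑ v : Future O A m, |futVec f.prob τ v - futVec M.prob τ v|) ≤
      Fintype.card A * queryDist H m f M π h :=
  sum_mul_sum_future_le hm hmH π f M h _ fun u τ hτ => le_card_mul_explore_seq π (h, u) τ hτ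

lemma sum_seq_concat_future_le (hm : 1 ≤ m) (hmH : m ≤ H) (π : Policy O A) (f M : POMDP S O A)
    (h : ℕ) (hh : h + 1 < H - m + 1) :
    sumLists h (fun τ => π.seq [] τ * ∑ x,
        ∑ v : Future O A m, |futVec f.prob (τ ++ [x]) v - futVec M.prob (τ ++ [x]) v|) ≤
      Fintype.card A * queryDist H m f M π ⟨h + 1, hh⟩ := by
  have := sum_mul_sum_future_le hm hmH π f M ⟨h + 1, hh⟩ (fun τ => π.seq [] τ.dropLast) ?_
  · refine le_trans (le_of_eq ?_) this
    rw [sumLists_add]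
    refine sumLists_congr fun τ _ => ?_
    rw [sumLists_succ, Finset.mul_sum]
    simp
  · intro u τ hτ
    obtain ⟨τ, x, rfl⟩ := (List.eq_nil_or_concat τ).resolve_left
      (by rintro rfl; simp at hτ)
    rw [List.concat_eq_append] at hτ ⊢
    rw [explore_seq_concat π _ τ x (by simpa using hτ), List.dropLast_concat, mul_left_comm,
      mul_one_div_cancel (by positivity), mul_one]

variable {f M : POMDP S O A} {h : ℕ} {C : ℝ}

lemma CoreData.err_nonneg (D : CoreData f.prob H m h C) (τ : List (O × A)) : 0 ≤ D.err M τ :=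
  Finset.sum_nonneg fun _ _ => Finset.sum_nonneg fun _ _ => abs_nonneg _

lemma CoreData.err_le (D : CoreData f.prob H m h C) (hm : 1 ≤ m) (hh : h + 1 + m ≤ H)
    {τ : List (O × A)} (hτ : τ.length = h) :
    D.err M τ ≤ (Fintype.card A : ℝ) ^ m * C *
        (∑ v : Future O A m, |futVec f.prob τ v - futVec M.prob τ v|) +
      ∑ x, ∑ v : Future O A m, |futVec f.prob (τ ++ [x]) v - futVec M.prob (τ ++ [x]) v| := by
  refine le_trans ?_ (add_le_add_left
    (D.sum_op_le hm (futVec f.prob τ - futVec M.prob τ)) _)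
  rw [← Finset.sum_add_distrib]
  refine Finset.sum_le_sum fun x _ => ?_
  rw [← Finset.sum_add_distrib]
  refine Finset.sum_le_sum fun v _ => ?_
  rw [D.op_sub, D.op_futVec hm hh x hτ, abs_sub_comm (futVec f.prob (τ ++ [x]) v)
    (D.op x (futVec M.prob τ) v)]
  exact abs_sub_le _ _ _

/-- The average one-step error under a policy is controlled by the total variation distances under
the exploration policies. -/
lemma CoreData.sum_seq_err_le (D : CoreData f.prob H m h C) (hm : 1 ≤ m) (hmH : m ≤ H)
    (hC : 0 ≤ C) (π : Policy O A) (hh : h + 1 < H - m + 1) :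
    sumLists h (fun τ => π.seq [] τ * D.err M τ) ≤
      (Fintype.card A : ℝ) ^ m * C *
          (Fintype.card A * queryDist H m f M π ⟨h, by omega⟩) +
        Fintype.card A * queryDist H m f M π ⟨h + 1, hh⟩ := by
  refine le_trans ?_ (add_le_add
    (mul_le_mul_of_nonneg_left (sum_seq_future_le hm hmH π f M ⟨h, by omega⟩)
      (by positivity : 0 ≤ (Fintype.card A : ℝ) ^ m * C))
    (sum_seq_concat_future_le hm hmH π f M h hh))
  rw [mul_sumLists, ← sumLists_add_distrib]
  refine sumLists_le_sumLists fun τ hτ => ?_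
  rw [mul_left_comm, ← mul_add]
  exact mul_le_mul_of_nonneg_left (D.err_le hm (by omega) hτ) (π.seq_nonneg _ _)

/-- The coordinates of the futures after `τ` with respect to the core histories. -/
noncomputable def CoreData.coord (D : CoreData M.prob H m h C) (τ : List (O × A)) : Fin D.d → ℝ :=
  D.P.mulVec (futVec M.prob τ)

lemma CoreData.sum_abs_coord_le (D : CoreData M.prob H m h C) (τ : List (O × A)) :
    ∑ i, |D.coord τ i| ≤ C * (Fintype.card A : ℝ) ^ (m - 1) * M.prob τ := by
  refine (D.norm_le _).trans (le_of_eq ?_)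
  have : ∀ v : Future O A m, |futVec M.prob τ v| = futVec M.prob τ v := fun v =>
    abs_of_nonneg (M.prob_nonneg _)
  simp only [this, M.isProcess_prob.sum_future_eq, mul_assoc]

lemma CoreData.sum_seq_coord_le (D : CoreData M.prob H m h C) (π : Policy O A) (n : ℕ) :
    sumLists n (fun τ => π.seq [] τ * ∑ i, |D.coord τ i|) ≤
      C * (Fintype.card A : ℝ) ^ (m - 1) := by
  refine (sumLists_le_sumLists fun τ _ => mul_le_mul_of_nonneg_left
    (D.sum_abs_coord_le τ) (π.seq_nonneg _ _)).trans (le_of_eq ?_)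
  have : ∀ τ, π.seq [] τ * (C * (Fintype.card A : ℝ) ^ (m - 1) * M.prob τ) =
      C * (Fintype.card A : ℝ) ^ (m - 1) * (π.seq [] τ * M.prob τ) := fun τ => by ring
  simp only [this]
  rw [← mul_sumLists, M.isProcess_prob.sum_seq π, M.prob_nil, mul_one]

/-- The one-step error after the core histories of `M`, for every entry of the operators. -/
noncomputable def CoreData.coreErr (D : CoreData f.prob H m h C) (D' : CoreData M.prob H m h C)
    (z : (O × A) × Future O A m) (i : Fin D'.d) : ℝ :=
  (D.op z.1 (futVec M.prob (D'.c i)) z.2 - futVec M.prob (D'.c i ++ [z.1]) z.2) /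
    M.prob (D'.c i)

/-- The one-step error after `τ` is a sum of absolute values of linear functionals of the coordinates
of `τ`. -/
lemma CoreData.err_eq (D : CoreData f.prob H m h C) (D' : CoreData M.prob H m h C)
    (hm : 1 ≤ m) (hh : h + 1 + m ≤ H) {τ : List (O × A)} (hτ : τ.length = h) :
    D.err M τ = ∑ z, |D.coreErr D' z ⬝ᵥ D'.coord τ| := by
  rw [Fintype.sum_prod_type]
  refine Finset.sum_congr rfl fun x _ => Finset.sum_congr rfl fun v _ => ?_
  congr 1
  have h1 : futVec (m := m) M.prob τ =
      ∑ i, (D'.coord τ i / M.prob (D'.c i)) • futVec M.prob (D'.c i) := by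
    ext w
    rw [futVec, D'.eq (by omega) τ hτ _ (by simp) (by simp; omega), Finset.sum_apply]
    refine Finset.sum_congr rfl fun i _ => ?_
    simp only [Pi.smul_apply, smul_eq_mul, futVec, coord]
    ring
  have h2 : futVec M.prob (τ ++ [x]) v =
      ∑ i, (D'.coord τ i / M.prob (D'.c i)) * futVec M.prob (D'.c i ++ [x]) v := by
    rw [futVec, List.append_assoc, D'.eq (by omega) τ hτ _ (by simp) (by simp; omega)]
    refine Finset.sum_congr rfl fun i _ => ?_
    simp only [futVec, coord, List.append_assoc]
    ring
  rw [h2]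
  conv_lhs => rw [h1]
  rw [D.op_sum, ← Finset.sum_sub_distrib]
  refine Finset.sum_congr rfl fun i _ => ?_
  rw [coreErr]
  ring

lemma CoreData.sum_abs_coreErr_le (D : CoreData f.prob H m h C) (D' : CoreData M.prob H m h C)
    (hm : 1 ≤ m) (hC : 0 ≤ C) (i : Fin D'.d) :
    ∑ z, |D.coreErr D' z i| ≤
      (Fintype.card A : ℝ) ^ m * C * (Fintype.card A : ℝ) ^ (m - 1) +
        (Fintype.card A : ℝ) ^ m := by
  set p := M.prob (D'.c i) with hp
  have hp0 : 0 ≤ p := M.prob_nonneg _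
  have habs : ∀ τ (v : Future O A m), |futVec M.prob τ v| = futVec M.prob τ v := fun τ v =>
    abs_of_nonneg (M.prob_nonneg _)
  have h1 := D.sum_op_le hm (futVec M.prob (D'.c i))
  have h2 := M.isProcess_prob.sum_cons_future_eq hm (D'.c i)
  simp only [habs, M.isProcess_prob.sum_future_eq] at h1
  have h3 : ∑ z, |D.coreErr D' z i| ≤
      ((Fintype.card A : ℝ) ^ m * C * ((Fintype.card A : ℝ) ^ (m - 1) * p) +
        (Fintype.card A : ℝ) ^ m * p) / p := by
    refine le_trans ?_ (div_le_div_of_nonneg_right (add_le_add h1 h2.le) hp0)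
    rw [← Finset.sum_add_distrib, Finset.sum_div, Fintype.sum_prod_type]
    refine Finset.sum_le_sum fun x _ => ?_
    rw [← Finset.sum_add_distrib, Finset.sum_div]
    refine Finset.sum_le_sum fun v _ => ?_
    rw [coreErr, abs_div, abs_of_nonneg hp0]
    refine div_le_div_of_nonneg_right ((abs_sub _ _).trans ?_) hp0
    rw [habs]
  refine h3.trans ?_
  rw [← mul_assoc, ← add_mul, mul_div_assoc]
  exact mul_le_of_le_one_right (by positivity) (div_self_le_one _)

end Explore

/-! ### Approximate barycentric spanners -/

open Module in
/-- A bounded set `X` in a space of finite dimension has an approximate barycentric spanner: a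
tuple of points of `X` of nearly maximal determinant. By Cramer's rule, every point of `X` is a
combination of these points with coefficients in `[-2, 2]`. (The tuple is padded with zeros.) -/
theorem exists_spanner {E : Type*} [NormedAddCommGroup E] [NormedSpace ℝ E]
    [FiniteDimensional ℝ E] {X : Set E} (hX : Bornology.IsBounded X) {n : ℕ}
    (hn : finrank ℝ (Submodule.span ℝ X) ≤ n) :
    ∃ v : Fin n → E, (∀ i, v i ∈ X ∨ v i = 0) ∧
      ∀ x ∈ X, ∃ c : Fin n → ℝ, (∀ i, |c i| ≤ 2) ∧ x = ∑ i, c i • v i := by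
  classical
  obtain ⟨k, rfl⟩ := Nat.exists_eq_add_of_le hn
  set W := Submodule.span ℝ X with hW
  set r := finrank ℝ W with hr
  let b : Basis (Fin r) ℝ W := finBasis ℝ W
  let toW : X → W := fun x => ⟨x, Submodule.subset_span x.2⟩
  obtain ⟨R, hR⟩ : ∃ R, ∀ (x : X) (i : Fin r), |b.repr (toW x) i| ≤ R := by
    obtain ⟨R₀, hR₀⟩ := hX.exists_norm_le
    let L : W →L[ℝ] (Fin r → ℝ) := LinearMap.toContinuousLinearMap b.equivFun.toLinearMap
    refine ⟨‖L‖ * R₀, fun x i => ?_⟩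
    have h1 : ‖L (toW x) i‖ ≤ ‖L (toW x)‖ := norm_le_pi_norm _ i
    have h2 : ‖L (toW x)‖ ≤ ‖L‖ * ‖toW x‖ := L.le_opNorm _
    have h3 : ‖toW x‖ ≤ R₀ := hR₀ x x.2
    exact h1.trans (h2.trans (mul_le_mul_of_nonneg_left h3 L.opNorm_nonneg))
  let s : Set ℝ := Set.range fun v : Fin r → X => |b.det (toW ∘ v)|
  have hbdd : BddAbove s := by
    refine ⟨(Fintype.card (Fin r)).factorial • R ^ Fintype.card (Fin r), ?_⟩
    rintro _ ⟨v, rfl⟩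
    exact Matrix.det_le (abv := AbsoluteValue.abs) fun i j => hR (v j) i
  obtain ⟨g, hgX, hgspan, hglin⟩ := Submodule.exists_fun_fin_finrank_span_eq ℝ X
  obtain ⟨v, hv⟩ : ∃ v : Fin r → X, sSup s / 2 < |b.det (toW ∘ v)| ∧
      0 < |b.det (toW ∘ v)| := by
    let v₀ : Fin r → X := fun i => ⟨g i, hgX i⟩
    have hlin : LinearIndependent ℝ (toW ∘ v₀) :=
      LinearIndependent.of_comp W.subtype hglin
    have hpos : 0 < |b.det (toW ∘ v₀)| := by
      rw [abs_pos]
      exact ((Basis.is_basis_iff_det b).1 ⟨hlin, hlin.span_eq_top_of_card_eq_finrank'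
        (by simp [hr])⟩).ne_zero
    have hs : 0 < sSup s := hpos.trans_le (le_csSup hbdd ⟨v₀, rfl⟩)
    obtain ⟨_, ⟨v, rfl⟩, hv⟩ :=
      exists_lt_of_lt_csSup (⟨_, ⟨v₀, rfl⟩⟩ : s.Nonempty) (half_lt_self hs)
    exact ⟨v, hv, (half_pos hs).trans hv⟩
  have hbasis := (Basis.is_basis_iff_det b).2 (isUnit_iff_ne_zero.2 (abs_pos.1 hv.2))
  refine ⟨Fin.append (fun i => (v i : E)) 0, fun i => ?_, fun x hx => ?_⟩
  · refine Fin.addCases (fun i => ?_) (fun i => ?_) i <;> simp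
  · let b' := Basis.mk hbasis.1 hbasis.2.ge
    have hcoord : ∀ i, |b'.repr (toW ⟨x, hx⟩) i| ≤ 2 := by
      intro i
      have h1 := LinearMap.congr_fun (b.det_smul_mk_coord_eq_det_update hbasis.1 hbasis.2.ge i)
        (toW ⟨x, hx⟩)
      have h2 : b.det (toW ∘ v) * b'.repr (toW ⟨x, hx⟩) i =
          b.det (toW ∘ Function.update v i ⟨x, hx⟩) := by
        rw [Function.comp_update]
        exact h1
      have h3 := le_csSup hbdd ⟨Function.update v i ⟨x, hx⟩, rfl⟩
      simp only at h3
      rw [← h2, abs_mul] at h3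
      by_contra! h4
      nlinarith [hv.1, hv.2]
    refine ⟨Fin.append (fun i => b'.repr (toW ⟨x, hx⟩) i) 0, fun i => ?_, ?_⟩
    · refine Fin.addCases (fun i => ?_) (fun i => ?_) i
      · simpa using hcoord i
      · simp
    · rw [Fin.sum_univ_add]
      have h5 := congrArg W.subtype (b'.sum_repr (toW ⟨x, hx⟩))
      simp only [map_sum, map_smul] at h5
      simpa [b', toW] using h5.symm

/-- A sum of absolute values of arbitrarily many linear functionals on `ℝ^d` is equivalent, up to
factors that depend on `d` only, to a sum over `d` functionals. -/
lemma exists_dominating_functionals {L : Type*} [Fintype L] {d : ℕ} (w : L → Fin d → ℝ) :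
    ∃ ω : Fin d → Fin d → ℝ, ∀ y, (∀ i, |ω i ⬝ᵥ y| ≤ ∑ l, |w l ⬝ᵥ y|) ∧
      ∑ l, |w l ⬝ᵥ y| ≤ 2 * ∑ i, |ω i ⬝ᵥ y| := by
  classical
  -- the seminorm is the maximum of the functionals given by all choices of signs
  let X : Set (Fin d → ℝ) := Set.range fun s : L → Bool => ∑ l, (if s l then 1 else -1 : ℝ) • w l
  have hdot : ∀ (s : L → Bool) y, (∑ l, (if s l then 1 else -1 : ℝ) • w l) ⬝ᵥ y =
      ∑ l, (if s l then 1 else -1 : ℝ) * (w l ⬝ᵥ y) := by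
    intro s y
    simp only [sum_dotProduct, smul_dotProduct, smul_eq_mul]
  obtain ⟨ω, hω, hspan⟩ := exists_spanner (X := X) (Set.finite_range _).isBounded (n := d)
    ((Submodule.finrank_le _).trans (by simp))
  refine ⟨ω, fun y => ⟨fun i => ?_, ?_⟩⟩
  · rcases hω i with ⟨s, hs⟩ | h0
    · rw [← hs, hdot]
      refine (Finset.abs_sum_le_sum_abs _ _).trans (Finset.sum_le_sum fun l _ => ?_)
      rw [abs_mul]
      split_ifs <;> simp
    · rw [h0, zero_dotProduct, abs_zero]
      exact Finset.sum_nonneg fun _ _ => abs_nonneg _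
  · obtain ⟨c, hc, hx⟩ := hspan _ ⟨fun l => decide (0 ≤ w l ⬝ᵥ y), rfl⟩
    have h1 : ∑ l, |w l ⬝ᵥ y| =
        (∑ l, (if decide (0 ≤ w l ⬝ᵥ y) then 1 else -1 : ℝ) • w l) ⬝ᵥ y := by
      rw [hdot (fun l => decide (0 ≤ w l ⬝ᵥ y))]
      refine Finset.sum_congr rfl fun l _ => ?_
      by_cases h : 0 ≤ w l ⬝ᵥ y
      · simp [h, abs_of_nonneg h]
      · simp [h, abs_of_neg (not_le.1 h)]
    beta_reduce at hx
    rw [h1, hx, sum_dotProduct, Finset.mul_sum]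
    refine Finset.sum_le_sum fun i _ => ?_
    rw [smul_dotProduct, smul_eq_mul]
    refine (le_abs_self _).trans ?_
    rw [abs_mul]
    exact mul_le_mul_of_nonneg_right (hc i) (abs_nonneg _)

/-! ### The elliptical potential -/

section Elliptical

variable {d : ℕ}

/-- The regularized Gram matrix of the first `k` vectors. -/
noncomputable def gram (r : ℝ) (φ : ℕ → Fin d → ℝ) (k : ℕ) : Matrix (Fin d) (Fin d) ℝ :=
  r • 1 + ∑ j ∈ Finset.range k, Matrix.vecMulVec (φ j) (φ j)

lemma dotProduct_gram_mulVec (r : ℝ) (φ : ℕ → Fin d → ℝ) (k : ℕ) (x y : Fin d → ℝ) :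
    x ⬝ᵥ (gram r φ k).mulVec y =
      r * (x ⬝ᵥ y) + ∑ j ∈ Finset.range k, (x ⬝ᵥ φ j) * (φ j ⬝ᵥ y) := by
  rw [gram, Matrix.add_mulVec, dotProduct_add, Matrix.smul_mulVec, Matrix.one_mulVec,
    dotProduct_smul, smul_eq_mul, Matrix.sum_mulVec, dotProduct_sum]
  congr 1
  refine Finset.sum_congr rfl fun j _ => ?_
  rw [Matrix.vecMulVec_mulVec]
  simp [mul_comm]

lemma posDef_gram {r : ℝ} (hr : 0 < r) (φ : ℕ → Fin d → ℝ) (k : ℕ) : (gram r φ k).PosDef := by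
  refine Matrix.PosDef.of_dotProduct_mulVec_pos ?_ fun x hx => ?_
  · unfold gram
    rw [Matrix.IsHermitian, Matrix.conjTranspose_eq_transpose_of_trivial]
    simp [Matrix.transpose_sum, Matrix.transpose_vecMulVec]
  · rw [star_trivial, dotProduct_gram_mulVec]
    have h1 : 0 < x ⬝ᵥ x := by
      rw [← star_trivial x]
      simpa using Matrix.dotProduct_star_self_pos_iff.2 hx
    have h2 : 0 ≤ ∑ j ∈ Finset.range k, (x ⬝ᵥ φ j) * (φ j ⬝ᵥ x) :=
      Finset.sum_nonneg fun j _ => by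
        rw [dotProduct_comm (φ j)]
        exact mul_self_nonneg _
    positivity

lemma det_gram_succ {r : ℝ} (hr : 0 < r) (φ : ℕ → Fin d → ℝ) (k : ℕ) :
    (gram r φ (k + 1)).det =
      (gram r φ k).det * (1 + φ k ⬝ᵥ ((gram r φ k)⁻¹).mulVec (φ k)) := by
  have h1 : gram r φ (k + 1) = gram r φ k +
      Matrix.replicateCol Unit (φ k) * Matrix.replicateRow Unit (φ k) := by
    rw [gram, Finset.sum_range_succ, ← add_assoc, ← gram, Matrix.vecMulVec_eq Unit]
  rw [h1, Matrix.det_add_replicateCol_mul_replicateRow (posDef_gram hr φ k).det_pos.ne'.isUnit]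
  congr 1
  rw [Matrix.det_unique]
  simp [Matrix.mul_apply, dotProduct, Matrix.mulVec, Finset.mul_sum, Finset.sum_mul, mul_assoc]
  rw [Finset.sum_comm]

lemma det_gram_le {r : ℝ} (hr : 0 < r) (φ : ℕ → Fin d → ℝ) (k : ℕ)
    (hφ : ∀ j < k, φ j ⬝ᵥ φ j ≤ r) : (gram r φ k).det ≤ (r * (d + k)) ^ d := by
  have hpos := posDef_gram hr φ k
  have htr : (gram r φ k).trace ≤ r * (d + k) := by
    simp only [gram, Matrix.trace_add, Matrix.trace_smul, Matrix.trace_one, Fintype.card_fin,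
      Matrix.trace_sum, Matrix.trace_vecMulVec, smul_eq_mul, mul_add]
    gcongr
    refine (Finset.sum_le_card_nsmul _ _ r fun j hj => hφ j (Finset.mem_range.1 hj)).trans ?_
    simp [mul_comm]
  have hnn : ∀ i, 0 ≤ hpos.1.eigenvalues i := fun i => hpos.posSemidef.eigenvalues_nonneg i
  rw [hpos.1.det_eq_prod_eigenvalues]
  rw [hpos.1.trace_eq_sum_eigenvalues] at htr
  simp only [RCLike.ofReal_real_eq_id, id] at htr ⊢
  calc ∏ i, hpos.1.eigenvalues i ≤ ∏ _i : Fin d, (r * (d + k)) :=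
        Finset.prod_le_prod (fun i _ => hnn i) fun i _ =>
          (Finset.single_le_sum (fun i _ => hnn i) (Finset.mem_univ i)).trans htr
    _ = _ := by simp

/-- The elliptical potential bounds the squares of the values of `ω k` at the next vector `φ k`, if
`ω k` is small on the previous vectors. -/
theorem sum_sq_dotProduct_le {K : ℕ} (hK : 0 < K) {φ ω : ℕ → Fin d → ℝ} {r s B : ℝ} (hr : 0 < r)
    (hφ : ∀ k < K, φ k ⬝ᵥ φ k ≤ r) (hω : ∀ k < K, ω k ⬝ᵥ ω k ≤ s)
    (hB : ∀ k < K, ∑ j ∈ Finset.range k, (ω k ⬝ᵥ φ j) ^ 2 ≤ B) :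
    ∑ k ∈ Finset.range K, (ω k ⬝ᵥ φ k) ^ 2 ≤ (r * s + B) * (2 * (d * Real.log (d + K))) := by
  set x : ℕ → ℝ := fun k => φ k ⬝ᵥ ((gram r φ k)⁻¹).mulVec (φ k) with hx
  have hdot_nonneg : ∀ y : Fin d → ℝ, 0 ≤ y ⬝ᵥ y := fun y =>
    Finset.sum_nonneg fun i _ => mul_self_nonneg _
  have hsolve : ∀ k, (gram r φ k).mulVec (((gram r φ k)⁻¹).mulVec (φ k)) = φ k := by
    intro k
    rw [Matrix.mulVec_mulVec, Matrix.mul_nonsing_inv _ (posDef_gram hr φ k).det_pos.ne'.isUnit,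
      Matrix.one_mulVec]
  have hxz : ∀ k, x k = ((gram r φ k)⁻¹).mulVec (φ k) ⬝ᵥ
      (gram r φ k).mulVec (((gram r φ k)⁻¹).mulVec (φ k)) := by
    intro k
    rw [hsolve, dotProduct_comm]
  have hx0 : ∀ k, 0 ≤ x k := by
    intro k
    rw [hxz]
    simpa using (posDef_gram hr φ k).posSemidef.dotProduct_mulVec_nonneg
      (((gram r φ k)⁻¹).mulVec (φ k))
  -- the Cauchy-Schwarz inequality for the quadratic form of the Gram matrix
  have hCS : ∀ k < K, (ω k ⬝ᵥ φ k) ^ 2 ≤ (r * s + B) * x k := by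
    intro k hk
    set z := ((gram r φ k)⁻¹).mulVec (φ k) with hz
    have hquad : ∀ t : ℝ, 0 ≤ x k * (t * t) + 2 * (ω k ⬝ᵥ φ k) * t +
        ω k ⬝ᵥ (gram r φ k).mulVec (ω k) := by
      intro t
      have h1 := (posDef_gram hr φ k).posSemidef.dotProduct_mulVec_nonneg (ω k + t • z)
      have h2 : z ⬝ᵥ (gram r φ k).mulVec (ω k) = ω k ⬝ᵥ φ k := by
        rw [← hsolve k, ← hz, dotProduct_gram_mulVec, dotProduct_gram_mulVec,
          dotProduct_comm z (ω k)]
        congr 1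
        refine Finset.sum_congr rfl fun j _ => ?_
        rw [dotProduct_comm z, dotProduct_comm (φ j) (ω k), mul_comm]
      rw [star_trivial, Matrix.mulVec_add, Matrix.mulVec_smul, hz, hsolve, ← hz] at h1
      simp only [dotProduct_add, add_dotProduct, smul_dotProduct, dotProduct_smul, smul_eq_mul,
        h2] at h1
      have h3 : z ⬝ᵥ φ k = x k := dotProduct_comm _ _
      rw [h3] at h1
      linarith
    have hd := discrim_le_zero hquad
    rw [discrim] at hd
    have h4 : ω k ⬝ᵥ (gram r φ k).mulVec (ω k) ≤ r * s + B := by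
      rw [dotProduct_gram_mulVec]
      refine add_le_add (mul_le_mul_of_nonneg_left (hω k hk) hr.le) ?_
      refine le_trans (le_of_eq ?_) (hB k hk)
      refine Finset.sum_congr rfl fun j _ => ?_
      rw [dotProduct_comm (φ j), sq]
    nlinarith [mul_le_mul_of_nonneg_right h4 (hx0 k)]
  have hx1 : ∀ k < K, x k ≤ 1 := by
    intro k hk
    set z := ((gram r φ k)⁻¹).mulVec (φ k) with hz
    have h1 : r * (z ⬝ᵥ z) ≤ x k := by
      rw [hxz, dotProduct_gram_mulVec]
      refine le_add_of_nonneg_right (Finset.sum_nonneg fun j _ => ?_)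
      rw [dotProduct_comm (φ j)]
      exact mul_self_nonneg _
    have h2 : x k ^ 2 ≤ (φ k ⬝ᵥ φ k) * (z ⬝ᵥ z) := by
      have := Finset.sum_mul_sq_le_sq_mul_sq Finset.univ (φ k) z
      simpa [hx, dotProduct, sq] using this
    have h3 : x k ^ 2 ≤ x k := by
      refine h2.trans (le_trans ?_ h1)
      exact mul_le_mul_of_nonneg_right (hφ k hk) (hdot_nonneg z)
    nlinarith [hx0 k]
  have hprod : ∀ k, (gram r φ k).det = r ^ d * ∏ j ∈ Finset.range k, (1 + x j) := by
    intro k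
    induction k with
    | zero => simp [gram]
    | succ k ih => rw [det_gram_succ hr, ih, Finset.prod_range_succ, mul_assoc]
  have hlog : ∑ k ∈ Finset.range K, x k ≤ 2 * (d * Real.log (d + K)) := by
    have h1 : ∏ j ∈ Finset.range K, (1 + x j) ≤ ((d : ℝ) + K) ^ d := by
      have := det_gram_le hr φ K hφ
      rw [hprod, mul_pow] at this
      exact le_of_mul_le_mul_left this (by positivity)
    have h2 : ∑ j ∈ Finset.range K, Real.log (1 + x j) ≤ d * Real.log (d + K) := by
      rw [← Real.log_prod (fun j _ => by linarith [hx0 j]), ← Real.log_pow]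
      exact Real.log_le_log (Finset.prod_pos fun j _ => by linarith [hx0 j]) h1
    have h3 : ∀ j ∈ Finset.range K, x j ≤ 2 * Real.log (1 + x j) := by
      intro j hj
      have h4 := hx0 j
      have h5 := hx1 j (Finset.mem_range.1 hj)
      have h6 := Real.one_sub_inv_le_log_of_pos (show 0 < 1 + x j by linarith)
      have h7 : x j / 2 ≤ 1 - (1 + x j)⁻¹ := by
        rw [← sub_nonneg]
        have : 1 - (1 + x j)⁻¹ - x j / 2 = x j * (1 - x j) / (2 * (1 + x j)) := by
          field_simp
          ring
        rw [this]
        exact div_nonneg (mul_nonneg h4 (by linarith)) (by linarith)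
      linarith
    refine (Finset.sum_le_sum h3).trans ?_
    rw [← Finset.mul_sum]
    linarith
  refine (Finset.sum_le_sum fun k hk => hCS k (Finset.mem_range.1 hk)).trans ?_
  rw [← Finset.mul_sum]
  refine mul_le_mul_of_nonneg_left hlog ?_
  have h1 := hB 0 hK
  have h2 := (hdot_nonneg (ω 0)).trans (hω 0 hK)
  simp only [Finset.range_zero, Finset.sum_empty] at h1
  positivity

/-- If the averages of a sum of absolute values of linear functionals `w k` are small under all
previous distributions `μ j`, `j < k`, they are small on average under the next distribution `μ k`.
The factor is polynomial in the dimension, logarithmic in `K`, and does not depend on the number of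
functionals. -/
theorem sum_avg_abs_le {T L : Type*} [Fintype T] [Fintype L] {K : ℕ} (hK : 0 < K)
    (y : T → Fin d → ℝ) (μ : ℕ → T → ℝ) (hμ : ∀ k t, 0 ≤ μ k t) (w : ℕ → L → Fin d → ℝ)
    {R₁ R₂ B : ℝ} (hR₁ : 0 < R₁)
    (hy : ∀ k < K, ∑ t, μ k t * ∑ i, |y t i| ≤ R₁)
    (hw : ∀ k < K, ∀ i, ∑ l, |w k l i| ≤ R₂)
    (hB : ∀ k < K, ∑ j ∈ Finset.range k, (∑ t, μ j t * ∑ l, |w k l ⬝ᵥ y t|) ^ 2 ≤ B) :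
    ∑ k ∈ Finset.range K, ∑ t, μ k t * ∑ l, |w k l ⬝ᵥ y t| ≤
      2 * (d * √(K * ((R₁ ^ 2 * (d * R₂ ^ 2) + B) * (2 * (d * Real.log (d + K)))))) := by
  choose ω hω using fun k => exists_dominating_functionals (w k)
  -- `φ i k` pairs with `ω k i` to the average of the absolute values
  let φ : Fin d → ℕ → Fin d → ℝ := fun i k =>
    ∑ t, (SignType.sign (ω k i ⬝ᵥ y t) * μ k t : ℝ) • y t
  have hωφ : ∀ i k, ω k i ⬝ᵥ φ i k = ∑ t, μ k t * |ω k i ⬝ᵥ y t| := by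
    intro i k
    simp only [φ, dotProduct_sum, dotProduct_smul, smul_eq_mul]
    refine Finset.sum_congr rfl fun t _ => ?_
    rw [← sign_mul_self]
    ring
  have hle : ∀ i k j, |ω k i ⬝ᵥ φ i j| ≤ ∑ t, μ j t * ∑ l, |w k l ⬝ᵥ y t| := by
    intro i k j
    simp only [φ, dotProduct_sum, dotProduct_smul, smul_eq_mul]
    refine (Finset.abs_sum_le_sum_abs _ _).trans (Finset.sum_le_sum fun t _ => ?_)
    rw [abs_mul, abs_mul, abs_of_nonneg (hμ j t)]
    have h1 : |((SignType.sign (ω j i ⬝ᵥ y t) : SignType) : ℝ)| ≤ 1 := by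
      rcases SignType.sign (ω j i ⬝ᵥ y t) with _ | _ | _ <;> simp
    calc _ ≤ 1 * μ j t * |ω k i ⬝ᵥ y t| := by
          have := hμ j t
          gcongr
      _ ≤ _ := by
          rw [one_mul]
          exact mul_le_mul_of_nonneg_left ((hω k _).1 i) (hμ j t)
  have hφ : ∀ i, ∀ k < K, φ i k ⬝ᵥ φ i k ≤ R₁ ^ 2 := by
    intro i k hk
    have h1 : ∑ c, |φ i k c| ≤ R₁ := by
      refine le_trans ?_ (hy k hk)
      simp only [Finset.mul_sum]
      rw [Finset.sum_comm]
      refine Finset.sum_le_sum fun c _ => ?_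
      simp only [φ, Finset.sum_apply, Pi.smul_apply, smul_eq_mul]
      refine (Finset.abs_sum_le_sum_abs _ _).trans (Finset.sum_le_sum fun t _ => ?_)
      rw [abs_mul, abs_mul, abs_of_nonneg (hμ k t)]
      have h1 : |((SignType.sign (ω k i ⬝ᵥ y t) : SignType) : ℝ)| ≤ 1 := by
        rcases SignType.sign (ω k i ⬝ᵥ y t) with _ | _ | _ <;> simp
      have := hμ k t
      gcongr
      exact mul_le_of_le_one_left this h1
    have h0 : 0 ≤ ∑ c, |φ i k c| := Finset.sum_nonneg fun _ _ => abs_nonneg _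
    calc φ i k ⬝ᵥ φ i k = ∑ c, |φ i k c| ^ 2 := by simp [dotProduct, sq]
      _ ≤ (∑ c, |φ i k c|) ^ 2 :=
          Finset.sum_sq_le_sq_sum_of_nonneg fun _ _ => abs_nonneg _
      _ ≤ R₁ ^ 2 := by gcongr
  have hωω : ∀ i, ∀ k < K, ω k i ⬝ᵥ ω k i ≤ d * R₂ ^ 2 := by
    intro i k hk
    have h1 : ∀ c, ω k i c * ω k i c ≤ R₂ ^ 2 := by
      intro c
      have h2 := (hω k (Pi.single c 1)).1 i
      simp only [dotProduct_single, mul_one] at h2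
      rw [← sq, ← sq_abs]
      have := h2.trans (hw k hk c)
      gcongr
    refine (Finset.sum_le_card_nsmul _ _ _ fun c _ => h1 c).trans ?_
    simp
  have hsum : ∀ i, ∑ k ∈ Finset.range K, |ω k i ⬝ᵥ φ i k| ≤
      √(K * ((R₁ ^ 2 * (d * R₂ ^ 2) + B) * (2 * (d * Real.log (d + K))))) := by
    intro i
    refine Real.le_sqrt_of_sq_le ?_
    have h1 := sum_sq_dotProduct_le hK (φ := φ i) (ω := fun k => ω k i) (pow_pos hR₁ 2)
      (hφ i) (hωω i) fun k hk => le_trans (Finset.sum_le_sum fun j _ => by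
        rw [← sq_abs]
        exact pow_le_pow_left₀ (abs_nonneg _) (hle i k j) 2) (hB k hk)
    have h2 := sq_sum_le_card_mul_sum_sq (s := Finset.range K) (f := fun k => |ω k i ⬝ᵥ φ i k|)
    simp only [sq_abs, Finset.card_range] at h2
    exact h2.trans (mul_le_mul_of_nonneg_left h1 (Nat.cast_nonneg _))
  calc ∑ k ∈ Finset.range K, ∑ t, μ k t * ∑ l, |w k l ⬝ᵥ y t|
      ≤ ∑ k ∈ Finset.range K, ∑ t, μ k t * (2 * ∑ i, |ω k i ⬝ᵥ y t|) :=
        Finset.sum_le_sum fun k _ => Finset.sum_le_sum fun t _ =>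
          mul_le_mul_of_nonneg_left (hω k (y t)).2 (hμ k t)
    _ = 2 * ∑ i, ∑ k ∈ Finset.range K, ω k i ⬝ᵥ φ i k := by
        simp only [hωφ, Finset.mul_sum]
        rw [Finset.sum_comm (s := (Finset.univ : Finset (Fin d)))]
        refine Finset.sum_congr rfl fun k _ => ?_
        rw [Finset.sum_comm]
        exact Finset.sum_congr rfl fun i _ => Finset.sum_congr rfl fun t _ => by ring
    _ ≤ _ := by
        refine mul_le_mul_of_nonneg_left ?_ zero_le_two
        refine (Finset.sum_le_sum fun i _ => (Finset.sum_le_sum fun k _ => le_abs_self _).trans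
          (hsum i)).trans ?_
        simp

end Elliptical

/-! ### Sequentially drawn data -/

lemma take_ofFn_length {B : Type*} {K n : ℕ} (ω : Fin K → B) (hn : n ≤ K) :
    ((List.ofFn ω).take n).length = n := by simp [hn]

section Sequential

variable {B : Type*} [Fintype B]

omit [Fintype B] in
lemma prod_take_cons (κ : List B → B → ℝ) {K : ℕ} (b : B) (ω : Fin K → B) :
    ∏ k : Fin (K + 1), κ ((List.ofFn (Fin.cons b ω : Fin (K + 1) → B)).take k)
        ((Fin.cons b ω : Fin (K + 1) → B) k) =
      κ [] b * ∏ k : Fin K, κ (b :: (List.ofFn ω).take k) (ω k) := by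
  simp [Fin.prod_univ_succ, List.ofFn_succ]

lemma sum_pi_succ {K : ℕ} (g : (Fin (K + 1) → B) → ℝ) :
    ∑ ω, g ω = ∑ b, ∑ ω : Fin K → B, g (Fin.cons b ω) := by
  rw [← (Fin.consEquiv fun _ : Fin (K + 1) => B).sum_comp, Fintype.sum_prod_type]
  rfl

/-- The total mass of a sequence of draws from sub-probability kernels is at most `1`. -/
lemma sum_prod_take_le_one (κ : List B → B → ℝ) (h0 : ∀ D b, 0 ≤ κ D b)
    (h1 : ∀ D, ∑ b, κ D b ≤ 1) (K : ℕ) :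
    ∑ ω : Fin K → B, ∏ k : Fin K, κ ((List.ofFn ω).take k) (ω k) ≤ 1 := by
  induction K generalizing κ with
  | zero => simp
  | succ K ih =>
    rw [sum_pi_succ]
    simp only [prod_take_cons, ← Finset.mul_sum]
    refine (Finset.sum_le_sum fun b _ => mul_le_of_le_one_right (h0 _ _) ?_).trans (h1 [])
    exact ih (fun D => κ (b :: D)) (fun D => h0 _) fun D => h1 _

lemma sum_prod_take_eq_one (κ : List B → B → ℝ) (h1 : ∀ D, ∑ b, κ D b = 1) (K : ℕ) :
    ∑ ω : Fin K → B, ∏ k : Fin K, κ ((List.ofFn ω).take k) (ω k) = 1 := by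
  induction K generalizing κ with
  | zero => simp
  | succ K ih =>
    rw [sum_pi_succ]
    simp only [prod_take_cons, ← Finset.mul_sum]
    rw [← h1 []]
    refine Finset.sum_congr rfl fun b _ => ?_
    rw [ih (fun D => κ (b :: D)) fun D => h1 _, mul_one]

end Sequential

/-! ### The Hellinger distance -/

section Hellinger

variable {X : Type*} [Fintype X] {G P : X → ℝ} {ε : ℝ}

/-- The mean of the square root of a likelihood ratio, in terms of the Hellinger distance. -/
lemma sum_mul_sqrt_div_le (hG : ∀ x, 0 ≤ G x) (hP : ∀ x, 0 ≤ P x) (hP1 : ∑ x, P x = 1)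
    (hG1 : ∑ x, G x ≤ 1 + ε) :
    ∑ x, P x * √(G x / P x) ≤ 1 + ε / 2 - (∑ x, (√(G x) - √(P x)) ^ 2) / 2 := by
  have h1 : ∀ x, P x * √(G x / P x) = √(G x) * √(P x) := by
    intro x
    rw [Real.sqrt_div (hG x)]
    rcases eq_or_ne (P x) 0 with h | h
    · simp [h]
    · have : √(P x) ≠ 0 := by
        rw [Real.sqrt_ne_zero (hP x)]
        exact h
      field_simp
      rw [Real.sq_sqrt (hP x), mul_comm]
  have h2 : ∀ x, (√(G x) - √(P x)) ^ 2 = G x + P x - 2 * (√(G x) * √(P x)) := by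
    intro x
    rw [sub_sq, Real.sq_sqrt (hG x), Real.sq_sqrt (hP x)]
    ring
  simp only [h1, h2, Finset.sum_sub_distrib, Finset.sum_add_distrib, ← Finset.mul_sum]
  linarith

/-- The total variation distance is at most of the order of the Hellinger distance. -/
lemma sum_abs_sub_sq_le (hG : ∀ x, 0 ≤ G x) (hP : ∀ x, 0 ≤ P x) (hP1 : ∑ x, P x = 1)
    (hG1 : ∑ x, G x ≤ 2) :
    (∑ x, |G x - P x|) ^ 2 ≤ 6 * ∑ x, (√(G x) - √(P x)) ^ 2 := by
  have h1 : ∀ x, |G x - P x| = |√(G x) - √(P x)| * (√(G x) + √(P x)) := by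
    intro x
    have hs : 0 ≤ √(G x) + √(P x) := by positivity
    rw [← abs_of_nonneg hs, ← abs_mul]
    congr 1
    nlinarith [Real.sq_sqrt (hG x), Real.sq_sqrt (hP x)]
  simp only [h1]
  refine (Finset.sum_mul_sq_le_sq_mul_sq _ _ _).trans ?_
  simp only [sq_abs]
  rw [mul_comm]
  refine mul_le_mul_of_nonneg_right ?_ (Finset.sum_nonneg fun _ _ => sq_nonneg _)
  have h2 : ∀ x, (√(G x) + √(P x)) ^ 2 ≤ 2 * G x + 2 * P x := by
    intro x
    nlinarith [Real.sq_sqrt (hG x), Real.sq_sqrt (hP x), sq_nonneg (√(G x) - √(P x))]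
  refine (Finset.sum_le_sum fun x _ => h2 x).trans ?_
  rw [Finset.sum_add_distrib, ← Finset.mul_sum, ← Finset.mul_sum]
  linarith

end Hellinger

/-! ### Maximum likelihood -/

section Likelihood

variable {S O A : Type*} [Fintype S] [Fintype O] [Fintype A] [Nonempty A] {H m : ℕ}

omit [Nonempty A] in
lemma trajProb_eq (M : POMDP S O A) (π : Policy O A) (τ : Traj O A H) :
    M.trajProb π τ = π.seq [] (List.ofFn τ) * M.prob (List.ofFn τ) := by
  rw [POMDP.trajProb, Policy.prob_eq_seq, mul_comm]

omit [Nonempty A] in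
lemma trajProb_nonneg (M : POMDP S O A) (π : Policy O A) (τ : Traj O A H) :
    0 ≤ M.trajProb π τ := by
  rw [trajProb_eq]
  exact mul_nonneg (π.seq_nonneg _ _) (M.prob_nonneg _)

lemma sum_trajProb (M : POMDP S O A) (π : Policy O A) :
    ∑ τ : Traj O A H, M.trajProb π τ = 1 := by
  simp only [trajProb_eq]
  exact (M.isProcess_prob.sum_seq π [] H).trans M.prob_nil

omit [Nonempty A] in
lemma tvDist_eq (f M : POMDP S O A) (π : Policy O A) :
    tvDist H f M π = ∑ τ : Traj O A H, |f.trajProb π τ - M.trajProb π τ| := by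
  refine Finset.sum_congr rfl fun τ _ => ?_
  rw [trajProb_eq, trajProb_eq, ← mul_sub, abs_mul, abs_of_nonneg (π.seq_nonneg _ _)]

/-- The policy of iteration `k` and query `q` on the run `ω`. -/
noncomputable def Selector.runPolicy (sel : Selector S O A H m) {K : ℕ}
    (ω : Fin K → Batch O A H m) (k : ℕ) (q : Query A H m) : Policy O A :=
  explore (sel ((List.ofFn ω).take k)).2 q

open Classical in
lemma Selector.sum_runProb (sel : Selector S O A H m) (M : POMDP S O A) (K : ℕ) :
    ∑ ω : Fin K → Batch O A H m, sel.runProb M ω = 1 := by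
  refine sum_prod_take_eq_one
    (fun D b => ∏ q, M.trajProb (explore (sel D).2 q) (b q)) (fun D => ?_) K
  rw [← Fintype.prod_sum]
  exact Finset.prod_eq_one fun q _ => sum_trajProb M _

lemma Selector.runProb_nonneg (sel : Selector S O A H m) (M : POMDP S O A) {K : ℕ}
    (ω : Fin K → Batch O A H m) : 0 ≤ sel.runProb M ω :=
  Finset.prod_nonneg fun _ _ => Finset.prod_nonneg fun _ _ => trajProb_nonneg _ _ _

/-- The (squared, unnormalized) Hellinger distance of a function `G` and the trajectory distribution
of `M`. -/
noncomputable def hell (G : Policy O A → Traj O A H → ℝ) (M : POMDP S O A) (π : Policy O A) : ℝ :=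
  ∑ τ, (√(G π τ) - √(M.trajProb π τ)) ^ 2

omit [Nonempty A] in
lemma hell_nonneg (G : Policy O A → Traj O A H → ℝ) (M : POMDP S O A) (π : Policy O A) :
    0 ≤ hell G M π :=
  Finset.sum_nonneg fun _ _ => sq_nonneg _

/-- The square root of the likelihood ratio of `G` and `M`, compensated so that its mean is at most
`1`. -/
noncomputable def ratioFactor (G : Policy O A → Traj O A H → ℝ) (M : POMDP S O A) (ε : ℝ)
    (π : Policy O A) (τ : Traj O A H) : ℝ :=
  √(G π τ / M.trajProb π τ) * Real.exp (hell G M π / 2 - ε / 2)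

omit [Nonempty A] in
lemma ratioFactor_nonneg (G : Policy O A → Traj O A H → ℝ) (M : POMDP S O A) (ε : ℝ)
    (π : Policy O A) (τ : Traj O A H) : 0 ≤ ratioFactor G M ε π τ :=
  mul_nonneg (Real.sqrt_nonneg _) (Real.exp_nonneg _)

lemma sum_trajProb_mul_ratioFactor_le {G : Policy O A → Traj O A H → ℝ} (M : POMDP S O A) {ε : ℝ}
    (hG : ∀ π τ, 0 ≤ G π τ) (hG1 : ∀ π, ∑ τ, G π τ ≤ 1 + ε) (π : Policy O A) :
    ∑ τ, M.trajProb π τ * ratioFactor G M ε π τ ≤ 1 := by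
  simp only [ratioFactor, ← mul_assoc, ← Finset.sum_mul]
  have h1 := sum_mul_sqrt_div_le (hG π) (trajProb_nonneg M π) (sum_trajProb M π) (hG1 π)
  have h2 : 1 + ε / 2 - hell G M π / 2 ≤ Real.exp (-(hell G M π / 2 - ε / 2)) := by
    have := Real.add_one_le_exp (-(hell G M π / 2 - ε / 2))
    linarith
  refine (mul_le_mul_of_nonneg_right (h1.trans h2) (Real.exp_nonneg _)).trans ?_
  rw [← Real.exp_add]
  simp

/-- The compensated likelihood ratio of the data of the first `n` iterations. -/
noncomputable def Selector.ratio (sel : Selector S O A H m) (G : Policy O A → Traj O A H → ℝ)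
    (M : POMDP S O A) (ε : ℝ) (n : ℕ) {K : ℕ} (ω : Fin K → Batch O A H m) : ℝ :=
  ∏ k : Fin K, ∏ q, if (k : ℕ) < n then ratioFactor G M ε (sel.runPolicy ω k q) (ω k q) else 1

open Classical in
lemma Selector.sum_runProb_mul_ratio_le (sel : Selector S O A H m)
    {G : Policy O A → Traj O A H → ℝ} (M : POMDP S O A) {ε : ℝ}
    (hG : ∀ π τ, 0 ≤ G π τ) (hG1 : ∀ π, ∑ τ, G π τ ≤ 1 + ε) (n K : ℕ) :
    ∑ ω : Fin K → Batch O A H m, sel.runProb M ω * sel.ratio G M ε n ω ≤ 1 := by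
  let κ : List (Batch O A H m) → Batch O A H m → ℝ := fun D b =>
    ∏ q, M.trajProb (explore (sel D).2 q) (b q) *
      if D.length < n then ratioFactor G M ε (explore (sel D).2 q) (b q) else 1
  have hκ0 : ∀ D b, 0 ≤ κ D b := fun D b => Finset.prod_nonneg fun q _ =>
    mul_nonneg (trajProb_nonneg _ _ _) (by
      split_ifs
      · exact ratioFactor_nonneg _ _ _ _ _
      · exact zero_le_one)
  have hκ1 : ∀ D, ∑ b, κ D b ≤ 1 := by
    intro D
    have h := Fintype.prod_sum fun (q : Query A H m) (τ : Traj O A H) =>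
      M.trajProb (explore (sel D).2 q) τ *
        if D.length < n then ratioFactor G M ε (explore (sel D).2 q) τ else 1
    refine h.symm.le.trans (Finset.prod_le_one (fun q _ => Finset.sum_nonneg fun τ _ => ?_)
      fun q _ => ?_)
    · refine mul_nonneg (trajProb_nonneg _ _ _) ?_
      split_ifs
      · exact ratioFactor_nonneg _ _ _ _ _
      · exact zero_le_one
    · split_ifs
      · exact sum_trajProb_mul_ratioFactor_le M hG hG1 _
      · simp [sum_trajProb]
  refine le_trans (le_of_eq ?_) (sum_prod_take_le_one κ hκ0 hκ1 K)
  refine Finset.sum_congr rfl fun ω _ => ?_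
  rw [runProb, ratio, ← Finset.prod_mul_distrib]
  refine Finset.prod_congr rfl fun k _ => ?_
  rw [← Finset.prod_mul_distrib]
  refine Finset.prod_congr rfl fun q _ => ?_
  rw [take_ofFn_length ω k.2.le]
  rfl

open Classical in
/-- Markov's inequality for the compensated likelihood ratio. -/
lemma Selector.sum_runProb_ratio_gt_le (sel : Selector S O A H m)
    {G : Policy O A → Traj O A H → ℝ} (M : POMDP S O A) {ε : ℝ}
    (hG : ∀ π τ, 0 ≤ G π τ) (hG1 : ∀ π, ∑ τ, G π τ ≤ 1 + ε) (n K : ℕ) {t : ℝ} (ht : 0 < t) :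
    ∑ ω : Fin K → Batch O A H m, (if t < sel.ratio G M ε n ω then sel.runProb M ω else 0) ≤
      1 / t := by
  rw [le_div_iff₀ ht, Finset.sum_mul]
  refine (Finset.sum_le_sum fun ω _ => ?_).trans (sel.sum_runProb_mul_ratio_le M hG hG1 n K)
  split_ifs with h
  · exact mul_le_mul_of_nonneg_left h.le (sel.runProb_nonneg M ω)
  · rw [zero_mul]
    refine mul_nonneg (sel.runProb_nonneg M ω) (Finset.prod_nonneg fun k _ =>
      Finset.prod_nonneg fun q _ => ?_)
    split_ifs
    · exact ratioFactor_nonneg _ _ _ _ _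
    · exact zero_le_one

lemma coe_sum_ereal {ι : Type*} (s : Finset ι) (f : ι → ℝ) :
    ((∑ i ∈ s, f i : ℝ) : EReal) = ∑ i ∈ s, (f i : EReal) := by
  classical
  induction s using Finset.induction_on with
  | empty => simp
  | insert a s ha ih => rw [Finset.sum_insert ha, Finset.sum_insert ha, EReal.coe_add, ih]

lemma sum_eq_bot_ereal {ι : Type*} {s : Finset ι} {f : ι → EReal} {i : ι} (hi : i ∈ s)
    (h : f i = ⊥) : ∑ i ∈ s, f i = ⊥ := by
  classical
  rw [← Finset.add_sum_erase s f hi, h, EReal.bot_add]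

/-- The log-likelihood, as a real number, of the data of the first `n` iterations. -/
noncomputable def Selector.runLogLik (sel : Selector S O A H m) {K : ℕ}
    (ω : Fin K → Batch O A H m) (n : ℕ) (f : POMDP S O A) : ℝ :=
  ∑ k : Fin K, ∑ q, if (k : ℕ) < n then Real.log (f.trajProb (sel.runPolicy ω k q) (ω k q)) else 0

lemma sum_fin_ite_lt {R : Type*} [AddCommMonoid R] {K n : ℕ} (hn : n ≤ K) (g : Fin K → R) :
    ∑ k : Fin K, (if (k : ℕ) < n then g k else 0) = ∑ k : Fin n, g (k.castLE hn) := by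
  obtain ⟨j, rfl⟩ := Nat.exists_eq_add_of_le hn
  rw [Fin.sum_univ_add]
  have h1 : ∀ i : Fin j, ¬ (((Fin.natAdd n i : Fin (n + j)) : ℕ) < n) := by
    intro i
    simp
  simp only [Fin.val_castAdd, Fin.is_lt, if_true, h1, if_false, Finset.sum_const_zero, add_zero]
  rfl

lemma Selector.logLik_take (sel : Selector S O A H m) {K n : ℕ} (hn : n ≤ K)
    (ω : Fin K → Batch O A H m) (f : POMDP S O A) :
    sel.logLik ((List.ofFn ω).take n) f =
      ∑ k : Fin K, ∑ q, if (k : ℕ) < n then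
        ENNReal.log (ENNReal.ofReal (f.trajProb (sel.runPolicy ω k q) (ω k q))) else 0 := by
  have h1 : ∀ k : Fin K, (∑ q, if (k : ℕ) < n then
        ENNReal.log (ENNReal.ofReal (f.trajProb (sel.runPolicy ω k q) (ω k q))) else 0) =
      if (k : ℕ) < n then ∑ q,
        ENNReal.log (ENNReal.ofReal (f.trajProb (sel.runPolicy ω k q) (ω k q))) else 0 := by
    intro k
    split_ifs <;> simp
  simp only [h1]
  rw [sum_fin_ite_lt hn, logLik]
  refine Fintype.sum_equiv (finCongr (take_ofFn_length ω hn)) _ _ fun k => ?_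
  refine Finset.sum_congr rfl fun q _ => ?_
  have hk : (k : ℕ) < n := lt_of_lt_of_eq k.2 (take_ofFn_length ω hn)
  have h2 : ((List.ofFn ω).take n).get k = ω ((finCongr (take_ofFn_length ω hn) k).castLE hn) := by
    simp [List.getElem_take]
    rfl
  have h3 : ((List.ofFn ω).take n).take k = (List.ofFn ω).take k := by
    rw [List.take_take, min_eq_left hk.le]
  rw [h2, queryPolicy, h3]
  rfl

lemma Selector.logLik_take_of_pos (sel : Selector S O A H m) {K n : ℕ} (hn : n ≤ K)
    (ω : Fin K → Batch O A H m) (f : POMDP S O A)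
    (hf : ∀ k : Fin K, (k : ℕ) < n → ∀ q, 0 < f.trajProb (sel.runPolicy ω k q) (ω k q)) :
    sel.logLik ((List.ofFn ω).take n) f = (sel.runLogLik ω n f : ℝ) := by
  rw [sel.logLik_take hn, runLogLik, coe_sum_ereal]
  refine Finset.sum_congr rfl fun k _ => ?_
  rw [coe_sum_ereal]
  refine Finset.sum_congr rfl fun q _ => ?_
  split_ifs with h
  · rw [ENNReal.log_ofReal_of_pos (hf k h q)]
  · simp

lemma Selector.logLik_take_eq_bot (sel : Selector S O A H m) {K n : ℕ} (hn : n ≤ K)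
    (ω : Fin K → Batch O A H m) (f : POMDP S O A) {k : Fin K} (hk : (k : ℕ) < n)
    {q : Query A H m} (hf : f.trajProb (sel.runPolicy ω k q) (ω k q) = 0) :
    sel.logLik ((List.ofFn ω).take n) f = ⊥ := by
  rw [sel.logLik_take hn]
  refine sum_eq_bot_ereal (Finset.mem_univ k) (sum_eq_bot_ereal (Finset.mem_univ q) ?_)
  simp [hk, hf]

/-- If the compensated likelihood ratio of an upper bound `G` for `f` is at most `t`, the Hellinger
distances of the first `n` iterations are controlled by the log-likelihood ratio of `M` and `f`. -/
lemma Selector.sum_hell_le (sel : Selector S O A H m) {G : Policy O A → Traj O A H → ℝ}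
    {f M : POMDP S O A} {ε t : ℝ} {K n : ℕ} (ω : Fin K → Batch O A H m)
    (hε : 0 ≤ ε) (hεK : (K * Fintype.card (Query A H m) : ℝ) * ε ≤ 1)
    (hfG : ∀ π (τ : Traj O A H), f.trajProb π τ ≤ G π τ)
    (hf : ∀ k : Fin K, (k : ℕ) < n → ∀ q, 0 < f.trajProb (sel.runPolicy ω k q) (ω k q))
    (hM : ∀ k : Fin K, ∀ q, 0 < M.trajProb (sel.runPolicy ω k q) (ω k q))
    (ht : sel.ratio G M ε n ω ≤ t) :
    (∑ k : Fin K, ∑ q, if (k : ℕ) < n then hell G M (sel.runPolicy ω k q) else 0) ≤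
      2 * Real.log t + 1 + (sel.runLogLik ω n M - sel.runLogLik ω n f) := by
  have hfac : ∀ (k : Fin K) q, 0 < (if (k : ℕ) < n then
      ratioFactor G M ε (sel.runPolicy ω k q) (ω k q) else 1) := by
    intro k q
    split_ifs with h
    · have h1 := (hf k h q).trans_le (hfG _ _)
      have h2 := hM k q
      unfold ratioFactor
      positivity
    · exact one_pos
  have hpos : 0 < sel.ratio G M ε n ω :=
    Finset.prod_pos fun k _ => Finset.prod_pos fun q _ => hfac k q
  have h1 := Real.log_le_log hpos ht
  rw [ratio, Real.log_prod fun k _ => (Finset.prod_pos fun q _ => hfac k q).ne'] at h1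
  have h2 : ∀ k : Fin K, Real.log (∏ q, if (k : ℕ) < n then
      ratioFactor G M ε (sel.runPolicy ω k q) (ω k q) else 1) =
      ∑ q, Real.log (if (k : ℕ) < n then
        ratioFactor G M ε (sel.runPolicy ω k q) (ω k q) else 1) := fun k =>
    Real.log_prod fun q _ => (hfac k q).ne'
  simp only [h2] at h1
  have h3 : ∀ (k : Fin K) q, ((if (k : ℕ) < n then hell G M (sel.runPolicy ω k q) else 0) -
      ((if (k : ℕ) < n then Real.log (M.trajProb (sel.runPolicy ω k q) (ω k q)) else 0) -
      (if (k : ℕ) < n then Real.log (f.trajProb (sel.runPolicy ω k q) (ω k q)) else 0))) - ε ≤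
      2 * Real.log (if (k : ℕ) < n then
        ratioFactor G M ε (sel.runPolicy ω k q) (ω k q) else 1) := by
    intro k q
    split_ifs with h
    · have hG := (hf k h q).trans_le (hfG _ _)
      have hMk := hM k q
      rw [ratioFactor, Real.log_mul (by positivity) (Real.exp_ne_zero _), Real.log_exp,
        Real.log_sqrt (by positivity), Real.log_div hG.ne' hMk.ne']
      have := Real.log_le_log (hf k h q) (hfG (sel.runPolicy ω k q) (ω k q))
      linarith
    · simpa using hε
  have h4 := Finset.sum_le_sum fun k (_ : k ∈ Finset.univ) =>
    Finset.sum_le_sum fun q (_ : q ∈ Finset.univ) => h3 k q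
  simp only [Finset.sum_sub_distrib, ← Finset.mul_sum] at h4
  simp only [Finset.sum_const, Finset.card_univ, nsmul_eq_mul, Fintype.card_fin] at h4
  simp only [runLogLik]
  rw [mul_assoc] at hεK
  linarith

open Classical in
/-- Guarantees for maximum likelihood: with high probability, the true model stays in all confidence
sets, and all models in a confidence set are close to it under the policies used so far. -/
theorem Selector.exists_good_event (sel : Selector S O A H m) {F : Set (POMDP S O A)}
    {M : POMDP S O A} (hMF : M ∈ F) {ε δ β : ℝ} {K N : ℕ} (hK : 0 < K)
    (hbr : HasBracket F H ε N) (hε : 0 ≤ ε) (hε1 : ε ≤ 1)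
    (hεK : (K * Fintype.card (Query A H m) : ℝ) * ε ≤ 1) (hδ : 0 < δ)
    (hβ1 : 1 ≤ β) (hβ : 1 + 2 * Real.log (N * K / δ) ≤ β) :
    ∃ bad : (Fin K → Batch O A H m) → Prop,
      ∑ ω, (if bad ω then sel.runProb M ω else 0) ≤ δ ∧
      ∀ ω, ¬ bad ω → 0 < sel.runProb M ω → ∀ n < K,
        M ∈ sel.confSet F β ((List.ofFn ω).take n) ∧
        ∀ f ∈ sel.confSet F β ((List.ofFn ω).take n),
          ∑ k ∈ Finset.range n, ∑ q, tvDist H f M (sel.runPolicy ω k q) ^ 2 ≤ 26 * β := by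
  obtain ⟨g₁, g₂, hg, hcov⟩ := hbr
  have hN : 0 < N := by
    obtain ⟨i, -⟩ := hcov M hMF
    exact i.pos
  set t : ℝ := N * K / δ with ht
  have ht0 : 0 < t := by positivity
  let used : Fin N → Prop := fun i => ∃ f ∈ F, ∀ π τ,
    g₁ i π τ ≤ f.trajProb π τ ∧ f.trajProb π τ ≤ g₂ i π τ
  have habs : ∀ i (f : POMDP S O A), (∀ π τ, g₁ i π τ ≤ f.trajProb π τ ∧
      f.trajProb π τ ≤ g₂ i π τ) → ∀ π, ∑ τ, |f.trajProb π τ - g₂ i π τ| ≤ ε := by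
    intro i f hf π
    refine (Finset.sum_le_sum fun τ _ => ?_).trans (hg i π)
    obtain ⟨h1, h2⟩ := hf π τ
    rw [abs_sub_comm, abs_sub_comm (g₁ i π τ), abs_of_nonneg (by linarith),
      abs_of_nonneg (by linarith)]
    linarith
  have hg0 : ∀ i, used i → ∀ π τ, 0 ≤ g₂ i π τ := by
    rintro i ⟨f, -, hf⟩ π τ
    exact (trajProb_nonneg f π τ).trans (hf π τ).2
  have hg1 : ∀ i, used i → ∀ π, ∑ τ, g₂ i π τ ≤ 1 + ε := by
    rintro i ⟨f, -, hf⟩ π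
    rw [← sum_trajProb (H := H) f π]
    refine le_trans ?_ (add_le_add_right (habs i f hf π) _)
    rw [← Finset.sum_add_distrib]
    refine Finset.sum_le_sum fun τ _ => ?_
    rw [abs_sub_comm]
    linarith [le_abs_self (g₂ i π τ - f.trajProb π τ)]
  obtain ⟨bad, hbad⟩ : ∃ bad : (Fin K → Batch O A H m) → Prop, ∀ ω, bad ω ↔
      ∃ i, used i ∧ ∃ n : Fin K, t < sel.ratio (g₂ i) M ε n ω := ⟨_, fun _ => Iff.rfl⟩
  refine ⟨bad, ?_, ?_⟩
  · calc ∑ ω : Fin K → Batch O A H m,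
          (if bad ω then sel.runProb M ω else 0)
        ≤ ∑ ω : Fin K → Batch O A H m, ∑ i, ∑ n : Fin K,
            (if used i ∧ t < sel.ratio (g₂ i) M ε n ω then sel.runProb M ω else 0) := by
          refine Finset.sum_le_sum fun ω _ => ?_
          have hnn : ∀ i (n : Fin K), 0 ≤
              (if used i ∧ t < sel.ratio (g₂ i) M ε n ω then sel.runProb M ω else 0) := by
            intro i n
            split_ifs
            · exact sel.runProb_nonneg M ω
            · exact le_rfl
          split_ifs with h
          · obtain ⟨i, hi, n, hin⟩ := (hbad ω).1 h
            calc sel.runProb M ω = (if used i ∧ t < sel.ratio (g₂ i) M ε n ω then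
                  sel.runProb M ω else 0) := by rw [if_pos ⟨hi, hin⟩]
              _ ≤ _ := Finset.single_le_sum (fun n _ => hnn i n) (Finset.mem_univ n)
              _ ≤ _ := Finset.single_le_sum
                (f := fun i => ∑ n : Fin K, (if used i ∧ t < sel.ratio (g₂ i) M ε n ω then
                  sel.runProb M ω else 0))
                (fun i _ => Finset.sum_nonneg fun n _ => hnn i n) (Finset.mem_univ i)
          · exact Finset.sum_nonneg fun i _ => Finset.sum_nonneg fun n _ => hnn i n
      _ = ∑ i, ∑ n : Fin K, ∑ ω : Fin K → Batch O A H m,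
            (if used i ∧ t < sel.ratio (g₂ i) M ε n ω then sel.runProb M ω else 0) := by
          rw [Finset.sum_comm]
          exact Finset.sum_congr rfl fun i _ => Finset.sum_comm
      _ ≤ ∑ _i : Fin N, ∑ _n : Fin K, 1 / t := by
          refine Finset.sum_le_sum fun i _ => Finset.sum_le_sum fun n _ => ?_
          by_cases hi : used i
          · simp only [hi, true_and]
            exact sel.sum_runProb_ratio_gt_le M (hg0 i hi) (hg1 i hi) n K ht0
          · simp only [hi, false_and, if_false, Finset.sum_const_zero]
            positivity
      _ = δ := by
          simp only [Finset.sum_const, Finset.card_univ, Fintype.card_fin, nsmul_eq_mul, ht]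
          field_simp
  · intro ω hω hpos n hn
    have hMpos : ∀ k : Fin K, ∀ q, 0 < M.trajProb (sel.runPolicy ω k q) (ω k q) := by
      intro k q
      refine lt_of_le_of_ne (trajProb_nonneg _ _ _) fun h0 => hpos.ne' ?_
      exact Finset.prod_eq_zero (Finset.mem_univ k) (Finset.prod_eq_zero (Finset.mem_univ q)
        h0.symm)
    have hMll := sel.logLik_take_of_pos hn.le ω M fun k _ q => hMpos k q
    have hratio : ∀ i, used i → sel.ratio (g₂ i) M ε n ω ≤ t := by
      intro i hi
      by_contra! h
      exact hω ((hbad ω).2 ⟨i, hi, ⟨n, hn⟩, h⟩)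
    refine ⟨⟨hMF, fun f hf => ?_⟩, fun f hf => ?_⟩
    · by_cases hfpos : ∀ k : Fin K, (k : ℕ) < n → ∀ q,
          0 < f.trajProb (sel.runPolicy ω k q) (ω k q)
      · obtain ⟨i, hi⟩ := hcov f hf
        have h1 := sel.sum_hell_le ω hε hεK (fun π τ => (hi π τ).2) hfpos hMpos
          (hratio i ⟨f, hf, hi⟩)
        have h2 : 0 ≤ ∑ k : Fin K, ∑ q, if (k : ℕ) < n then
            hell (g₂ i) M (sel.runPolicy ω k q) else 0 :=
          Finset.sum_nonneg fun k _ => Finset.sum_nonneg fun q _ => by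
            split_ifs
            · exact hell_nonneg _ _ _
            · exact le_rfl
        rw [sel.logLik_take_of_pos hn.le ω f hfpos, hMll, ← EReal.coe_add, EReal.coe_le_coe_iff]
        linarith
      · push Not at hfpos
        obtain ⟨k, hk, q, h0⟩ := hfpos
        rw [sel.logLik_take_eq_bot hn.le ω f hk (le_antisymm h0 (trajProb_nonneg _ _ _))]
        exact bot_le
    · obtain ⟨hfF, hfM⟩ := hf
      have h0 := hfM M hMF
      have hfpos : ∀ k : Fin K, (k : ℕ) < n → ∀ q,
          0 < f.trajProb (sel.runPolicy ω k q) (ω k q) := by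
        intro k hk q
        refine lt_of_le_of_ne (trajProb_nonneg _ _ _) fun hz => ?_
        rw [hMll, sel.logLik_take_eq_bot hn.le ω f hk hz.symm, EReal.bot_add] at h0
        exact EReal.coe_ne_bot _ (le_bot_iff.1 h0)
      rw [hMll, sel.logLik_take_of_pos hn.le ω f hfpos, ← EReal.coe_add,
        EReal.coe_le_coe_iff] at h0
      obtain ⟨i, hi⟩ := hcov f hfF
      have h1 := sel.sum_hell_le ω hε hεK (fun π τ => (hi π τ).2) hfpos hMpos
        (hratio i ⟨f, hfF, hi⟩)
      have h2 : ∀ π, tvDist H f M π ^ 2 ≤ 2 * ε + 12 * hell (g₂ i) M π := by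
        intro π
        have h3 := sum_abs_sub_sq_le (hg0 i ⟨f, hfF, hi⟩ π) (trajProb_nonneg M π)
          (sum_trajProb M π) ((hg1 i ⟨f, hfF, hi⟩ π).trans (by linarith))
        have h4 := habs i f hi π
        have h5 : tvDist H f M π ≤ ∑ τ, |f.trajProb π τ - g₂ i π τ| +
            ∑ τ, |g₂ i π τ - M.trajProb π τ| := by
          rw [tvDist_eq, ← Finset.sum_add_distrib]
          exact Finset.sum_le_sum fun τ _ => abs_sub_le _ _ _
        have h6 := tvDist_nonneg (H := H) f M π
        have h7 : hell (g₂ i) M π = ∑ τ, (√(g₂ i π τ) - √(M.trajProb π τ)) ^ 2 := rfl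
        set a := ∑ τ, |f.trajProb π τ - g₂ i π τ| with ha
        set b := ∑ τ, |g₂ i π τ - M.trajProb π τ| with hb
        have ha0 : 0 ≤ a := Finset.sum_nonneg fun _ _ => abs_nonneg _
        have h8 : tvDist H f M π ^ 2 ≤ (a + b) ^ 2 := by gcongr
        nlinarith [sq_nonneg (a - b), mul_le_mul h4 (h4.trans hε1) ha0 hε]
      have h3 : ∑ k ∈ Finset.range n, ∑ q, tvDist H f M (sel.runPolicy ω k q) ^ 2 =
          ∑ k : Fin K, ∑ q, if (k : ℕ) < n then tvDist H f M (sel.runPolicy ω k q) ^ 2 else 0 := by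
        rw [Finset.sum_range fun k => ∑ q, tvDist H f M (sel.runPolicy ω k q) ^ 2]
        have := sum_fin_ite_lt hn.le fun k : Fin K => ∑ q, tvDist H f M (sel.runPolicy ω k q) ^ 2
        simp only [Fin.val_castLE] at this
        rw [← this]
        refine Finset.sum_congr rfl fun k _ => ?_
        split_ifs <;> simp
      have h4 : (∑ k : Fin K, ∑ q, if (k : ℕ) < n then
            tvDist H f M (sel.runPolicy ω k q) ^ 2 else 0) ≤
          ∑ k : Fin K, ∑ q, (2 * ε + 12 * if (k : ℕ) < n then
            hell (g₂ i) M (sel.runPolicy ω k q) else 0) := by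
        refine Finset.sum_le_sum fun k _ => Finset.sum_le_sum fun q _ => ?_
        split_ifs
        · exact h2 _
        · linarith
      simp only [Finset.sum_add_distrib, ← Finset.mul_sum] at h4
      simp only [Finset.sum_const, Finset.card_univ, nsmul_eq_mul, Fintype.card_fin] at h4
      rw [mul_assoc] at hεK
      rw [h3]
      linarith

end Likelihood

/-! ### The regret of optimistic planning -/

section Regret

variable {S O A : Type*} [Fintype S] [Fintype O] [Fintype A] [Nonempty A] {H m : ℕ}

/-- At steps at which no `m`-step future fits, empty core data are used. -/
lemma POMDP.IsRegular.exists_coreData {M : POMDP S O A} {α : ℝ} (hm : 1 ≤ m) (hα : 0 < α)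
    (hreg : M.IsRegular H m α) (hcore : M.FuturesAreCore H m) :
    ∃ D : ∀ h, CoreData M.prob H m h (1 / α), ∀ h, (D h).d ≤ M.psrRank H := by
  have key : ∀ h, ∃ D : CoreData M.prob H m h (1 / α), D.d ≤ M.psrRank H := by
    intro h
    by_cases hh : h + m ≤ H
    · obtain ⟨d, hd, c, P, hc, hP, heq⟩ := hreg.exists_core hm hcore hh
      exact ⟨⟨d, c, P, hc, hP, fun _ => heq⟩, hd⟩
    · refine ⟨⟨0, Fin.elim0, Matrix.of Fin.elim0, fun i => i.elim0, fun x => ?_,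
        fun h' => absurd h' hh⟩, Nat.zero_le _⟩
      simp only [Finset.univ_eq_empty, Finset.sum_empty]
      exact mul_nonneg (by positivity) (Finset.sum_nonneg fun _ _ => abs_nonneg _)
  choose D hD using key
  exact ⟨D, hD⟩

lemma log_nat_add_le {d K : ℕ} (hK : 0 < K) {Y : ℝ} (hd : (d : ℝ) ≤ Y) (hY : 1 ≤ Y) :
    Real.log (d + K) ≤ Y * (1 + Real.log K) := by
  have hK1 : (1 : ℝ) ≤ K := by exact_mod_cast hK
  have hd0 : (0 : ℝ) ≤ d := Nat.cast_nonneg d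
  have hlog := Real.log_nonneg hK1
  calc Real.log (d + K) ≤ Real.log ((1 + d) * K) :=
        Real.log_le_log (by positivity) (by nlinarith)
    _ = Real.log (1 + d) + Real.log K := Real.log_mul (by positivity) (by positivity)
    _ ≤ d + Real.log K := by
        have := Real.log_le_sub_one_of_pos (show (0 : ℝ) < 1 + d by positivity)
        linarith
    _ ≤ _ := by nlinarith

/-- If `f k` is close to `M` under the exploration policies for all `π j` with `j < k`, it is on
average close to `M` under the policy `π k` itself. -/
theorem sum_tvDist_le [Nonempty O] (hm : 1 ≤ m) (hmH : m ≤ H) {C Y B : ℝ} (hC : 0 ≤ C)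
    {f : ℕ → POMDP S O A} {M : POMDP S O A} (π : ℕ → Policy O A)
    (D : ∀ k h, CoreData (f k).prob H m h C) (D' : ∀ h, CoreData M.prob H m h C) (hY : 1 ≤ Y)
    (hd : ∀ h, ((D' h).d : ℝ) ≤ Y) (hCY : C ≤ Y) (hAY : (Fintype.card A : ℝ) ^ m ≤ Y)
    (hHY : (H : ℝ) ≤ Y) {K : ℕ} (hK : 0 < K)
    (hB : ∀ k < K, ∑ j ∈ Finset.range k, ∑ q : Query A H m,
      tvDist H (f k) M (explore (π j) q) ^ 2 ≤ B) :
    ∑ k ∈ Finset.range K, tvDist H (f k) M (π k) ≤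
      8 * Y ^ 3 * √(8 * K * Y ^ 13 * (1 + B) * (1 + Real.log K)) := by
  have hY0 : 0 < Y := by linarith
  have hA1 : (1 : ℝ) ≤ Fintype.card A := by exact_mod_cast Fintype.card_pos
  have hUY : (Fintype.card A : ℝ) ^ (m - 1) ≤ Y :=
    (pow_le_pow_right₀ hA1 (Nat.sub_le m 1)).trans hAY
  have hAY1 : (Fintype.card A : ℝ) ≤ Y := by
    refine le_trans ?_ hAY
    simpa using pow_le_pow_right₀ hA1 hm
  have hK1 : (1 : ℝ) ≤ K := by exact_mod_cast hK
  have hlogK := Real.log_nonneg hK1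
  have hB0 : 0 ≤ B := by simpa using hB 0 hK
  have hQD0 : ∀ k j (h : Fin (H - m + 1)), 0 ≤ queryDist H m (f k) M (π j) h := fun k j h =>
    Finset.sum_nonneg fun u _ => tvDist_nonneg _ _ _
  have hQD : ∀ k < K, ∀ h : Fin (H - m + 1),
      ∑ j ∈ Finset.range k, queryDist H m (f k) M (π j) h ^ 2 ≤ Y * B := by
    intro k hk h
    have h1 : ∀ j, queryDist H m (f k) M (π j) h ^ 2 ≤
        Y * ∑ q : Query A H m, tvDist H (f k) M (explore (π j) q) ^ 2 := by
      intro j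
      have h2 := sq_sum_le_card_mul_sum_sq (s := (Finset.univ : Finset (Fin (m - 1) → A)))
        (f := fun u => tvDist H (f k) M (explore (π j) (h, u)))
      refine h2.trans ?_
      have h3 : ((Finset.univ : Finset (Fin (m - 1) → A)).card : ℝ) ≤ Y := by
        rw [Finset.card_univ, Fintype.card_pi]
        simpa using hUY
      have h4 : ∑ u : Fin (m - 1) → A, tvDist H (f k) M (explore (π j) (h, u)) ^ 2 ≤
          ∑ q : Query A H m, tvDist H (f k) M (explore (π j) q) ^ 2 := by
        rw [Fintype.sum_prod_type]
        exact Finset.single_le_sum (f := fun h : Fin (H - m + 1) => ∑ u : Fin (m - 1) → A,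
          tvDist H (f k) M (explore (π j) (h, u)) ^ 2)
          (fun h _ => Finset.sum_nonneg fun u _ => sq_nonneg _) (Finset.mem_univ h)
      exact mul_le_mul h3 h4 (Finset.sum_nonneg fun _ _ => sq_nonneg _) hY0.le
    refine (Finset.sum_le_sum fun j _ => h1 j).trans ?_
    rw [← Finset.mul_sum]
    exact mul_le_mul_of_nonneg_left (hB k hk) hY0.le
  set R := √(8 * K * Y ^ 13 * (1 + B) * (1 + Real.log K)) with hR
  -- the futures at the beginning of the episode
  have hinit : ∑ k ∈ Finset.range K,
      ∑ v : Future O A m, |futVec (f k).prob [] v - futVec M.prob [] v| ≤ 2 * Y * R := by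
    set x : ℕ → ℝ := fun k => ∑ v : Future O A m, |futVec (f k).prob [] v - futVec M.prob [] v|
      with hx
    have hx0 : ∀ k, 0 ≤ x k := fun k => Finset.sum_nonneg fun _ _ => abs_nonneg _
    have hxQ : ∀ k j, x k ≤ Y * queryDist H m (f k) M (π j) ⟨0, by omega⟩ := by
      intro k j
      have h1 := sum_seq_future_le hm hmH (π j) (f k) M ⟨0, by omega⟩
      simp only [sumLists_zero, Policy.seq_nil, one_mul] at h1
      exact h1.trans (mul_le_mul_of_nonneg_right hAY1 (hQD0 _ _ _))
    have hx2 : ∀ k, x k ≤ 2 * Y := by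
      intro k
      have h1 := (f k).isProcess_prob.sum_future_eq (m := m) []
      have h2 := M.isProcess_prob.sum_future_eq (m := m) []
      rw [POMDP.prob_nil, mul_one] at h1 h2
      have h3 : x k ≤ ∑ v : Future O A m, (futVec (f k).prob [] v + futVec M.prob [] v) := by
        refine Finset.sum_le_sum fun v _ => (abs_sub _ _).trans (le_of_eq ?_)
        have h4 : 0 ≤ futVec (f k).prob [] v := (f k).prob_nonneg _
        have h5 : 0 ≤ futVec M.prob [] v := M.prob_nonneg _
        rw [abs_of_nonneg h4, abs_of_nonneg h5]
      rw [Finset.sum_add_distrib, h1, h2] at h3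
      linarith
    -- the error at the beginning does not depend on the policy: the potential argument in dimension 1
    have h1 := sum_avg_abs_le (d := 1) (T := Unit) (L := Unit) hK (fun _ _ => 1) (fun _ _ => 1)
      (fun _ _ => zero_le_one) (fun k _ _ => x k) (R₁ := 1) (R₂ := 2 * Y) (B := Y ^ 3 * B) one_pos
      (by simp) (fun k _ i => by simpa [abs_of_nonneg (hx0 k)] using hx2 k) (by
        intro k hk
        have h2 : ∀ j, (∑ _t : Unit, (1 : ℝ) *
            ∑ _l : Unit, |(fun _ : Fin 1 => x k) ⬝ᵥ fun _ => 1|) ^ 2 ≤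
            Y ^ 2 * queryDist H m (f k) M (π j) ⟨0, by omega⟩ ^ 2 := by
          intro j
          rw [← mul_pow]
          simp only [Finset.univ_unique, Finset.sum_const, Finset.card_singleton, one_smul,
            one_mul, dotProduct, mul_one, abs_of_nonneg (hx0 k)]
          exact pow_le_pow_left₀ (hx0 k) (hxQ k j) 2
        refine (Finset.sum_le_sum fun j _ => h2 j).trans ?_
        rw [← Finset.mul_sum]
        nlinarith [hQD k hk ⟨0, by omega⟩, sq_nonneg Y])
    simp only [Finset.univ_unique, Finset.sum_const, Finset.card_singleton, one_smul,
      one_mul, dotProduct, mul_one, abs_of_nonneg (hx0 _), Nat.cast_one, one_pow] at h1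
    refine h1.trans ?_
    rw [mul_assoc 2 Y R]
    refine mul_le_mul_of_nonneg_left (le_trans (Real.sqrt_le_sqrt ?_)
      (le_mul_of_one_le_left (Real.sqrt_nonneg _) hY)) zero_le_two
    have h3 : Real.log (1 + K) ≤ 1 + Real.log K := by
      simpa using log_nat_add_le (d := 1) hK (Y := 1) (by simp) le_rfl
    have h4 : (2 * Y) ^ 2 + Y ^ 3 * B ≤ 4 * Y ^ 13 * (1 + B) := by
      have h5 : Y ^ 2 ≤ Y ^ 13 := pow_le_pow_right₀ hY (by norm_num)
      have h6 : Y ^ 3 ≤ Y ^ 13 := pow_le_pow_right₀ hY (by norm_num)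
      nlinarith [mul_le_mul_of_nonneg_right h6 hB0, mul_nonneg (pow_nonneg hY0.le 13) hB0]
    calc (K : ℝ) * (((2 * Y) ^ 2 + Y ^ 3 * B) * (2 * Real.log (1 + K)))
        ≤ K * ((4 * Y ^ 13 * (1 + B)) * (2 * (1 + Real.log K))) := by
          have : 0 ≤ Real.log (1 + K) := Real.log_nonneg (by linarith)
          gcongr
      _ = _ := by ring
  -- the one-step errors
  have hstep : ∀ h ∈ Finset.range (H - m), ∑ k ∈ Finset.range K,
      sumLists h (fun l => (π k).seq [] l * (D k h).err M l) ≤ 2 * Y * R := by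
    intro h hh
    rw [Finset.mem_range] at hh
    have herr : ∀ k j, sumLists h (fun l => (π j).seq [] l * (D k h).err M l) =
        ∑ t : Fin h → O × A, (π j).seq [] (List.ofFn t) *
          ∑ z, |(D k h).coreErr (D' h) z ⬝ᵥ (D' h).coord (List.ofFn t)| := by
      intro k j
      refine Finset.sum_congr rfl fun t _ => ?_
      beta_reduce
      rw [(D k h).err_eq (D' h) hm (by omega) (List.length_ofFn)]
    have hE : ∀ k < K, ∑ j ∈ Finset.range k,
        sumLists h (fun l => (π j).seq [] l * (D k h).err M l) ^ 2 ≤ 4 * Y ^ 7 * B := by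
      intro k hk
      have h1 : ∀ j, sumLists h (fun l => (π j).seq [] l * (D k h).err M l) ^ 2 ≤
          2 * Y ^ 6 * (queryDist H m (f k) M (π j) ⟨h, by omega⟩ ^ 2 +
            queryDist H m (f k) M (π j) ⟨h + 1, by omega⟩ ^ 2) := by
        intro j
        have h2 := (D k h).sum_seq_err_le (M := M) hm hmH hC (π j) (by omega)
        have h0 : 0 ≤ sumLists h (fun l => (π j).seq [] l * (D k h).err M l) :=
          sumLists_nonneg fun l _ => mul_nonneg ((π j).seq_nonneg _ _) ((D k h).err_nonneg _)
        set a := queryDist H m (f k) M (π j) ⟨h, by omega⟩ with ha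
        set b := queryDist H m (f k) M (π j) ⟨h + 1, by omega⟩ with hb
        have ha0 : 0 ≤ a := hQD0 _ _ _
        have hb0 : 0 ≤ b := hQD0 _ _ _
        have h3 : (Fintype.card A : ℝ) ^ m * C * (Fintype.card A * a) + Fintype.card A * b ≤
            Y ^ 3 * (a + b) := by
          have h4 : (Fintype.card A : ℝ) ^ m * C * (Fintype.card A * a) ≤ Y * Y * (Y * a) := by
            gcongr
          have h5 : (Fintype.card A : ℝ) * b ≤ Y ^ 3 * b := by
            refine mul_le_mul_of_nonneg_right (hAY1.trans ?_) hb0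
            simpa using pow_le_pow_right₀ hY (show 1 ≤ 3 by norm_num)
          nlinarith
        calc _ ≤ (Y ^ 3 * (a + b)) ^ 2 := pow_le_pow_left₀ h0 (h2.trans h3) 2
          _ = Y ^ 6 * (a + b) ^ 2 := by ring
          _ ≤ Y ^ 6 * (2 * (a ^ 2 + b ^ 2)) :=
              mul_le_mul_of_nonneg_left add_sq_le (by positivity)
          _ = _ := by ring
      refine (Finset.sum_le_sum fun j _ => h1 j).trans ?_
      rw [← Finset.mul_sum, Finset.sum_add_distrib]
      calc _ ≤ 2 * Y ^ 6 * (Y * B + Y * B) := by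
            gcongr
            · exact hQD k hk _
            · exact hQD k hk _
        _ = _ := by ring
    have h1 := sum_avg_abs_le hK (fun t : Fin h → O × A => (D' h).coord (List.ofFn t))
      (fun k t => (π k).seq [] (List.ofFn t)) (fun k t => (π k).seq_nonneg _ _)
      (fun k => (D k h).coreErr (D' h)) (R₁ := Y ^ 2) (R₂ := 2 * Y ^ 3) (B := 4 * Y ^ 7 * B)
      (by positivity)
      (by
        intro k _
        refine ((D' h).sum_seq_coord_le (π k) h).trans ?_
        rw [sq]
        exact mul_le_mul hCY hUY (by positivity) hY0.le)
      (by
        intro k _ i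
        refine ((D k h).sum_abs_coreErr_le (D' h) hm hC i).trans ?_
        have h4 : (Fintype.card A : ℝ) ^ m * C * (Fintype.card A : ℝ) ^ (m - 1) ≤ Y * Y * Y := by
          gcongr
        have h5 : Y ≤ Y ^ 3 := by simpa using pow_le_pow_right₀ hY (show 1 ≤ 3 by norm_num)
        nlinarith)
      (by simpa only [herr] using hE)
    simp only [← herr] at h1
    refine h1.trans ?_
    rw [mul_assoc 2 Y R]
    refine mul_le_mul_of_nonneg_left (mul_le_mul (hd h) (Real.sqrt_le_sqrt ?_)
      (Real.sqrt_nonneg _) hY0.le) zero_le_two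
    have hlog := log_nat_add_le hK (hd h) hY
    have hlog0 : 0 ≤ Real.log ((D' h).d + K) :=
      Real.log_nonneg (by have : (0 : ℝ) ≤ (D' h).d := Nat.cast_nonneg _; linarith)
    calc (K : ℝ) * (((Y ^ 2) ^ 2 * ((D' h).d * (2 * Y ^ 3) ^ 2) + 4 * Y ^ 7 * B) *
          (2 * ((D' h).d * Real.log ((D' h).d + K))))
        ≤ K * (((Y ^ 2) ^ 2 * (Y * (2 * Y ^ 3) ^ 2) + 4 * Y ^ 11 * B) *
          (2 * (Y * (Y * (1 + Real.log K))))) := by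
          have h7 : Y ^ 7 ≤ Y ^ 11 := pow_le_pow_right₀ hY (by norm_num)
          gcongr
          · exact hd h
          · exact hd h
      _ = _ := by ring
  calc ∑ k ∈ Finset.range K, tvDist H (f k) M (π k)
      ≤ ∑ k ∈ Finset.range K, (1 + C) *
          (∑ v : Future O A m, |futVec (f k).prob [] v - futVec M.prob [] v| +
          ∑ h ∈ Finset.range (H - m),
            sumLists h fun l => (π k).seq [] l * (D k h).err M l) :=
        Finset.sum_le_sum fun k _ => CoreData.sum_abs_sub_le (D k) hm hmH hC M (π k)
    _ = (1 + C) * (∑ k ∈ Finset.range K,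
          ∑ v : Future O A m, |futVec (f k).prob [] v - futVec M.prob [] v| +
          ∑ h ∈ Finset.range (H - m), ∑ k ∈ Finset.range K,
            sumLists h fun l => (π k).seq [] l * (D k h).err M l) := by
        rw [← Finset.mul_sum, Finset.sum_add_distrib]
        congr 2
        exact Finset.sum_comm
    _ ≤ (1 + C) * (2 * Y * R + ∑ _h ∈ Finset.range (H - m), 2 * Y * R) := by
        gcongr with h hh
        exact hstep h hh
    _ ≤ (2 * Y) * (2 * Y * R + Y * (2 * Y * R)) := by
        have hR0 : 0 ≤ R := Real.sqrt_nonneg _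
        rw [Finset.sum_const, Finset.card_range, nsmul_eq_mul]
        have h1 : ((H - m : ℕ) : ℝ) ≤ Y := le_trans (by exact_mod_cast Nat.sub_le H m) hHY
        gcongr
        linarith
    _ ≤ 8 * Y ^ 3 * R := by
        have hR0 : 0 ≤ R := Real.sqrt_nonneg _
        nlinarith [mul_nonneg (mul_nonneg (sq_nonneg Y) hR0) (sub_nonneg.2 hY)]

/-! ### Values -/

omit [Nonempty A] in
lemma value_sub_le {r : ℕ → O → A → ℝ} (hr : ∀ h o a, 0 ≤ r h o a ∧ r h o a ≤ 1)
    (f M : POMDP S O A) (π : Policy O A) :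
    f.value H r π - M.value H r π ≤ H * tvDist H f M π := by
  rw [POMDP.value, POMDP.value, expReward, expReward, ← Finset.sum_sub_distrib, tvDist_eq,
    Finset.mul_sum]
  refine Finset.sum_le_sum fun τ _ => ?_
  rw [← sub_mul, mul_comm]
  have h0 : 0 ≤ ∑ h : Fin H, r h (τ h).1 (τ h).2 := Finset.sum_nonneg fun h _ => (hr _ _ _).1
  have h1 : ∑ h : Fin H, r h (τ h).1 (τ h).2 ≤ H := by
    refine (Finset.sum_le_card_nsmul _ _ 1 fun h _ => (hr _ _ _).2).trans ?_
    simp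
  exact (mul_le_mul_of_nonneg_left (le_abs_self _) h0).trans
    (mul_le_mul_of_nonneg_right h1 (abs_nonneg _))

omit [Nonempty A] in
lemma value_nonneg {r : ℕ → O → A → ℝ} (hr : ∀ h o a, 0 ≤ r h o a ∧ r h o a ≤ 1)
    (M : POMDP S O A) (π : Policy O A) : 0 ≤ M.value H r π :=
  Finset.sum_nonneg fun _ _ => mul_nonneg (trajProb_nonneg _ _ _)
    (Finset.sum_nonneg fun _ _ => (hr _ _ _).1)

lemma value_le {r : ℕ → O → A → ℝ} (hr : ∀ h o a, 0 ≤ r h o a ∧ r h o a ≤ 1)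
    (M : POMDP S O A) (π : Policy O A) : M.value H r π ≤ H := by
  have h1 : ∀ τ : Traj O A H, ∑ h : Fin H, r h (τ h).1 (τ h).2 ≤ H := fun τ =>
    (Finset.sum_le_card_nsmul _ _ 1 fun h _ => (hr _ _ _).2).trans (by simp)
  refine (Finset.sum_le_sum fun τ _ => mul_le_mul_of_nonneg_left (h1 τ)
    (trajProb_nonneg M π τ)).trans ?_
  rw [← Finset.sum_mul, sum_trajProb, one_mul]

omit [Nonempty A] in
lemma mixtureValue_eq (M : POMDP S O A) (r : ℕ → O → A → ℝ) {K : ℕ} (π : Fin K → Policy O A) :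
    M.mixtureValue H r π = (∑ k, M.value H r (π k)) / K := by
  simp only [POMDP.mixtureValue, POMDP.value, expReward]
  rw [Finset.sum_comm, Finset.sum_div]
  refine Finset.sum_congr rfl fun τ _ => ?_
  rw [← Finset.sum_mul]
  ring

instance : Nonempty (Policy O A) :=
  ⟨⟨fun _ _ _ => 1 / Fintype.card A, fun _ _ _ => by positivity, fun _ _ => by simp⟩⟩

lemma optValue_le {M : POMDP S O A} {r : ℕ → O → A → ℝ} {v : ℝ}
    (h : ∀ π, M.value H r π ≤ v) : M.optValue H r ≤ v :=
  ciSup_le h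

/-! ### The sample complexity of CRANE in terms of the bracket number -/

/-- Inverting `K ε² ≥ const · (1 + log K)²`. -/
lemma mul_log_sq_le {c₂ Y ε : ℝ} {b K : ℕ} (hc₂ : 1 ≤ c₂) (hY : 1 ≤ Y) (hε : 0 < ε) (hK : 1 ≤ K)
    (hεY : Real.posLog (1 / ε) ≤ Y)
    (h : 1 / ε ^ 2 * (4096 * c₂ ^ 2 * Y ^ (2 * b + 2)) ≤ K) :
    c₂ * Y ^ b * (1 + Real.log K) ^ 2 ≤ K * ε ^ 2 := by
  have hK1 : (1 : ℝ) ≤ K := by exact_mod_cast hK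
  set T : ℝ := K * ε ^ 2 with hT
  have hT0 : 0 < T := by positivity
  have h1 : 4096 * c₂ ^ 2 * Y ^ (2 * b + 2) ≤ T := by
    rw [hT, ← div_le_iff₀ (by positivity)]
    simpa [div_eq_inv_mul] using h
  have hlogK : Real.log K = Real.log T + 2 * Real.log (1 / ε) := by
    rw [hT, Real.log_mul (by positivity) (by positivity), Real.log_pow, one_div, Real.log_inv]
    push_cast
    ring
  have hlogε : Real.log (1 / ε) ≤ Y := le_trans (le_max_right _ _) hεY
  have hlogT : Real.log T ≤ 4 * √√T := by
    have h2 : Real.log T = 4 * Real.log √√T := by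
      rw [Real.log_sqrt (Real.sqrt_nonneg _), Real.log_sqrt hT0.le]
      ring
    have h3 := Real.log_le_sub_one_of_pos (show 0 < √√T by positivity)
    linarith
  have hlog0 : 0 ≤ Real.log K := Real.log_nonneg hK1
  have h4 : (1 + Real.log K) ^ 2 ≤ 18 * Y ^ 2 + 32 * √T := by
    have h5 : 1 + Real.log K ≤ 3 * Y + 4 * √√T := by linarith
    have h6 : √√T ^ 2 = √T := Real.sq_sqrt (Real.sqrt_nonneg _)
    calc (1 + Real.log K) ^ 2 ≤ (3 * Y + 4 * √√T) ^ 2 := by gcongr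
      _ ≤ 18 * Y ^ 2 + 32 * √√T ^ 2 := by nlinarith [sq_nonneg (3 * Y - 4 * √√T)]
      _ = _ := by rw [h6]
  have hYb : 1 ≤ Y ^ b := one_le_pow₀ hY
  have hsqrt : 64 * c₂ * Y ^ b ≤ √T := by
    refine Real.le_sqrt_of_sq_le (le_trans ?_ h1)
    have : Y ^ (2 * b) ≤ Y ^ (2 * b + 2) := pow_le_pow_right₀ hY (by omega)
    calc (64 * c₂ * Y ^ b) ^ 2 = 4096 * c₂ ^ 2 * Y ^ (2 * b) := by ring
      _ ≤ _ := by gcongr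
  have h7 : 36 * c₂ * Y ^ b * Y ^ 2 ≤ T := by
    refine le_trans ?_ h1
    have : Y ^ b * Y ^ 2 ≤ Y ^ (2 * b + 2) := by
      rw [← pow_add]
      exact pow_le_pow_right₀ hY (by omega)
    calc 36 * c₂ * Y ^ b * Y ^ 2 = 36 * c₂ * (Y ^ b * Y ^ 2) := by ring
      _ ≤ 4096 * c₂ ^ 2 * Y ^ (2 * b + 2) := by
        gcongr
        · norm_num
        · nlinarith
  have h8 : 64 * c₂ * Y ^ b * √T ≤ T := by
    calc _ ≤ √T * √T := by gcongr
      _ = T := Real.mul_self_sqrt hT0.le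
  calc c₂ * Y ^ b * (1 + Real.log K) ^ 2 ≤ c₂ * Y ^ b * (18 * Y ^ 2 + 32 * √T) := by gcongr
    _ ≤ T := by nlinarith

set_option maxHeartbeats 1000000 in
open Classical in
/-- CRANE succeeds if `K ε²` is at least a polynomial in a bound `Y` for all relevant quantities, as
soon as the logarithm of the bracket number is polynomial in `Y` and linear in `log K`. -/
theorem craneSucceeds_of_le {C₁ : ℝ} (hC₁ : 1 ≤ C₁) {b : ℕ} (hm : 1 ≤ m) (hmH : m ≤ H)
    {r : ℕ → O → A → ℝ} (hr : ∀ h o a, 0 ≤ r h o a ∧ r h o a ≤ 1) {F : Set (POMDP S O A)}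
    {M : POMDP S O A} (hMF : M ∈ F) (hcore : ∀ f ∈ F, f.FuturesAreCore H m) {α δ ε Y : ℝ} {K : ℕ}
    (hα : 0 < α) (hreg : ∀ f ∈ F, f.IsRegular H m α) (hδ : 0 < δ) (hδ1 : δ ≤ 1) (hε : 0 < ε)
    (hK : 1 ≤ K) (hY : 1 ≤ Y) (hdY : (M.psrRank H : ℝ) ≤ Y)
    (hAY : (Fintype.card A : ℝ) ^ m ≤ Y) (hαY : 1 / α ≤ Y) (hHY : (H : ℝ) ≤ Y)
    (hδY : Real.log (1 / δ) ≤ Y) (hεY : Real.posLog (1 / ε) ≤ Y)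
    (hbr : ∃ N, HasBracket F H (bracketScale A H m K) N)
    (hN : Real.log (bracketNumber F H (bracketScale A H m K)) ≤ C₁ * Y ^ b * (1 + Real.log K))
    (hKε : 1 / ε ^ 2 *
      (4096 * (512 * (105 * (C₁ + 4))) ^ 2 * Y ^ (2 * (22 + b) + 2)) ≤ K) :
    CraneSucceeds H m M F r 4 δ ε K := by
  intro sel hsel
  have hO : Nonempty O := by
    rcases isEmpty_or_nonempty O with hO | hO
    · have hS : Nonempty S := by
        by_contra h
        rw [not_nonempty_iff] at h
        simpa using M.μ_sum
      simpa using M.E_sum 0 hS.some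
    · exact hO
  have hY0 : 0 < Y := by linarith
  have hK1 : (1 : ℝ) ≤ K := by exact_mod_cast hK
  have hlogK := Real.log_nonneg hK1
  have hA1 : (1 : ℝ) ≤ Fintype.card A := by exact_mod_cast Fintype.card_pos
  have hH1 : (1 : ℝ) ≤ H := by exact_mod_cast hm.trans hmH
  have hKpos : 0 < (K : ℝ) := by linarith
  have hYb : 1 ≤ Y ^ b := one_le_pow₀ hY
  have hinv := mul_log_sq_le (b := 22 + b) (by linarith) hY hε hK hεY hKε
  -- it suffices that all runs outside an event of probability `δ` succeed
  suffices hgood : ∃ bad : (Fin K → Batch O A H m) → Prop,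
      ∑ ω, (if bad ω then sel.runProb M ω else 0) ≤ δ ∧
      ∀ ω, ¬ bad ω → 0 < sel.runProb M ω →
        M.optValue H r - ε ≤ M.mixtureValue H r (sel.policyAt ω) by
    obtain ⟨bad, hbad, hgood⟩ := hgood
    have h1 : (1 : ℝ) ≤ sel.successProb M r K ε +
        ∑ ω, (if bad ω then sel.runProb M ω else 0) := by
      rw [← sel.sum_runProb M K, Selector.successProb, ← Finset.sum_add_distrib]
      refine Finset.sum_le_sum fun ω _ => ?_
      have h0 := sel.runProb_nonneg M ω
      by_cases hb : bad ω
      · rw [if_pos hb]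
        split_ifs <;> linarith
      · rcases h0.eq_or_lt with hz | hpos
        · rw [← hz]
          simp
        · rw [if_pos (hgood ω hb hpos), if_neg hb, add_zero]
    linarith
  have hmix : ∀ ω : Fin K → Batch O A H m, M.mixtureValue H r (sel.policyAt ω) =
      (∑ k : Fin K, M.value H r (sel.policyAt ω k)) / K := fun ω => mixtureValue_eq M r _
  rcases le_or_gt (H : ℝ) ε with hHε | hHε
  · refine ⟨fun _ => False, by simpa using hδ.le, fun ω _ _ => ?_⟩
    have h1 : M.optValue H r ≤ H := optValue_le fun π => value_le hr M π
    have h2 : 0 ≤ M.mixtureValue H r (sel.policyAt ω) := by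
      rw [hmix]
      exact div_nonneg (Finset.sum_nonneg fun k _ => value_nonneg hr M _) hKpos.le
    linarith
  -- at least two iterations are needed for an accuracy below the trivial one
  have hK2 : (2 : ℝ) ≤ K := by
    have hne : K ≠ 1 := by
      rintro rfl
      have hYY : Y ^ 2 ≤ Y ^ (22 + b) := pow_le_pow_right₀ hY (by omega)
      have h1 : Y ^ 2 ≤ ε ^ 2 := by
        simp only [Nat.cast_one, Real.log_one, add_zero, one_pow, mul_one, one_mul] at hinv
        have : (1 : ℝ) ≤ 512 * (105 * (C₁ + 4)) := by linarith
        calc Y ^ 2 ≤ Y ^ (22 + b) := hYY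
          _ ≤ _ := le_mul_of_one_le_left (by positivity) this
          _ ≤ _ := hinv
      have h2 : Y ≤ ε := le_of_sq_le_sq h1 hε.le
      linarith
    exact_mod_cast (show 2 ≤ K by omega)
  set N := bracketNumber F H (bracketScale A H m K) with hNdef
  have hNbr : HasBracket F H (bracketScale A H m K) N := Nat.sInf_mem hbr
  have hN1 : (1 : ℝ) ≤ N := by
    obtain ⟨g₁, g₂, -, hcov⟩ := hNbr
    obtain ⟨i, -⟩ := hcov M hMF
    exact_mod_cast i.pos
  set U : ℝ := (Fintype.card A : ℝ) ^ (m - 1) with hU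
  have hU1 : 1 ≤ U := one_le_pow₀ hA1
  have hUY : U ≤ Y := (pow_le_pow_right₀ hA1 (Nat.sub_le m 1)).trans hAY
  set L : ℝ := Real.log (N * K * H * U / δ) with hL
  have hβ : craneBeta H m F 4 δ K = 4 * L := rfl
  have hNK : (N : ℝ) * K / δ ≤ N * K * H * U / δ := by
    refine div_le_div_of_nonneg_right ?_ hδ.le
    have : (1 : ℝ) ≤ H * U := one_le_mul_of_one_le_of_one_le hH1 hU1
    calc (N : ℝ) * K ≤ N * K * (H * U) := le_mul_of_one_le_right (by positivity) this
      _ = _ := by ring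
  have hL1 : 1 / 2 ≤ L := by
    have h1 : (2 : ℝ) ≤ N * K * H * U / δ := by
      refine le_trans ?_ hNK
      rw [le_div_iff₀ hδ]
      nlinarith
    have h2 := Real.log_le_log two_pos h1
    linarith [Real.log_two_gt_d9]
  have hL2 : Real.log (N * K / δ) ≤ L := Real.log_le_log (by positivity) hNK
  have hL3 : L ≤ (C₁ + 4) * Y ^ (b + 1) * (1 + Real.log K) := by
    have h1 : L = Real.log N + Real.log K + Real.log H + Real.log U + Real.log (1 / δ) := by
      rw [hL, div_eq_mul_one_div, Real.log_mul (by positivity) (by positivity),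
        Real.log_mul (by positivity) (by positivity), Real.log_mul (by positivity) (by positivity),
        Real.log_mul (by positivity) (by positivity)]
    have h2 : Real.log H ≤ Y := (Real.log_le_self (by positivity)).trans hHY
    have h3 : Real.log U ≤ Y := (Real.log_le_self (by positivity)).trans hUY
    have h4 : Y ≤ Y ^ (b + 1) := by
      rw [pow_succ]
      exact le_mul_of_one_le_left hY0.le hYb
    have h5 : Y ^ b ≤ Y ^ (b + 1) := pow_le_pow_right₀ hY (by omega)
    have h6 : C₁ * Y ^ b * (1 + Real.log K) ≤ C₁ * Y ^ (b + 1) * (1 + Real.log K) := by gcongr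
    have h7 : 0 ≤ (Y ^ (b + 1) - 1) * Real.log K := mul_nonneg (by linarith) hlogK
    calc L ≤ C₁ * Y ^ (b + 1) * (1 + Real.log K) + (Y ^ (b + 1) * Real.log K + 3 * Y ^ (b + 1)) := by
          linarith
      _ ≤ C₁ * Y ^ (b + 1) * (1 + Real.log K) +
          (4 * Y ^ (b + 1) * Real.log K + 4 * Y ^ (b + 1)) := by
          have h8 : 0 ≤ Y ^ (b + 1) * Real.log K := by positivity
          have h9 : 0 ≤ Y ^ (b + 1) := by positivity
          linarith
      _ = _ := by ring
  have hscale0 : 0 ≤ bracketScale A H m K := by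
    unfold bracketScale
    positivity
  have hKHU : 1 ≤ (K : ℝ) * H * U := by
    have := one_le_mul_of_one_le_of_one_le hH1 hU1
    nlinarith
  have hscale1 : bracketScale A H m K ≤ 1 := by
    unfold bracketScale
    rw [div_le_one (by linarith)]
    exact hKHU
  have hscaleK : (K * Fintype.card (Query A H m) : ℝ) * bracketScale A H m K ≤ 1 := by
    have h1 : (Fintype.card (Query A H m) : ℝ) ≤ H * U := by
      rw [Fintype.card_prod, Fintype.card_pi]
      simp only [Fintype.card_fin, Finset.prod_const, Finset.card_univ, Nat.cast_mul, Nat.cast_pow]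
      refine mul_le_mul_of_nonneg_right ?_ (by positivity)
      exact_mod_cast (show H - m + 1 ≤ H by omega)
    unfold bracketScale
    rw [mul_one_div, div_le_one (by linarith), mul_assoc]
    exact mul_le_mul_of_nonneg_left h1 hKpos.le
  obtain ⟨bad, hbad, hgood⟩ := sel.exists_good_event hMF (β := 4 * L) hK hNbr hscale0 hscale1
    hscaleK hδ (by linarith) (by linarith)
  refine ⟨bad, hbad, fun ω hω hpos => ?_⟩
  have hopt : ∀ k : Fin K, sel.IsOptimistic F r (4 * L) ((List.ofFn ω).take k) :=
    hβ ▸ hsel ω hpos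
  let π : ℕ → Policy O A := fun k => (sel ((List.ofFn ω).take k)).2
  let f : ℕ → POMDP S O A := fun k => if k < K then (sel ((List.ofFn ω).take k)).1 else M
  have hf : ∀ k < K, f k = (sel ((List.ofFn ω).take k)).1 := fun k hk => if_pos hk
  have hfF : ∀ k, f k ∈ F := by
    intro k
    by_cases hk : k < K
    · rw [hf k hk]
      exact (hopt ⟨k, hk⟩).1.1
    · simpa [f, hk] using hMF
  choose D hD using fun k => (hreg (f k) (hfF k)).exists_coreData hm hα (hcore _ (hfF k))
  obtain ⟨D', hD'⟩ := (hreg M hMF).exists_coreData hm hα (hcore M hMF)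
  have hreg := sum_tvDist_le hm hmH (by positivity) π D D' hY
    (fun h => le_trans (by exact_mod_cast hD' h) hdY) hαY hAY hHY hK (B := 26 * (4 * L))
    fun k hk => (hgood ω hω hpos k hk).2 (f k) (hf k hk ▸ (hopt ⟨k, hk⟩).1)
  have hregret : ∑ k ∈ Finset.range K, (M.optValue H r - M.value H r (π k)) ≤ K * ε := by
    calc ∑ k ∈ Finset.range K, (M.optValue H r - M.value H r (π k))
        ≤ ∑ k ∈ Finset.range K, H * tvDist H (f k) M (π k) := by
          refine Finset.sum_le_sum fun k hk => ?_
          have hk' := Finset.mem_range.1 hk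
          refine le_trans (sub_le_sub_right ?_ _) (value_sub_le hr (f k) M (π k))
          refine optValue_le fun π' => ?_
          rw [hf k hk']
          exact (hopt ⟨k, hk'⟩).2 M (hgood ω hω hpos k hk').1 π'
      _ ≤ Y * (8 * Y ^ 3 * √(8 * K * Y ^ 13 * (1 + 26 * (4 * L)) * (1 + Real.log K))) := by
          rw [← Finset.mul_sum]
          exact mul_le_mul hHY hreg (Finset.sum_nonneg fun _ _ => tvDist_nonneg _ _ _) hY0.le
      _ ≤ K * ε := by
          rw [← mul_assoc]
          have h0 : 0 ≤ Y * (8 * Y ^ 3) := by positivity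
          rw [← Real.sqrt_sq h0, ← Real.sqrt_mul (sq_nonneg _)]
          rw [Real.sqrt_le_left (by positivity)]
          have h1 : 1 + 26 * (4 * L) ≤ 105 * (C₁ + 4) * Y ^ (b + 1) * (1 + Real.log K) := by
            have h2 : 1 ≤ (C₁ + 4) * Y ^ (b + 1) * (1 + Real.log K) :=
              le_trans (by linarith) (one_le_mul_of_one_le_of_one_le
                (one_le_mul_of_one_le_of_one_le (by linarith) (one_le_pow₀ hY))
                (by linarith : 1 ≤ 1 + Real.log K))
            linarith
          calc (Y * (8 * Y ^ 3)) ^ 2 *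
                (8 * K * Y ^ 13 * (1 + 26 * (4 * L)) * (1 + Real.log K))
              ≤ (Y * (8 * Y ^ 3)) ^ 2 * (8 * K * Y ^ 13 *
                (105 * (C₁ + 4) * Y ^ (b + 1) * (1 + Real.log K)) * (1 + Real.log K)) := by
                gcongr
            _ = K * (512 * (105 * (C₁ + 4)) * Y ^ (22 + b) * (1 + Real.log K) ^ 2) := by ring
            _ ≤ K * (K * ε ^ 2) := by gcongr
            _ = (K * ε) ^ 2 := by ring
  rw [hmix, sub_le_iff_le_add, ← sub_le_iff_le_add', sub_div' hKpos.ne', div_le_iff₀ hKpos]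
  rw [Finset.sum_sub_distrib, Finset.sum_const, Finset.card_range, nsmul_eq_mul,
    Finset.sum_range fun k => M.value H r (π k)] at hregret
  have : ∑ k : Fin K, M.value H r (sel.policyAt ω k) = ∑ k : Fin K, M.value H r (π k) := rfl
  rw [this]
  linarith

end Regret

open Module

section Bounds

variable {S O A : Type*} [Fintype S] [Fintype O]

lemma POMDP.nonempty_states (M : POMDP S O A) : Nonempty S := by
  by_contra h
  rw [not_nonempty_iff] at h
  simpa using M.μ_sum

lemma POMDP.nonempty_observations (M : POMDP S O A) : Nonempty O := by
  by_contra h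
  rw [not_nonempty_iff] at h
  simpa using M.E_sum 0 M.nonempty_states.some

lemma POMDP.E_le_one (M : POMDP S O A) (h : ℕ) (s : S) (o : O) : M.E h s o ≤ 1 := by
  rw [← M.E_sum h s]
  exact Finset.single_le_sum (f := M.E h s) (fun o _ => M.E_nonneg _ _ _) (Finset.mem_univ o)

lemma POMDP.T_le_one (M : POMDP S O A) (h : ℕ) (s : S) (a : A) (s' : S) : M.T h s a s' ≤ 1 := by
  rw [← M.T_sum h s a]
  exact Finset.single_le_sum (f := M.T h s a) (fun o _ => M.T_nonneg _ _ _ _) (Finset.mem_univ s')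

lemma POMDP.μ_le_one (M : POMDP S O A) (s : S) : M.μ s ≤ 1 := by
  rw [← M.μ_sum]
  exact Finset.single_le_sum (f := M.μ) (fun o _ => M.μ_nonneg _) (Finset.mem_univ s)

end Bounds

/-! ### Brackets from partitions of the model class -/

section Brackets

variable {S O A : Type*} [Fintype S] [Fintype O] [Fintype A] [Nonempty A] {H : ℕ}

omit [Nonempty A] in
/-- A partition of the model class gives a bracket: for a representative `g` of each cell, take the
trajectory probabilities of `g`, decreased and increased by a bound `R g` for the deviation of the
models in the cell of `g`. -/
lemma hasBracket_of_cells {ι : Type*} [Fintype ι] {F : Set (POMDP S O A)} (cell : POMDP S O A → ι)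
    (R : POMDP S O A → List (O × A) → ℝ) {ε : ℝ} (hε : 0 ≤ ε)
    (hR : ∀ f ∈ F, ∀ g ∈ F, cell f = cell g → ∀ l, l.length = H → |f.prob l - g.prob l| ≤ R g l)
    (hsum : ∀ g ∈ F, ∀ π : Policy O A, 2 * sumLists H (fun l => π.seq [] l * R g l) ≤ ε) :
    HasBracket F H ε (Fintype.card ι) := by
  classical
  let e := Fintype.equivFin ι
  have hrep : ∀ i, ∃ p : Policy O A → (Traj O A H → ℝ) × (Traj O A H → ℝ),
      (∀ π, ∑ τ, |(p π).1 τ - (p π).2 τ| ≤ ε) ∧ ∀ f ∈ F, cell f = e.symm i → ∀ π τ,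
        (p π).1 τ ≤ f.trajProb π τ ∧ f.trajProb π τ ≤ (p π).2 τ := by
    intro i
    by_cases h : ∃ g ∈ F, cell g = e.symm i
    · obtain ⟨g, hg, hgi⟩ := h
      have hR0 : ∀ l : List (O × A), l.length = H → 0 ≤ R g l := fun l hl =>
        (abs_nonneg _).trans (hR g hg g hg rfl l hl)
      refine ⟨fun π => (fun τ => π.seq [] (List.ofFn τ) * (g.prob (List.ofFn τ) - R g (List.ofFn τ)),
        fun τ => π.seq [] (List.ofFn τ) * (g.prob (List.ofFn τ) + R g (List.ofFn τ))),
        fun π => ?_, fun f hf hfi π τ => ?_⟩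
      · refine le_trans (le_of_eq ?_) (hsum g hg π)
        rw [sumLists, Finset.mul_sum]
        refine Finset.sum_congr rfl fun τ _ => ?_
        have h1 := hR0 (List.ofFn τ) (by simp)
        have h2 := π.seq_nonneg [] (List.ofFn τ)
        rw [← mul_sub, abs_mul, abs_of_nonneg h2, abs_sub_comm, abs_of_nonneg (by linarith)]
        ring
      · have h1 := abs_le.1 (hR f hf g hg (hfi.trans hgi.symm) (List.ofFn τ) (by simp))
        have h2 := π.seq_nonneg [] (List.ofFn τ)
        rw [trajProb_eq]
        exact ⟨mul_le_mul_of_nonneg_left (by linarith) h2,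
          mul_le_mul_of_nonneg_left (by linarith) h2⟩
    · exact ⟨fun _ => (0, 0), fun _ => by simpa using hε, fun f hf hfi => absurd ⟨f, hf, hfi⟩ h⟩
  choose p hp hp' using hrep
  refine ⟨fun i π => (p i π).1, fun i π => (p i π).2, hp, fun f hf => ⟨e (cell f), ?_⟩⟩
  exact hp' _ f hf (by simp)

omit [Nonempty A] in
lemma log_bracketNumber_le {F : Set (POMDP S O A)} {ε : ℝ} {N : ℕ} (h : HasBracket F H ε N) :
    Real.log (bracketNumber F H ε) ≤ Real.log N := by
  have hle : bracketNumber F H ε ≤ N := Nat.sInf_le h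
  rcases Nat.eq_zero_or_pos (bracketNumber F H ε) with h0 | h0
  · rw [h0, Nat.cast_zero, Real.log_zero]
    exact Real.log_natCast_nonneg N
  · exact Real.log_le_log (by exact_mod_cast h0) (by exact_mod_cast hle)

omit [Nonempty A] in
/-- If the transitions factor through features of dimension `d`, the PSR rank is at most `d`: the
beliefs after the first step lie in a space of dimension `d`. -/
lemma POMDP.psrRank_le {M : POMDP S O A} {d : ℕ} (hd : 1 ≤ d) (g : ℕ → S → Fin d → ℝ)
    (e : ℕ → S → A → Fin d → ℝ)
    (hT : ∀ h < H, ∀ s a s', M.T h s a s' = g h s' ⬝ᵥ e h s a) : M.psrRank H ≤ d := by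
  refine Finset.sup_le fun h hh => ?_
  have hbel : ∃ G : S → Fin d → ℝ, ∀ τ : Fin h → O × A, ∃ y : Fin d → ℝ,
      ∀ s, M.belief (List.ofFn τ) s = G s ⬝ᵥ y := by
    cases h with
    | zero =>
      -- the only belief is the initial one
      refine ⟨fun s _ => M.μ s, fun τ => ⟨Pi.single ⟨0, hd⟩ 1, fun s => ?_⟩⟩
      simp [belief, filter]
    | succ h =>
      refine ⟨g h, fun τ => ?_⟩
      have hsplit : List.ofFn τ =
          List.ofFn (Fin.init τ) ++ [((τ (Fin.last h)).1, (τ (Fin.last h)).2)] := by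
        rw [List.ofFn_succ_last]
        rfl
      refine ⟨∑ s, (M.belief (List.ofFn (Fin.init τ)) s * M.E h s (τ (Fin.last h)).1) •
        e h s (τ (Fin.last h)).2, fun s' => ?_⟩
      rw [hsplit, belief_concat, dotProduct_sum]
      refine Finset.sum_congr rfl fun s _ => ?_
      rw [List.length_ofFn, hT h (by have := Finset.mem_range.1 hh; omega), dotProduct_smul,
        smul_eq_mul]
  obtain ⟨G, hG⟩ := hbel
  choose y hy using hG
  have hfac : M.dynMatrix h (tests O A H h) =
      (Matrix.of fun (t : tests O A H h) i => ∑ s, M.testFrom h s t.1.1 t.1.2 * G s i) *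
      (Matrix.of fun i τ => y τ i / M.prob (List.ofFn τ)) := by
    ext t τ
    simp only [dynMatrix, Matrix.of_apply, Matrix.mul_apply, testProb, hy, List.length_ofFn,
      dotProduct, Finset.sum_mul, Finset.sum_div]
    rw [Finset.sum_comm]
    refine Finset.sum_congr rfl fun i _ => Finset.sum_congr rfl fun s _ => by ring
  rw [psrRankAt, hfac]
  exact (Matrix.rank_mul_le_right _ _).trans ((Matrix.rank_le_card_height _).trans (by simp))

omit [Fintype A] in
/-- Models whose kernels are close in total variation have close observation probabilities. -/
lemma POMDP.sum_abs_belief_sub_le {f g : POMDP S O A} {η : ℝ}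
    (hT : ∀ h < H, ∀ s a, ∑ s', |f.T h s a s' - g.T h s a s'| ≤ η)
    (hE : ∀ h < H, ∀ s o, |f.E h s o - g.E h s o| ≤ η) (hμ : ∑ s, |f.μ s - g.μ s| ≤ η)
    (l : List (O × A)) (hl : l.length ≤ H) :
    ∑ s, |f.belief l s - g.belief l s| ≤ (1 + 2 * l.length) * η := by
  induction l using List.reverseRecOn with
  | nil => simpa [belief, filter] using hμ
  | append_singleton l x ih =>
    obtain ⟨o, a⟩ := x
    simp only [List.length_append, List.length_singleton] at hl ⊢
    have hlH : l.length < H := by omega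
    have ih := ih (by omega)
    have hp := g.prob_le_one l
    have hη : 0 ≤ η := (Finset.sum_nonneg fun _ _ => abs_nonneg _).trans hμ
    calc ∑ s', |f.belief (l ++ [(o, a)]) s' - g.belief (l ++ [(o, a)]) s'|
        ≤ ∑ s', ∑ s, (|f.belief l s - g.belief l s| * f.T l.length s a s' +
            g.belief l s * η * f.T l.length s a s' +
            g.belief l s * |f.T l.length s a s' - g.T l.length s a s'|) := by
          refine Finset.sum_le_sum fun s' _ => ?_
          rw [belief_concat, belief_concat, ← Finset.sum_sub_distrib]
          refine (Finset.abs_sum_le_sum_abs _ _).trans (Finset.sum_le_sum fun s _ => ?_)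
          have hb := g.belief_nonneg l s
          have ht := f.T_nonneg l.length s a s'
          have he := f.E_nonneg l.length s o
          have he' := g.E_nonneg l.length s o
          have h1 : f.belief l s * f.E l.length s o * f.T l.length s a s' -
              g.belief l s * g.E l.length s o * g.T l.length s a s' =
              (f.belief l s - g.belief l s) * f.E l.length s o * f.T l.length s a s' +
              g.belief l s * (f.E l.length s o - g.E l.length s o) * f.T l.length s a s' +
              g.belief l s * g.E l.length s o * (f.T l.length s a s' - g.T l.length s a s') := by
            ring
          rw [h1]
          refine (abs_add_three _ _ _).trans ?_
          simp only [abs_mul, abs_of_nonneg hb, abs_of_nonneg ht, abs_of_nonneg he,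
            abs_of_nonneg he']
          gcongr
          · exact mul_le_of_le_one_right (abs_nonneg _) (f.E_le_one _ _ _)
          · exact hE _ hlH s o
          · exact mul_le_of_le_one_right hb (g.E_le_one _ _ _)
      _ = ∑ s, (|f.belief l s - g.belief l s| + g.belief l s * η +
            g.belief l s * ∑ s', |f.T l.length s a s' - g.T l.length s a s'|) := by
          rw [Finset.sum_comm]
          refine Finset.sum_congr rfl fun s _ => ?_
          rw [Finset.sum_add_distrib, Finset.sum_add_distrib, ← Finset.mul_sum, ← Finset.mul_sum,
            ← Finset.mul_sum, f.T_sum, mul_one, mul_one]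
      _ ≤ ∑ s, (|f.belief l s - g.belief l s| + g.belief l s * η + g.belief l s * η) := by
          gcongr with s
          · exact g.belief_nonneg l s
          · exact hT _ hlH s a
      _ = ∑ s, |f.belief l s - g.belief l s| + g.prob l * η + g.prob l * η := by
          rw [Finset.sum_add_distrib, Finset.sum_add_distrib, ← Finset.sum_mul, prob]
      _ ≤ (1 + 2 * l.length) * η + 1 * η + 1 * η := by gcongr
      _ = _ := by
          push_cast
          ring

end Brackets

open Module

/-! ### The bracket number of a class of models in a subspace -/

/-- A bounded set in a space of dimension `n` can be partitioned into `(⌊4 n / η⌋ + 1) ^ n` cells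
such that the differences within a cell are combinations, with total weight at most `η`, of members
of the set: round the coefficients with respect to a spanner. -/
lemma exists_cells {α E : Type*} [NormedAddCommGroup E] [NormedSpace ℝ E] [FiniteDimensional ℝ E]
    {F : Set α} {vec : α → E} (hF : Bornology.IsBounded (vec '' F)) {n : ℕ} (hn : 1 ≤ n)
    (hrank : finrank ℝ (Submodule.span ℝ (vec '' F)) ≤ n) {η : ℝ} (hη : 0 < η) :
    ∃ (v : Fin n → E) (cell : α → Fin n → Fin (⌊4 * n / η⌋₊ + 1)),
      (∀ i, v i ∈ vec '' F ∨ v i = 0) ∧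
      ∀ f ∈ F, ∀ g ∈ F, cell f = cell g → ∃ c : Fin n → ℝ, ∑ i, |c i| ≤ η ∧
        vec f - vec g = ∑ i, c i • v i := by
  classical
  obtain ⟨v, hv, hspan⟩ := exists_spanner hF hrank
  have hspan' : ∀ f, ∃ c : Fin n → ℝ, (∀ i, |c i| ≤ 2) ∧ (f ∈ F → vec f = ∑ i, c i • v i) := by
    intro f
    by_cases hf : f ∈ F
    · obtain ⟨c, hc, h⟩ := hspan _ ⟨f, hf, rfl⟩
      exact ⟨c, hc, fun _ => h⟩
    · exact ⟨0, fun i => by simp, fun h => absurd h hf⟩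
  choose c hc hvec using hspan'
  have hn0 : (0 : ℝ) < n := by exact_mod_cast hn
  have hcoord : ∀ f i, 0 ≤ (c f i + 2) * n / η ∧ (c f i + 2) * n / η ≤ 4 * n / η := by
    intro f i
    have := abs_le.1 (hc f i)
    constructor
    · have : 0 ≤ c f i + 2 := by linarith
      positivity
    · gcongr
      linarith
  refine ⟨v, fun f i => ⟨⌊(c f i + 2) * n / η⌋₊, Nat.lt_succ_of_le
    (Nat.floor_le_floor (hcoord f i).2)⟩, hv, fun f hf g hg hfg => ⟨fun i => c f i - c g i, ?_, ?_⟩⟩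
  · have h1 : ∀ i, |c f i - c g i| ≤ η / n := by
      intro i
      have h2 : ⌊(c f i + 2) * n / η⌋₊ = ⌊(c g i + 2) * n / η⌋₊ :=
        Fin.mk.inj_iff.1 (congrFun hfg i)
      have hf1 := Nat.floor_le (hcoord f i).1
      have hf2 := Nat.lt_floor_add_one ((c f i + 2) * n / η)
      have hg1 := Nat.floor_le (hcoord g i).1
      have hg2 := Nat.lt_floor_add_one ((c g i + 2) * n / η)
      rw [h2] at hf1 hf2
      have h3 : |(c f i + 2) * n / η - (c g i + 2) * n / η| ≤ 1 :=
        abs_le.2 ⟨by linarith, by linarith⟩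
      have h4 : (c f i + 2) * n / η - (c g i + 2) * n / η = (c f i - c g i) * (n / η) := by ring
      rw [h4, abs_mul, abs_of_pos (by positivity : (0 : ℝ) < n / η)] at h3
      rw [le_div_iff₀ hn0]
      have h5 : |c f i - c g i| * (n / η) = |c f i - c g i| * n / η := by ring
      rw [h5, div_le_one hη] at h3
      exact h3
    refine (Finset.sum_le_sum fun i _ => h1 i).trans (le_of_eq ?_)
    simp only [Finset.sum_const, Finset.card_univ, Fintype.card_fin, nsmul_eq_mul]
    field_simp
  · rw [hvec f hf, hvec g hg, ← Finset.sum_sub_distrib]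
    simp only [sub_smul]

section Subspace

variable {S O A : Type*} [Fintype S] [Fintype O] [Fintype A] [Nonempty A] {H m : ℕ}

/-- The kernels of a model for an episode of length `H`, as a vector. -/
def POMDP.kernelVec (H : ℕ) (M : POMDP S O A) :
    (Fin H × S × A × S) ⊕ (Fin H × S × O) ⊕ S → ℝ :=
  Sum.elim (fun x => M.T x.1 x.2.1 x.2.2.1 x.2.2.2)
    (Sum.elim (fun x => M.E x.1 x.2.1 x.2.2) M.μ)

omit [Nonempty A] in
lemma isBounded_kernelVec (F : Set (POMDP S O A)) :
    Bornology.IsBounded (POMDP.kernelVec H '' F) := by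
  refine (Metric.isBounded_closedBall (x := 0) (r := 1)).subset ?_
  rintro _ ⟨M, -, rfl⟩
  rw [mem_closedBall_zero_iff, pi_norm_le_iff_of_nonneg zero_le_one]
  rintro (x | x | x)
  · exact (abs_of_nonneg (M.T_nonneg x.1 x.2.1 x.2.2.1 x.2.2.2)).trans_le (M.T_le_one _ _ _ _)
  · exact (abs_of_nonneg (M.E_nonneg x.1 x.2.1 x.2.2)).trans_le (M.E_le_one _ _ _)
  · exact (abs_of_nonneg (M.μ_nonneg x)).trans_le (M.μ_le_one _)

/-- A class of models whose kernels span a space of dimension `n` has an `ε`-bracket whose size does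
not depend on the number of states. -/
lemma hasBracket_of_finrank_le {F : Set (POMDP S O A)} {n : ℕ} (hn : 1 ≤ n)
    (hrank : finrank ℝ (Submodule.span ℝ (POMDP.kernelVec H '' F)) ≤ n) {ε η : ℝ} (hη : 0 < η)
    (hηε : 2 * (Fintype.card O : ℝ) ^ H * ((1 + 2 * H) * η) ≤ ε) :
    HasBracket F H ε ((⌊4 * n / η⌋₊ + 1) ^ n) := by
  obtain ⟨v, cell, hv, hcell⟩ := exists_cells (isBounded_kernelVec F) hn hrank hη
  have hclose : ∀ f ∈ F, ∀ g ∈ F, cell f = cell g → ∀ (J : Finset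
      ((Fin H × S × A × S) ⊕ (Fin H × S × O) ⊕ S)),
      (∀ M ∈ F, ∑ j ∈ J, |M.kernelVec H j| ≤ 1) →
      ∑ j ∈ J, |f.kernelVec H j - g.kernelVec H j| ≤ η := by
    intro f hf g hg hfg J hJ
    obtain ⟨c, hc, heq⟩ := hcell f hf g hg hfg
    have hvJ : ∀ i, ∑ j ∈ J, |v i j| ≤ 1 := by
      intro i
      rcases hv i with ⟨M, hM, h⟩ | h
      · rw [← h]
        exact hJ M hM
      · simp [h]
    calc ∑ j ∈ J, |f.kernelVec H j - g.kernelVec H j|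
        ≤ ∑ j ∈ J, ∑ i, |c i| * |v i j| := by
          refine Finset.sum_le_sum fun j _ => ?_
          have h1 := congrFun heq j
          simp only [Pi.sub_apply, Finset.sum_apply, Pi.smul_apply, smul_eq_mul] at h1
          rw [h1]
          refine (Finset.abs_sum_le_sum_abs _ _).trans (le_of_eq ?_)
          simp only [abs_mul]
      _ = ∑ i, |c i| * ∑ j ∈ J, |v i j| := by
          rw [Finset.sum_comm]
          simp only [Finset.mul_sum]
      _ ≤ ∑ i, |c i| * 1 := by
          gcongr with i
          exact hvJ i
      _ ≤ η := by simpa using hc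
  have h := hasBracket_of_cells (H := H) (ε := ε) (F := F) cell (fun _ _ => (1 + 2 * H) * η)
    (le_trans (by positivity) hηε) ?_ ?_
  · simpa using h
  · intro f hf g hg hfg l hl
    have h1 := POMDP.sum_abs_belief_sub_le (f := f) (g := g) (H := H) (η := η) ?_ ?_ ?_ l hl.le
    · rw [hl] at h1
      refine le_trans ?_ h1
      rw [POMDP.prob, POMDP.prob, ← Finset.sum_sub_distrib]
      exact Finset.abs_sum_le_sum_abs _ _
    · intro h hh s a
      let e : S ↪ (Fin H × S × A × S) ⊕ (Fin H × S × O) ⊕ S :=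
        ⟨fun s' => .inl (⟨h, hh⟩, s, a, s'), fun _ _ h => by simpa using h⟩
      have := hclose f hf g hg hfg (Finset.univ.map e) fun M _ => by
        rw [Finset.sum_map]
        refine le_of_eq (Eq.trans ?_ (M.T_sum h s a))
        exact Finset.sum_congr rfl fun s' _ => abs_of_nonneg (M.T_nonneg h s a s')
      rwa [Finset.sum_map] at this
    · intro h hh s o
      have := hclose f hf g hg hfg {.inr (.inl (⟨h, hh⟩, s, o))} fun M _ => by
        rw [Finset.sum_singleton]
        exact (abs_of_nonneg (M.E_nonneg h s o)).trans_le (M.E_le_one h s o)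
      rwa [Finset.sum_singleton] at this
    · let e : S ↪ (Fin H × S × A × S) ⊕ (Fin H × S × O) ⊕ S :=
        ⟨fun s => .inr (.inr s), fun _ _ h => by simpa using h⟩
      have := hclose f hf g hg hfg (Finset.univ.map e) fun M _ => by
        rw [Finset.sum_map]
        refine le_of_eq (Eq.trans ?_ M.μ_sum)
        exact Finset.sum_congr rfl fun s _ => abs_of_nonneg (M.μ_nonneg s)
      rwa [Finset.sum_map] at this
  · intro g _ π
    refine le_trans (le_of_eq ?_) hηε
    simp only [mul_comm _ ((1 + 2 * (H : ℝ)) * η)]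
    rw [← mul_sumLists, π.sum_seq_eq_pow]
    ring

/-- The logarithm of the bracket number at the scale `ε_b` for a class of models whose kernels span a
space of dimension `n`. -/
lemma log_bracketNumber_le_of_finrank_le [Nonempty O] (hmH : m ≤ H) (hm : 1 ≤ m)
    {F : Set (POMDP S O A)} {n : ℕ} (hn : 1 ≤ n)
    (hrank : finrank ℝ (Submodule.span ℝ (POMDP.kernelVec H '' F)) ≤ n) {Y : ℝ} {K : ℕ}
    (hK : 1 ≤ K) (hY : 1 ≤ Y) (hnY : (n : ℝ) ≤ 3 * Y ^ 4) (hHY : (H : ℝ) ≤ Y)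
    (hAY : (Fintype.card A : ℝ) ^ m ≤ Y) (hOY : Real.log (Fintype.card O) ≤ Y) :
    (∃ N, HasBracket F H (bracketScale A H m K) N) ∧
      Real.log (bracketNumber F H (bracketScale A H m K)) ≤ 39 * Y ^ 6 * (1 + Real.log K) := by
  have hY0 : 0 < Y := by linarith
  have hK1 : (1 : ℝ) ≤ K := by exact_mod_cast hK
  have hK0 : (0 : ℝ) < K := by linarith
  have hlogK := Real.log_nonneg hK1
  have hA1 : (1 : ℝ) ≤ Fintype.card A := by exact_mod_cast Fintype.card_pos
  have hO1 : (1 : ℝ) ≤ Fintype.card O := by exact_mod_cast Fintype.card_pos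
  have hO0 : (0 : ℝ) < Fintype.card O := by linarith
  have hH1 : (1 : ℝ) ≤ H := by exact_mod_cast hm.trans hmH
  have hH0 : (0 : ℝ) < H := by linarith
  have hn1 : (1 : ℝ) ≤ n := by exact_mod_cast hn
  set U : ℝ := (Fintype.card A : ℝ) ^ (m - 1) with hU
  have hU1 : 1 ≤ U := one_le_pow₀ hA1
  have hUY : U ≤ Y := (pow_le_pow_right₀ hA1 (Nat.sub_le m 1)).trans hAY
  set η : ℝ := bracketScale A H m K / (2 * (Fintype.card O : ℝ) ^ H * (1 + 2 * H)) with hηdef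
  have hscale : bracketScale A H m K = 1 / (K * H * U) := rfl
  have hη : 0 < η := by
    rw [hηdef, hscale]
    positivity
  have hbr := hasBracket_of_finrank_le (ε := bracketScale A H m K) hn hrank hη (by
    rw [hηdef]
    apply le_of_eq
    field_simp)
  refine ⟨⟨_, hbr⟩, (log_bracketNumber_le hbr).trans ?_⟩
  have hηinv : 4 * n / η = (8 * n * (1 + 2 * H) * H * U) * K * (Fintype.card O : ℝ) ^ H := by
    rw [hηdef, hscale]
    field_simp
    ring
  have hbig : (8 * n * (1 + 2 * H) * H * U : ℝ) + 1 ≤ 73 * Y ^ 7 := by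
    have h1 : (8 * n * (1 + 2 * H) * H * U : ℝ) ≤ 8 * (3 * Y ^ 4) * (3 * Y) * Y * Y := by
      gcongr
      linarith
    have h2 : 1 ≤ Y ^ 7 := one_le_pow₀ hY
    nlinarith
  have hfloor : ((⌊4 * n / η⌋₊ + 1 : ℕ) : ℝ) ≤ 73 * Y ^ 7 * K * (Fintype.card O : ℝ) ^ H := by
    push_cast
    have h1 := Nat.floor_le (show 0 ≤ 4 * n / η by positivity)
    have h2 : 1 ≤ (K : ℝ) * (Fintype.card O : ℝ) ^ H :=
      one_le_mul_of_one_le_of_one_le hK1 (one_le_pow₀ hO1)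
    calc ((⌊4 * n / η⌋₊ : ℝ) + 1)
        ≤ (8 * n * (1 + 2 * H) * H * U) * (K * (Fintype.card O : ℝ) ^ H) +
          K * (Fintype.card O : ℝ) ^ H := by
          rw [hηinv, mul_assoc] at h1
          rw [hηinv, mul_assoc]
          linarith
      _ = ((8 * n * (1 + 2 * H) * H * U : ℝ) + 1) * (K * (Fintype.card O : ℝ) ^ H) := by ring
      _ ≤ 73 * Y ^ 7 * (K * (Fintype.card O : ℝ) ^ H) := by gcongr
      _ = _ := by ring
  have hlog : Real.log ((⌊4 * n / η⌋₊ + 1 : ℕ) : ℝ) ≤ 13 * Y ^ 2 * (1 + Real.log K) := by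
    have h1 : Real.log ((⌊4 * n / η⌋₊ + 1 : ℕ) : ℝ) ≤
        Real.log (73 * Y ^ 7 * K * (Fintype.card O : ℝ) ^ H) :=
      Real.log_le_log (by positivity) hfloor
    rw [Real.log_mul (by positivity) (by positivity), Real.log_mul (by positivity) (by positivity),
      Real.log_mul (by positivity) (by positivity), Real.log_pow, Real.log_pow] at h1
    have h2 : Real.log 73 ≤ 5 := by
      rw [Real.log_le_iff_le_exp (by norm_num)]
      have := Real.exp_one_gt_d9
      calc (73 : ℝ) ≤ 2.7 ^ 5 := by norm_num
        _ ≤ Real.exp 1 ^ 5 := by gcongr; linarith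
        _ = Real.exp 5 := by rw [← Real.exp_nat_mul]; norm_num
    have h3 : Real.log Y ≤ Y := Real.log_le_self hY0.le
    have h4 : H * Real.log (Fintype.card O) ≤ Y * Y :=
      mul_le_mul hHY hOY (Real.log_nonneg hO1) hY0.le
    have h5 : 1 ≤ Y ^ 2 := one_le_pow₀ hY
    have h6 : Y ≤ Y ^ 2 := by nlinarith
    have h7 : Real.log K ≤ Y ^ 2 * Real.log K := le_mul_of_one_le_left hlogK h5
    push_cast at h1 ⊢
    calc _ ≤ _ := h1
      _ ≤ 13 * Y ^ 2 + Y ^ 2 * Real.log K := by nlinarith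
      _ ≤ 13 * Y ^ 2 + 13 * (Y ^ 2 * Real.log K) := by
        have : 0 ≤ Y ^ 2 * Real.log K := by positivity
        linarith
      _ = _ := by ring
  rw [Nat.cast_pow, Real.log_pow]
  calc n * Real.log ((⌊4 * n / η⌋₊ + 1 : ℕ) : ℝ)
      ≤ (3 * Y ^ 4) * (13 * Y ^ 2 * (1 + Real.log K)) := by gcongr
    _ = _ := by ring

omit [Fintype A] [Nonempty A] in
/-- The kernels of linear models with given features span a space whose dimension is at most the
number of parameters. -/
lemma finrank_span_kernelVec_le {d₁ d₂ d₃ d₄ d₅ : ℕ}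
    (feat : LinearFeatures S O A H d₁ d₂ d₃ d₄ d₅) {F : Set (POMDP S O A)}
    (hF : ∀ f ∈ F, f.IsLinear feat) :
    finrank ℝ (Submodule.span ℝ (POMDP.kernelVec H '' F)) ≤
      H * (d₂ * d₁) + (H * (d₄ * d₃) + d₅) := by
  let Φ : ((Fin H → Matrix (Fin d₂) (Fin d₁) ℝ) × (Fin H → Matrix (Fin d₄) (Fin d₃) ℝ) ×
      (Fin d₅ → ℝ)) →ₗ[ℝ] ((Fin H × S × A × S) ⊕ (Fin H × S × O) ⊕ S → ℝ) :=
    { toFun := fun p => Sum.elim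
        (fun x => feat.ψT x.1 x.2.2.2 ⬝ᵥ (p.1 x.1).mulVec (feat.φT x.1 x.2.1 x.2.2.1))
        (Sum.elim (fun x => feat.ψE x.1 x.2.2 ⬝ᵥ (p.2.1 x.1).mulVec (feat.φE x.1 x.2.1))
          fun s => p.2.2 ⬝ᵥ feat.φμ s)
      map_add' := fun p q => by
        ext (x | x | x) <;> simp [Matrix.add_mulVec, dotProduct_add, add_dotProduct]
      map_smul' := fun r p => by
        ext (x | x | x) <;> simp [Matrix.smul_mulVec, dotProduct_smul, smul_dotProduct] }
  have hle : Submodule.span ℝ (POMDP.kernelVec H '' F) ≤ LinearMap.range Φ := by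
    rw [Submodule.span_le]
    rintro _ ⟨f, hf, rfl⟩
    obtain ⟨B₁, B₂, θ, -, -, -, hT, hE, hμ⟩ := hF f hf
    refine ⟨(fun h => B₁ h, fun h => B₂ h, θ), ?_⟩
    ext (x | x | x)
    · exact (hT x.1 x.1.2 _ _ _).symm
    · exact (hE x.1 x.1.2 _ _).symm
    · exact (hμ x).symm
  refine (Submodule.finrank_mono hle).trans ((LinearMap.finrank_range_le Φ).trans (le_of_eq ?_))
  rw [finrank_prod, finrank_prod, finrank_pi_fintype, finrank_pi_fintype]
  simp [finrank_matrix]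

end Subspace

/-! ### The bracket number of a class of low-rank decodable models -/

lemma logCover_nonneg {X : Type*} [PseudoEMetricSpace X] (ε : ℝ) (Y : Set X) : 0 ≤ logCover ε Y :=
  Real.log_natCast_nonneg _

/-- A nonempty bounded set is partitioned into sets of diameter at most `2 ε` by a smallest external
`ε`-cover. -/
lemma exists_cells_logCover {X : Type*} [PseudoMetricSpace X] [ProperSpace X] {Y : Set X}
    (hY : Bornology.IsBounded Y) (hne : Y.Nonempty) {ε : ℝ} (hε : 0 < ε) :
    ∃ (N : ℕ) (cell : X → Fin N), Real.log N = logCover ε Y ∧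
      ∀ x ∈ Y, ∀ y ∈ Y, cell x = cell y → dist x y ≤ 2 * ε := by
  classical
  obtain ⟨C₀, -, hC₀, hcov₀⟩ := Metric.exists_finite_isCover_of_isCompact_closure
    (s := Y) (ε := ε.toNNReal) (by simpa using hε) hY.isCompact_closure
  have hfin : Metric.externalCoveringNumber ε.toNNReal Y ≠ ⊤ :=
    ((hcov₀.externalCoveringNumber_le_encard).trans_lt hC₀.encard_lt_top).ne
  obtain ⟨C, hcov, hC⟩ : ∃ C, Metric.IsCover ε.toNNReal Y C ∧
      C.encard = Metric.externalCoveringNumber ε.toNNReal Y := by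
    have h1 : ∃ C : {C : Set X // Metric.IsCover ε.toNNReal Y C},
        C.1.encard = ⨅ C : {C : Set X // Metric.IsCover ε.toNNReal Y C}, C.1.encard := by
      have : Nonempty {C : Set X // Metric.IsCover ε.toNNReal Y C} := ⟨⟨C₀, hcov₀⟩⟩
      exact ENat.exists_eq_iInf _
    obtain ⟨C, hC⟩ := h1
    exact ⟨C.1, C.2, by rw [hC, Metric.externalCoveringNumber, iInf_subtype]⟩
  have hCfin : C.Finite := Set.encard_ne_top_iff.1 (hC ▸ hfin)
  have := hCfin.fintype
  have hcard : (Metric.externalCoveringNumber ε.toNNReal Y).toNat = Fintype.card C := by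
    rw [← hC, ← Set.ncard_def, Set.ncard_eq_toFinset_card', Set.toFinset_card]
  have hcov' : ∀ x ∈ Y, ∃ z : C, dist x z ≤ ε := by
    intro x hx
    obtain ⟨z, hz, hxz⟩ := hcov hx
    refine ⟨⟨z, hz⟩, ?_⟩
    have hxz : edist x z ≤ ε.toNNReal := hxz
    rwa [edist_dist, ENNReal.ofNNReal_toNNReal, ENNReal.ofReal_le_ofReal_iff hε.le] at hxz
  obtain ⟨y₀, hy₀⟩ := hne
  obtain ⟨z₀, -⟩ := hcov' y₀ hy₀
  let near : X → C := fun x => if hx : ∃ z : C, dist x z ≤ ε then hx.choose else z₀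
  have hnear : ∀ x ∈ Y, dist x (near x) ≤ ε := by
    intro x hx
    have h := hcov' x hx
    simp only [near, dif_pos h]
    exact h.choose_spec
  refine ⟨Fintype.card C, fun x => Fintype.equivFin C (near x), by rw [logCover, hcard],
    fun x hx y hy hxy => ?_⟩
  have h1 : near x = near y := (Fintype.equivFin C).injective hxy
  have h2 := hnear x hx
  have h3 := hnear y hy
  rw [h1] at h2
  linarith [dist_triangle_right x y (near y : X)]

/-- The sums of two nonnegative functions, each with at most one nonzero value, are as close as the
functions in the sup norm. -/
lemma abs_sum_sub_sum_le {S : Type*} [Fintype S] {a b : S → ℝ} {C : ℝ} (ha : ∀ s, 0 ≤ a s)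
    (hb : ∀ s, 0 ≤ b s) (ha' : ∃ s₁, ∀ s, s ≠ s₁ → a s = 0) (hb' : ∃ s₂, ∀ s, s ≠ s₂ → b s = 0)
    (h : ∀ s, |a s - b s| ≤ C) : |∑ s, a s - ∑ s, b s| ≤ C := by
  classical
  obtain ⟨s₁, h₁⟩ := ha'
  obtain ⟨s₂, h₂⟩ := hb'
  rw [Finset.sum_eq_single s₁ (fun s _ hs => h₁ s hs) (by simp),
    Finset.sum_eq_single s₂ (fun s _ hs => h₂ s hs) (by simp)]
  rcases eq_or_ne s₁ s₂ with rfl | hne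
  · exact h _
  · have e1 := h s₁
    have e2 := h s₂
    rw [h₂ s₁ hne, sub_zero, abs_of_nonneg (ha s₁)] at e1
    rw [h₁ s₂ hne.symm, zero_sub, abs_neg, abs_of_nonneg (hb s₂)] at e2
    exact abs_le.2 ⟨by linarith [ha s₁], by linarith [hb s₂]⟩

section LowRank

variable {S O A : Type*} [Fintype S] [Fintype O] {H m : ℕ}

lemma POMDP.IsDecodable.exists_unique_state {M : POMDP S O A} (hdec : M.IsDecodable H m)
    {l : List (O × A)} (hl : l.length < H) (o : O) :
    ∃ s₁, ∀ s, s ≠ s₁ → M.belief l s * M.E l.length s o = 0 := by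
  obtain ⟨dec, hdec⟩ := hdec
  refine ⟨dec l.length (l.rtake (m - 1)) o, fun s hs => ?_⟩
  by_contra h0
  exact hs (hdec _ hl l rfl o s (lt_of_le_of_ne
    (mul_nonneg (M.belief_nonneg _ _) (M.E_nonneg _ _ _)) (Ne.symm h0)))

lemma POMDP.belief_le_prob (M : POMDP S O A) (l : List (O × A)) (s : S) :
    M.belief l s ≤ M.prob l :=
  Finset.single_le_sum (f := M.belief l) (fun s _ => M.belief_nonneg l s) (Finset.mem_univ s)

variable {f g : POMDP S O A} {ρ : ℝ}

/-- For decodable models, the sup-norm distance of beliefs only accumulates errors weighted with the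
probabilities of the prefixes: since only one state is compatible with a history and an
observation, the filter takes maxima in place of sums over the states. -/
lemma POMDP.IsDecodable.abs_belief_sub_le (hf : f.IsDecodable H m) (hg : g.IsDecodable H m)
    (hρ : 0 ≤ ρ) (hT : ∀ h < H, ∀ s a s', |f.T h s a s' - g.T h s a s'| ≤ 4 * ρ)
    (hE : ∀ h < H, ∀ s o, |f.E h s o - g.E h s o| ≤ 2 * ρ) (hμ : ∀ s, |f.μ s - g.μ s| ≤ 2 * ρ)
    (l : List (O × A)) (hl : l.length ≤ H) (s : S) :
    |f.belief l s - g.belief l s| ≤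
      6 * ρ * (1 + ∑ i ∈ Finset.range l.length, g.prob (l.take i)) := by
  induction l using List.reverseRecOn generalizing s with
  | nil =>
    have := hμ s
    simp only [belief, filter, List.length_nil, Finset.range_zero, Finset.sum_empty, add_zero,
      mul_one]
    linarith
  | append_singleton l x ih =>
    obtain ⟨o, a⟩ := x
    simp only [List.length_append, List.length_singleton] at hl ⊢
    have hlH : l.length < H := by omega
    have htake : ∑ i ∈ Finset.range (l.length + 1), g.prob ((l ++ [(o, a)]).take i) =
        ∑ i ∈ Finset.range l.length, g.prob (l.take i) + g.prob l := by
      rw [Finset.sum_range_succ, List.take_left]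
      congr 1
      refine Finset.sum_congr rfl fun i hi => ?_
      rw [List.take_append_of_le_length (Finset.mem_range.1 hi).le]
    rw [htake, belief_concat, belief_concat]
    refine abs_sum_sub_sum_le
      (fun s' => mul_nonneg (mul_nonneg (f.belief_nonneg _ _) (f.E_nonneg _ _ _)) (f.T_nonneg _ _ _ _))
      (fun s' => mul_nonneg (mul_nonneg (g.belief_nonneg _ _) (g.E_nonneg _ _ _)) (g.T_nonneg _ _ _ _))
      ?_ ?_ fun s₀ => ?_
    · obtain ⟨s₁, h₁⟩ := hf.exists_unique_state hlH o
      exact ⟨s₁, fun s' hs' => by rw [h₁ s' hs', zero_mul]⟩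
    · obtain ⟨s₁, h₁⟩ := hg.exists_unique_state hlH o
      exact ⟨s₁, fun s' hs' => by rw [h₁ s' hs', zero_mul]⟩
    · have hb := g.belief_nonneg l s₀
      have ht := f.T_nonneg l.length s₀ a s
      have he := f.E_nonneg l.length s₀ o
      have he' := g.E_nonneg l.length s₀ o
      have hbp := g.belief_le_prob l s₀
      have h1 : f.belief l s₀ * f.E l.length s₀ o * f.T l.length s₀ a s -
          g.belief l s₀ * g.E l.length s₀ o * g.T l.length s₀ a s =
          (f.belief l s₀ - g.belief l s₀) * (f.E l.length s₀ o * f.T l.length s₀ a s) +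
          g.belief l s₀ * (f.E l.length s₀ o - g.E l.length s₀ o) * f.T l.length s₀ a s +
          g.belief l s₀ * g.E l.length s₀ o * (f.T l.length s₀ a s - g.T l.length s₀ a s) := by
        ring
      rw [h1]
      refine (abs_add_three _ _ _).trans ?_
      simp only [abs_mul, abs_of_nonneg hb, abs_of_nonneg ht, abs_of_nonneg he, abs_of_nonneg he']
      have e1 := mul_le_of_le_one_right (abs_nonneg (f.belief l s₀ - g.belief l s₀))
        (mul_le_one₀ (f.E_le_one l.length s₀ o) ht (f.T_le_one l.length s₀ a s))
      have e2 : g.belief l s₀ * |f.E l.length s₀ o - g.E l.length s₀ o| * f.T l.length s₀ a s ≤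
          g.prob l * (2 * ρ) :=
        (mul_le_of_le_one_right (by positivity) (f.T_le_one _ _ _ _)).trans
          (mul_le_mul hbp (hE _ hlH _ _) (abs_nonneg _) (g.prob_nonneg l))
      have e3 : g.belief l s₀ * g.E l.length s₀ o * |f.T l.length s₀ a s - g.T l.length s₀ a s| ≤
          g.prob l * (4 * ρ) :=
        mul_le_mul ((mul_le_of_le_one_right hb (g.E_le_one _ _ _)).trans hbp) (hT _ hlH _ _ _)
          (abs_nonneg _) (g.prob_nonneg l)
      have e4 := ih (by omega) s₀
      linarith

lemma POMDP.IsDecodable.abs_prob_sub_le (hf : f.IsDecodable H m) (hg : g.IsDecodable H m)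
    (hρ : 0 ≤ ρ) (hT : ∀ h < H, ∀ s a s', |f.T h s a s' - g.T h s a s'| ≤ 4 * ρ)
    (hE : ∀ h < H, ∀ s o, |f.E h s o - g.E h s o| ≤ 2 * ρ) (hμ : ∀ s, |f.μ s - g.μ s| ≤ 2 * ρ)
    (l : List (O × A)) (hl : l.length ≤ H) :
    |f.prob l - g.prob l| ≤
      6 * ρ * (1 + ∑ i ∈ Finset.range l.length, g.prob (l.take i)) := by
  rcases List.eq_nil_or_concat' l with rfl | ⟨l, ⟨o, a⟩, rfl⟩
  · simpa using hρ
  simp only [List.length_append, List.length_singleton] at hl ⊢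
  have hlH : l.length < H := by omega
  have htake : ∑ i ∈ Finset.range (l.length + 1), g.prob ((l ++ [(o, a)]).take i) =
      ∑ i ∈ Finset.range l.length, g.prob (l.take i) + g.prob l := by
    rw [Finset.sum_range_succ, List.take_left]
    congr 1
    refine Finset.sum_congr rfl fun i hi => ?_
    rw [List.take_append_of_le_length (Finset.mem_range.1 hi).le]
  rw [htake, prob_concat, prob_concat]
  refine abs_sum_sub_sum_le
    (fun s' => mul_nonneg (f.belief_nonneg _ _) (f.E_nonneg _ _ _))
    (fun s' => mul_nonneg (g.belief_nonneg _ _) (g.E_nonneg _ _ _))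
    (hf.exists_unique_state hlH o) (hg.exists_unique_state hlH o) fun s₀ => ?_
  have hb := g.belief_nonneg l s₀
  have he := f.E_nonneg l.length s₀ o
  have h1 : f.belief l s₀ * f.E l.length s₀ o - g.belief l s₀ * g.E l.length s₀ o =
      (f.belief l s₀ - g.belief l s₀) * f.E l.length s₀ o +
      g.belief l s₀ * (f.E l.length s₀ o - g.E l.length s₀ o) := by ring
  rw [h1]
  refine (abs_add_le _ _).trans ?_
  simp only [abs_mul, abs_of_nonneg hb, abs_of_nonneg he]
  have e1 := mul_le_of_le_one_right (abs_nonneg (f.belief l s₀ - g.belief l s₀))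
    (f.E_le_one l.length s₀ o)
  have e2 : g.belief l s₀ * |f.E l.length s₀ o - g.E l.length s₀ o| ≤ g.prob l * (2 * ρ) :=
    mul_le_mul (g.belief_le_prob l s₀) (hE _ hlH _ _) (abs_nonneg _) (g.prob_nonneg l)
  have e3 := hf.abs_belief_sub_le hg hρ hT hE hμ l hlH.le s₀
  have e4 : 0 ≤ g.prob l * ρ := mul_nonneg (g.prob_nonneg l) hρ
  linarith

/-- Without information in the observations, all models have the same observation probabilities. -/
lemma POMDP.prob_eq_one_of_card_eq_one (hO : Fintype.card O = 1) (M : POMDP S O A)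
    (l : List (O × A)) : M.prob l = 1 := by
  obtain ⟨o₀, ho₀⟩ := Fintype.card_eq_one_iff.1 hO
  induction l using List.reverseRecOn with
  | nil => exact M.prob_nil
  | append_singleton l x ih =>
    have h1 := M.isProcess_prob.sum l x.2
    rw [Fintype.sum_eq_single x.1 fun o ho => absurd ((ho₀ o).trans (ho₀ x.1).symm) ho] at h1
    exact h1.trans ih

variable [Fintype A] [Nonempty A]

lemma Policy.sum_seq_mul_prob_take (π : Policy O A) (M : POMDP S O A) {i : ℕ} (hi : i ≤ H) :
    sumLists H (fun l => π.seq [] l * M.prob (l.take i)) = (Fintype.card O : ℝ) ^ (H - i) := by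
  obtain ⟨k, rfl⟩ := Nat.exists_eq_add_of_le hi
  rw [sumLists_add, Nat.add_sub_cancel_left]
  calc sumLists i (fun a => sumLists k fun b =>
        π.seq [] (a ++ b) * M.prob ((a ++ b).take i))
      = sumLists i (fun a => (Fintype.card O : ℝ) ^ k * (π.seq [] a * M.prob a)) := by
        refine sumLists_congr fun a ha => ?_
        rw [← π.sum_seq_eq_pow a k, mul_comm, mul_sumLists]
        refine sumLists_congr fun b _ => ?_
        rw [← ha, List.take_left, Policy.seq_append, List.nil_append]
        ring
    _ = _ := by rw [← mul_sumLists, M.isProcess_prob.sum_seq, M.prob_nil, mul_one]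

/-- The bracket number of a class of decodable low-rank models is at most the product of the four
covering numbers. -/
lemma log_bracketNumber_le_logCover {d : ℕ} (hd : 1 ≤ d)
    {F : Set (LowRankPOMDP S O A H d)} {M : LowRankPOMDP S O A H d} (hMF : M ∈ F)
    (hdec : ∀ f ∈ F, f.IsDecodable H m) {ε ρ : ℝ} (hρ : 0 < ρ)
    (hρε : 24 * ρ * (Fintype.card O : ℝ) ^ (H + 2) ≤ ε) :
    (∃ N, HasBracket (LowRankPOMDP.toPOMDP '' F) H ε N) ∧
      Real.log (bracketNumber (LowRankPOMDP.toPOMDP '' F) H ε) ≤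
        logCover (ρ / d) (LowRankPOMDP.phiFun '' F) + logCover (ρ / d) (LowRankPOMDP.psiFun '' F) +
        logCover ρ (LowRankPOMDP.emFun '' F) + logCover ρ (LowRankPOMDP.muFun '' F) := by
  classical
  have hε : 0 ≤ ε := le_trans (by positivity) hρε
  have := M.nonempty_observations
  have hd0 : (0 : ℝ) < d := by exact_mod_cast hd
  have hO1 : 1 ≤ Fintype.card O := Fintype.card_pos
  -- a single observation carries no information, and the geometric sum below needs a base `≥ 2`
  rcases hO1.eq_or_lt with hO | hO2
  · have hbr := hasBracket_of_cells (F := LowRankPOMDP.toPOMDP '' F) (H := H) (ε := ε)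
      (fun _ => ()) (fun _ _ => 0) hε
      (fun f _ g _ _ l _ => by
        rw [f.prob_eq_one_of_card_eq_one hO.symm, g.prob_eq_one_of_card_eq_one hO.symm]
        simp)
      (fun g _ π => by simpa [sumLists] using hε)
    refine ⟨⟨_, hbr⟩, (log_bracketNumber_le hbr).trans ?_⟩
    simp only [Fintype.card_unit, Nat.cast_one, Real.log_one]
    exact add_nonneg (add_nonneg (add_nonneg (logCover_nonneg _ _) (logCover_nonneg _ _))
      (logCover_nonneg _ _)) (logCover_nonneg _ _)
  obtain ⟨N₁, c₁, hN₁, h₁⟩ := exists_cells_logCover (Y := LowRankPOMDP.phiFun '' F) (ε := ρ / d)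
    (by
      refine (Metric.isBounded_closedBall (x := 0) (r := 1)).subset ?_
      rintro _ ⟨f, -, rfl⟩
      rw [mem_closedBall_zero_iff]
      simp only [pi_norm_le_iff_of_nonneg zero_le_one]
      exact fun h s a i => f.φ_le h h.2 s a i) ⟨_, M, hMF, rfl⟩ (by positivity)
  obtain ⟨N₂, c₂, hN₂, h₂⟩ := exists_cells_logCover (Y := LowRankPOMDP.psiFun '' F) (ε := ρ / d)
    (by
      refine (Metric.isBounded_closedBall (x := 0) (r := 1)).subset ?_
      rintro _ ⟨f, -, rfl⟩
      rw [mem_closedBall_zero_iff]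
      simp only [pi_norm_le_iff_of_nonneg zero_le_one]
      exact fun h s i => f.ψ_le h h.2 s i) ⟨_, M, hMF, rfl⟩ (by positivity)
  obtain ⟨N₃, c₃, hN₃, h₃⟩ := exists_cells_logCover (Y := LowRankPOMDP.emFun '' F) (ε := ρ)
    (by
      refine (Metric.isBounded_closedBall (x := 0) (r := 1)).subset ?_
      rintro _ ⟨f, -, rfl⟩
      rw [mem_closedBall_zero_iff]
      simp only [pi_norm_le_iff_of_nonneg zero_le_one]
      exact fun h s o => (abs_of_nonneg (f.E_nonneg h s o)).trans_le (f.E_le_one h s o))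
    ⟨_, M, hMF, rfl⟩ hρ
  obtain ⟨N₄, c₄, hN₄, h₄⟩ := exists_cells_logCover (Y := LowRankPOMDP.muFun '' F) (ε := ρ)
    (by
      refine (Metric.isBounded_closedBall (x := 0) (r := 1)).subset ?_
      rintro _ ⟨f, -, rfl⟩
      rw [mem_closedBall_zero_iff]
      simp only [pi_norm_le_iff_of_nonneg zero_le_one]
      exact fun s => (abs_of_nonneg (f.μ_nonneg s)).trans_le (f.μ_le_one s)) ⟨_, M, hMF, rfl⟩ hρ
  -- cells are defined for models without features, so features have to be chosen
  have hrep : ∀ f : POMDP S O A, ∃ f' ∈ F, f ∈ LowRankPOMDP.toPOMDP '' F → f'.toPOMDP = f := by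
    intro f
    by_cases hf : f ∈ LowRankPOMDP.toPOMDP '' F
    · obtain ⟨f', hf', rfl⟩ := hf
      exact ⟨f', hf', fun _ => rfl⟩
    · exact ⟨M, hMF, fun h => absurd h hf⟩
  choose rep hrepF hrep using hrep
  have hbr := hasBracket_of_cells (F := LowRankPOMDP.toPOMDP '' F) (H := H) (ε := ε)
    (fun f => (c₁ (rep f).phiFun, c₂ (rep f).psiFun, c₃ (rep f).emFun, c₄ (rep f).muFun))
    (fun g l => 6 * ρ * (1 + ∑ i ∈ Finset.range H, g.prob (l.take i))) hε ?_ ?_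
  · refine ⟨⟨_, hbr⟩, (log_bracketNumber_le hbr).trans (le_of_eq ?_)⟩
    have hpos : ∀ {N : ℕ}, Fin N → (N : ℝ) ≠ 0 := fun i => by
      have := i.pos
      positivity
    have p₁ := hpos (c₁ M.phiFun)
    have p₂ := hpos (c₂ M.psiFun)
    have p₃ := hpos (c₃ M.emFun)
    have p₄ := hpos (c₄ M.muFun)
    rw [← hN₁, ← hN₂, ← hN₃, ← hN₄]
    simp only [Fintype.card_prod, Fintype.card_fin, Nat.cast_mul]
    rw [Real.log_mul p₁ (by positivity), Real.log_mul p₂ (by positivity), Real.log_mul p₃ p₄]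
    ring
  · intro f hf g hg hfg l hl
    obtain ⟨e₁, e₂, e₃, e₄⟩ : _ ∧ _ ∧ _ ∧ _ := by simpa only [Prod.mk.injEq] using hfg
    have d₁ := h₁ _ ⟨_, hrepF f, rfl⟩ _ ⟨_, hrepF g, rfl⟩ e₁
    have d₂ := h₂ _ ⟨_, hrepF f, rfl⟩ _ ⟨_, hrepF g, rfl⟩ e₂
    have d₃ := h₃ _ ⟨_, hrepF f, rfl⟩ _ ⟨_, hrepF g, rfl⟩ e₃
    have d₄ := h₄ _ ⟨_, hrepF f, rfl⟩ _ ⟨_, hrepF g, rfl⟩ e₄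
    have hρ2 : 0 ≤ 2 * ρ := by positivity
    have hρd : 0 ≤ 2 * (ρ / d) := by positivity
    simp only [dist_pi_le_iff hρd] at d₁ d₂
    simp only [dist_pi_le_iff hρ2] at d₃ d₄
    have hφ : ∀ h < H, ∀ s a i, |(rep f).φ h s a i - (rep g).φ h s a i| ≤ 2 * (ρ / d) :=
      fun h hh s a i => d₁ ⟨h, hh⟩ s a i
    have hψ : ∀ h < H, ∀ s i, |(rep f).ψ h s i - (rep g).ψ h s i| ≤ 2 * (ρ / d) :=
      fun h hh s i => d₂ ⟨h, hh⟩ s i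
    have hE : ∀ h < H, ∀ s o, |(rep f).E h s o - (rep g).E h s o| ≤ 2 * ρ :=
      fun h hh s o => d₃ ⟨h, hh⟩ s o
    have hμ : ∀ s, |(rep f).μ s - (rep g).μ s| ≤ 2 * ρ := d₄
    have hT : ∀ h < H, ∀ s a s', |(rep f).T h s a s' - (rep g).T h s a s'| ≤ 4 * ρ := by
      intro h hh s a s'
      rw [(rep f).T_eq h hh, (rep g).T_eq h hh, dotProduct, dotProduct, ← Finset.sum_sub_distrib]
      calc |∑ i, ((rep f).ψ h s' i * (rep f).φ h s a i - (rep g).ψ h s' i * (rep g).φ h s a i)|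
          ≤ ∑ i : Fin d, (2 * (ρ / d) * 1 + 1 * (2 * (ρ / d))) := by
            refine (Finset.abs_sum_le_sum_abs _ _).trans (Finset.sum_le_sum fun i _ => ?_)
            have e : (rep f).ψ h s' i * (rep f).φ h s a i - (rep g).ψ h s' i * (rep g).φ h s a i =
                ((rep f).ψ h s' i - (rep g).ψ h s' i) * (rep f).φ h s a i +
                (rep g).ψ h s' i * ((rep f).φ h s a i - (rep g).φ h s a i) := by ring
            rw [e]
            refine (abs_add_le _ _).trans ?_
            rw [abs_mul, abs_mul]
            exact add_le_add
              (mul_le_mul (hψ h hh _ _) ((rep f).φ_le h hh _ _ _) (abs_nonneg _) (by positivity))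
              (mul_le_mul ((rep g).ψ_le h hh _ _) (hφ h hh _ _ _) (abs_nonneg _) zero_le_one)
        _ = 4 * ρ := by
            simp only [Finset.sum_const, Finset.card_univ, Fintype.card_fin, nsmul_eq_mul]
            field_simp
            ring
    have := (hdec _ (hrepF f)).abs_prob_sub_le (hdec _ (hrepF g)) hρ.le hT hE hμ l hl.le
    rwa [hrep f hf, hrep g hg, hl] at this
  · intro g _ π
    refine le_trans ?_ hρε
    have h1 : sumLists H (fun l => π.seq [] l * (6 * ρ * (1 + ∑ i ∈ Finset.range H,
        g.prob (l.take i)))) = 6 * ρ * ((Fintype.card O : ℝ) ^ H +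
          ∑ i ∈ Finset.range H, (Fintype.card O : ℝ) ^ (H - i)) := by
      have h2 : ∀ l : List (O × A), π.seq [] l * (6 * ρ * (1 + ∑ i ∈ Finset.range H,
          g.prob (l.take i))) = 6 * ρ * (π.seq [] l + ∑ i ∈ Finset.range H,
            π.seq [] l * g.prob (l.take i)) := by
        intro l
        rw [← Finset.mul_sum]
        ring
      simp only [h2]
      rw [← mul_sumLists, sumLists_add_distrib, π.sum_seq_eq_pow, sumLists_sum]
      congr 2
      exact Finset.sum_congr rfl fun i hi => π.sum_seq_mul_prob_take g (Finset.mem_range.1 hi).le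
    have h3 : ∑ i ∈ Finset.range H, (Fintype.card O : ℝ) ^ (H - i) ≤
        (Fintype.card O : ℝ) ^ (H + 2) := by
      have h4 : ∑ i ∈ Finset.range H, Fintype.card O ^ (H - i) ≤
          ∑ i ∈ Finset.range (H + 1), Fintype.card O ^ i := by
        rw [← Finset.sum_range_reflect (fun i => Fintype.card O ^ i), Finset.sum_range_succ]
        simp
      have h5 := Nat.geomSum_lt hO2 (s := Finset.range (H + 1)) (n := H + 1) (by simp)
      have h6 : Fintype.card O ^ (H + 1) ≤ Fintype.card O ^ (H + 2) :=
        Nat.pow_le_pow_right hO1 (by omega)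
      exact_mod_cast h4.trans (h5.le.trans h6)
    have h7 : (Fintype.card O : ℝ) ^ H ≤ (Fintype.card O : ℝ) ^ (H + 2) :=
      pow_le_pow_right₀ (by exact_mod_cast hO1) (by omega)
    rw [h1]
    calc 2 * (6 * ρ * ((Fintype.card O : ℝ) ^ H +
          ∑ i ∈ Finset.range H, (Fintype.card O : ℝ) ^ (H - i)))
        ≤ 2 * (6 * ρ * ((Fintype.card O : ℝ) ^ (H + 2) + (Fintype.card O : ℝ) ^ (H + 2))) := by
          gcongr
      _ = _ := by ring

end LowRank

open Module

/-! ### Polynomial sample complexity -/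

/-- The polynomial in the relevant quantities by which `K ε²` has to be bounded below: a power of
`1` plus their sum. The constants are those of `craneSucceeds_of_le`. -/
noncomputable def samplePoly (n : ℕ) (C₁ : ℝ) (b : ℕ) : MvPolynomial (Fin n) ℝ :=
  MvPolynomial.C (4096 * (512 * (105 * (C₁ + 4))) ^ 2) *
    (1 + ∑ i, MvPolynomial.X i) ^ (2 * (22 + b) + 2)

lemma eval_samplePoly (n : ℕ) (C₁ : ℝ) (b : ℕ) (x : Fin n → ℝ) :
    MvPolynomial.eval x (samplePoly n C₁ b) =
      4096 * (512 * (105 * (C₁ + 4))) ^ 2 * (1 + ∑ i, x i) ^ (2 * (22 + b) + 2) := by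
  simp [samplePoly]

lemma le_one_add_sum {n : ℕ} {x : Fin n → ℝ} (hx : ∀ i, 0 ≤ x i) (i : Fin n) :
    x i ≤ 1 + ∑ j, x j := by
  have := Finset.single_le_sum (fun j _ => hx j) (Finset.mem_univ i)
  linarith

section Final

variable {S O A : Type*} [Fintype S] [Fintype O] [Fintype A] [Nonempty A] {H m : ℕ}

omit [Fintype A] in
/-- Transitions cannot factor through features of dimension `0`. -/
lemma POMDP.one_le_of_T_eq (M : POMDP S O A) (hH : 0 < H) {d : ℕ} (g : ℕ → S → Fin d → ℝ)
    (e : ℕ → S → A → Fin d → ℝ)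
    (hT : ∀ h < H, ∀ s a s', M.T h s a s' = g h s' ⬝ᵥ e h s a) : 1 ≤ d := by
  by_contra hd
  obtain rfl : d = 0 := by omega
  have := M.T_sum 0 M.nonempty_states.some (Classical.arbitrary A)
  simp [hT 0 hH] at this

/-- The guarantee for model classes whose kernels span a space of dimension `n`. -/
lemma craneSucceeds_of_finrank_le (hm : 1 ≤ m) (hmH : m ≤ H)
    {r : ℕ → O → A → ℝ} (hr : ∀ h o a, 0 ≤ r h o a ∧ r h o a ≤ 1) {F : Set (POMDP S O A)}
    {M : POMDP S O A} (hMF : M ∈ F) (hF : ∀ f ∈ F, f.IsDecodable H m ∨ f.FuturesAreCore H m)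
    {α δ ε Y : ℝ} {K n : ℕ} (hα : 0 < α) (hreg : ∀ f ∈ F, f.IsRegular H m α) (hδ : 0 < δ)
    (hδ1 : δ ≤ 1) (hε : 0 < ε) (hK : 1 ≤ K) (hn : 1 ≤ n)
    (hrank : finrank ℝ (Submodule.span ℝ (POMDP.kernelVec H '' F)) ≤ n)
    (hY : 1 ≤ Y) (hnY : (n : ℝ) ≤ 3 * Y ^ 4) (hdY : (M.psrRank H : ℝ) ≤ Y)
    (hAY : (Fintype.card A : ℝ) ^ m ≤ Y) (hαY : 1 / α ≤ Y) (hHY : (H : ℝ) ≤ Y)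
    (hOY : Real.log (Fintype.card O) ≤ Y) (hδY : Real.log (1 / δ) ≤ Y)
    (hεY : Real.posLog (1 / ε) ≤ Y)
    (hKε : 1 / ε ^ 2 *
      (4096 * (512 * (105 * ((39 : ℝ) + 4))) ^ 2 * Y ^ (2 * (22 + 6) + 2)) ≤ K) :
    CraneSucceeds H m M F r 4 δ ε K := by
  have := M.nonempty_observations
  have hbr := log_bracketNumber_le_of_finrank_le hmH hm hn hrank hK hY hnY hHY hAY hOY
  refine craneSucceeds_of_le (by norm_num) hm hmH hr hMF (fun f hf => ?_) hα hreg hδ hδ1 hε hK hY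
    hdY hAY hαY hHY hδY hεY hbr.1 hbr.2 hKε
  exact (hF f hf).elim (fun h => h.futuresAreCore hm) id

end Final

end PSR

theorem corollary6 :
    (∀ (S : Type u) (O : Type v) (A : Type w) [Fintype S] [Fintype O] [Fintype A]
      [Nonempty A] (H m : ℕ) (M : PSR.POMDP S O A),
      1 ≤ m → m ≤ H → M.IsDecodable H m → M.FuturesAreCore H m) ∧
    ∃ c > (0 : ℝ),
      -- tabular POMDPs
      (∃ P : MvPolynomial (Fin 8) ℝ,
        ∀ (S : Type u) (O : Type v) (A : Type w) [Fintype S] [Fintype O]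
          [Fintype A] [Nonempty A]
          (H m : ℕ) (r : ℕ → O → A → ℝ) (F : Set (PSR.POMDP S O A)) (M : PSR.POMDP S O A)
          (α δ ε : ℝ) (K : ℕ),
          1 ≤ m → m ≤ H → (∀ h o a, 0 ≤ r h o a ∧ r h o a ≤ 1) →
          M ∈ F → M.IsDecodable H m →
          (∀ f ∈ F, f.IsDecodable H m ∨ f.FuturesAreCore H m) →
          0 < α → (∀ f ∈ F, f.IsRegular H m α) →
          0 < δ → δ ≤ 1 → 0 < ε → 1 ≤ K →
          1 / ε ^ 2 * MvPolynomial.eval ![(M.psrRank H : ℝ), (Fintype.card A : ℝ) ^ m, 1 / α,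
            (Fintype.card O : ℝ), (Fintype.card S : ℝ), (H : ℝ), Real.log (1 / δ),
            Real.posLog (1 / ε)] P ≤ (K : ℝ) →
          PSR.CraneSucceeds H m M F r c δ ε K) ∧
      -- low-rank POMDPs
      (∃ P : MvPolynomial (Fin 11) ℝ, ∃ c₀ > (0 : ℝ),
        ∀ (S : Type u) (O : Type v) (A : Type w) [Fintype S] [Fintype O]
          [Fintype A] [Nonempty A]
          (H m d : ℕ) (r : ℕ → O → A → ℝ) (F : Set (PSR.LowRankPOMDP S O A H d))
          (M : PSR.LowRankPOMDP S O A H d) (α δ ε εLR : ℝ) (K : ℕ),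
          1 ≤ m → m ≤ H → (∀ h o a, 0 ≤ r h o a ∧ r h o a ≤ 1) →
          M ∈ F → (∀ f ∈ F, f.IsDecodable H m) →
          0 < α → (∀ f ∈ F, f.IsRegular H m α) →
          0 < δ → δ ≤ 1 → 0 < ε → 1 ≤ K →
          εLR = c₀ * (PSR.bracketScale A H m K /
            ((Fintype.card O : ℝ) ^ (H + 2) * (Fintype.card A : ℝ) ^ H)) →
          1 / ε ^ 2 * MvPolynomial.eval ![(d : ℝ), (Fintype.card A : ℝ) ^ m, 1 / α,
            PSR.logCover (εLR / d) (PSR.LowRankPOMDP.phiFun '' F),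
            PSR.logCover (εLR / d) (PSR.LowRankPOMDP.psiFun '' F),
            PSR.logCover εLR (PSR.LowRankPOMDP.emFun '' F),
            PSR.logCover εLR (PSR.LowRankPOMDP.muFun '' F),
            (H : ℝ), Real.log (Fintype.card O), Real.log (1 / δ),
            Real.posLog (1 / ε)] P ≤ (K : ℝ) →
          PSR.CraneSucceeds H m M.toPOMDP (PSR.LowRankPOMDP.toPOMDP '' F) r c δ ε K) ∧
      -- linear POMDPs
      (∃ P : MvPolynomial (Fin 7) ℝ,
        ∀ (S : Type u) (O : Type v) (A : Type w) [Fintype S] [Fintype O]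
          [Fintype A] [Nonempty A]
          (H m d₁ d₂ d₃ d₄ d₅ : ℕ) (feat : PSR.LinearFeatures S O A H d₁ d₂ d₃ d₄ d₅)
          (r : ℕ → O → A → ℝ) (F : Set (PSR.POMDP S O A)) (M : PSR.POMDP S O A)
          (α δ ε : ℝ) (K : ℕ),
          1 ≤ m → m ≤ H → (∀ h o a, 0 ≤ r h o a ∧ r h o a ≤ 1) →
          (∀ f ∈ F, f.IsLinear feat) →
          M ∈ F → M.IsDecodable H m →
          (∀ f ∈ F, f.IsDecodable H m ∨ f.FuturesAreCore H m) →
          0 < α → (∀ f ∈ F, f.IsRegular H m α) →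
          0 < δ → δ ≤ 1 → 0 < ε → 1 ≤ K →
          1 / ε ^ 2 * MvPolynomial.eval ![((max d₁ (max d₂ (max d₃ (max d₄ d₅))) : ℕ) : ℝ),
            (Fintype.card A : ℝ) ^ m, 1 / α, (H : ℝ), Real.log (Fintype.card O),
            Real.log (1 / δ), Real.posLog (1 / ε)] P ≤ (K : ℝ) →
          PSR.CraneSucceeds H m M F r c δ ε K) := by
  refine ⟨fun S O A _ _ _ _ H m M hm _ hdec => hdec.futuresAreCore hm, 4, by norm_num,
    ⟨PSR.samplePoly 8 39 6, ?_⟩, ⟨PSR.samplePoly 11 1 1, 1 / 24, by norm_num, ?_⟩,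
    ⟨PSR.samplePoly 7 39 6, ?_⟩⟩
  · intro S O A _ _ _ _ H m r F M α δ ε K hm hmH hr hMF _ hF hα hreg hδ hδ1 hε hK hKε
    rw [PSR.eval_samplePoly] at hKε
    set x : Fin 8 → ℝ := ![(M.psrRank H : ℝ), (Fintype.card A : ℝ) ^ m, 1 / α,
      (Fintype.card O : ℝ), (Fintype.card S : ℝ), (H : ℝ), Real.log (1 / δ),
      Real.posLog (1 / ε)] with hx
    have hδ0 : 0 ≤ Real.log (1 / δ) := Real.log_nonneg ((one_le_div hδ).2 hδ1)
    have hx0 : ∀ i, 0 ≤ x i := by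
      intro i
      fin_cases i
      exacts [Nat.cast_nonneg _, pow_nonneg (Nat.cast_nonneg _) _, one_div_nonneg.2 hα.le, Nat.cast_nonneg _,
        Nat.cast_nonneg _, Nat.cast_nonneg _, hδ0, Real.posLog_nonneg]
    have hle := PSR.le_one_add_sum hx0
    have hY : 1 ≤ 1 + ∑ i, x i := le_add_of_nonneg_right (Finset.sum_nonneg fun i _ => hx0 i)
    set Y := 1 + ∑ i, x i
    have hAY : (Fintype.card A : ℝ) ^ m ≤ Y := hle 1
    have hOY : (Fintype.card O : ℝ) ≤ Y := hle 3
    have hSY : (Fintype.card S : ℝ) ≤ Y := hle 4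
    have hHY : (H : ℝ) ≤ Y := hle 5
    have hA1 : (1 : ℝ) ≤ Fintype.card A := by exact_mod_cast Fintype.card_pos
    have hA'Y : (Fintype.card A : ℝ) ≤ Y := (le_self_pow₀ hA1 (by omega)).trans hAY
    have hY0 : 0 ≤ Y := by linarith
    have := M.nonempty_states
    -- the span of the kernels has at most as many dimensions as the kernels have entries
    have hcard : Fintype.card ((Fin H × S × A × S) ⊕ (Fin H × S × O) ⊕ S) =
        H * (Fintype.card S * (Fintype.card A * Fintype.card S)) +
          (H * (Fintype.card S * Fintype.card O) + Fintype.card S) := by simp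
    refine PSR.craneSucceeds_of_finrank_le
      (n := Fintype.card ((Fin H × S × A × S) ⊕ (Fin H × S × O) ⊕ S)) hm hmH hr hMF hF hα hreg hδ
      hδ1 hε hK Fintype.card_pos ((Submodule.finrank_le _).trans (by simp)) hY ?_ (hle 0) hAY
      (hle 2) hHY ((Real.log_le_self (Nat.cast_nonneg _)).trans hOY) (hle 6) (hle 7) hKε
    rw [hcard]
    push_cast
    have h3 : Y ^ 3 ≤ Y ^ 4 := pow_le_pow_right₀ hY (by norm_num)
    have h1 : Y ≤ Y ^ 4 := le_self_pow₀ hY (by norm_num)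
    calc (H : ℝ) * (Fintype.card S * (Fintype.card A * Fintype.card S)) +
          (H * (Fintype.card S * Fintype.card O) + Fintype.card S)
        ≤ Y * (Y * (Y * Y)) + (Y * (Y * Y) + Y) := by gcongr
      _ = Y ^ 4 + (Y ^ 3 + Y) := by ring
      _ ≤ 3 * Y ^ 4 := by linarith
  · intro S O A _ _ _ _ H m d r F M α δ ε εLR K hm hmH hr hMF hF hα hreg hδ hδ1 hε hK hLR hKε
    rw [PSR.eval_samplePoly] at hKε
    set x : Fin 11 → ℝ := ![(d : ℝ), (Fintype.card A : ℝ) ^ m, 1 / α,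
      PSR.logCover (εLR / d) (PSR.LowRankPOMDP.phiFun '' F),
      PSR.logCover (εLR / d) (PSR.LowRankPOMDP.psiFun '' F),
      PSR.logCover εLR (PSR.LowRankPOMDP.emFun '' F),
      PSR.logCover εLR (PSR.LowRankPOMDP.muFun '' F),
      (H : ℝ), Real.log (Fintype.card O), Real.log (1 / δ), Real.posLog (1 / ε)] with hx
    have hδ0 : 0 ≤ Real.log (1 / δ) := Real.log_nonneg ((one_le_div hδ).2 hδ1)
    have hx0 : ∀ i, 0 ≤ x i := by
      intro i
      fin_cases i
      exacts [Nat.cast_nonneg _, pow_nonneg (Nat.cast_nonneg _) _, one_div_nonneg.2 hα.le, PSR.logCover_nonneg _ _,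
        PSR.logCover_nonneg _ _, PSR.logCover_nonneg _ _, PSR.logCover_nonneg _ _,
        Nat.cast_nonneg _, Real.log_natCast_nonneg _, hδ0, Real.posLog_nonneg]
    have hle := PSR.le_one_add_sum hx0
    have hY : 1 ≤ 1 + ∑ i, x i := le_add_of_nonneg_right (Finset.sum_nonneg fun i _ => hx0 i)
    have hcov : x 3 + x 4 + x 5 + x 6 ≤ 1 + ∑ i, x i := by
      have := Finset.sum_le_univ_sum_of_nonneg hx0 (s := {3, 4, 5, 6})
      rw [Finset.sum_insert (by decide), Finset.sum_insert (by decide),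
        Finset.sum_insert (by decide), Finset.sum_singleton] at this
      linarith
    set Y := 1 + ∑ i, x i
    have hA1 : (1 : ℝ) ≤ Fintype.card A := by exact_mod_cast Fintype.card_pos
    have hH : 0 < H := by omega
    have hd := M.one_le_of_T_eq hH M.ψ M.φ M.T_eq
    have := M.nonempty_observations
    have hK0 : (0 : ℝ) < K := by exact_mod_cast hK
    have hH0 : (0 : ℝ) < H := by exact_mod_cast hH
    have hO0 : (0 : ℝ) < Fintype.card O := by exact_mod_cast Fintype.card_pos
    have hscale : 0 < PSR.bracketScale A H m K := by
      unfold PSR.bracketScale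
      positivity
    have hρ : 0 < εLR := by
      rw [hLR]
      positivity
    have hbr := PSR.log_bracketNumber_le_logCover hd hMF hF hρ
      (ε := PSR.bracketScale A H m K) (by
        have h1 : 24 * εLR * (Fintype.card O : ℝ) ^ (H + 2) =
            PSR.bracketScale A H m K / (Fintype.card A : ℝ) ^ H := by
          rw [hLR]
          field_simp
        rw [h1]
        exact div_le_self hscale.le (one_le_pow₀ hA1))
    refine PSR.craneSucceeds_of_le (C₁ := 1) (b := 1) (Y := Y)
      (F := PSR.LowRankPOMDP.toPOMDP '' F) (M := M.toPOMDP) le_rfl hm hmH hr ⟨M, hMF, rfl⟩ ?_ hα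
      ?_ hδ hδ1 hε hK hY ?_ (hle 1) (hle 2) (hle 7) (hle 9) (hle 10) hbr.1 ?_ hKε
    · rintro _ ⟨f, hf, rfl⟩
      exact (hF f hf).futuresAreCore hm
    · rintro _ ⟨f, hf, rfl⟩
      exact hreg f hf
    · exact le_trans (Nat.cast_le.2 (PSR.POMDP.psrRank_le hd M.ψ M.φ M.T_eq)) (hle 0)
    · have hlogK : 0 ≤ Real.log K := Real.log_natCast_nonneg K
      calc _ ≤ Y := hbr.2.trans hcov
        _ ≤ 1 * Y ^ 1 * (1 + Real.log K) := by
          rw [one_mul, pow_one]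
          exact le_mul_of_one_le_right (by linarith) (by linarith)
  · intro S O A _ _ _ _ H m d₁ d₂ d₃ d₄ d₅ feat r F M α δ ε K hm hmH hr hlin hMF _ hF hα hreg hδ hδ1
      hε hK hKε
    rw [PSR.eval_samplePoly] at hKε
    set D : ℕ := max d₁ (max d₂ (max d₃ (max d₄ d₅))) with hD
    set x : Fin 7 → ℝ := ![(D : ℝ), (Fintype.card A : ℝ) ^ m, 1 / α, (H : ℝ),
      Real.log (Fintype.card O), Real.log (1 / δ), Real.posLog (1 / ε)] with hx
    have hδ0 : 0 ≤ Real.log (1 / δ) := Real.log_nonneg ((one_le_div hδ).2 hδ1)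
    have hx0 : ∀ i, 0 ≤ x i := by
      intro i
      fin_cases i
      exacts [Nat.cast_nonneg _, pow_nonneg (Nat.cast_nonneg _) _, one_div_nonneg.2 hα.le, Nat.cast_nonneg _,
        Real.log_natCast_nonneg _, hδ0, Real.posLog_nonneg]
    have hle := PSR.le_one_add_sum hx0
    have hY : 1 ≤ 1 + ∑ i, x i := le_add_of_nonneg_right (Finset.sum_nonneg fun i _ => hx0 i)
    set Y := 1 + ∑ i, x i
    have hDY : (D : ℝ) ≤ Y := hle 0
    have hHY : (H : ℝ) ≤ Y := hle 3
    have hY0 : 0 ≤ Y := by linarith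
    have hH : 0 < H := by omega
    obtain ⟨B₁, B₂, θ, -, -, -, hT, -, hμ⟩ := hlin M hMF
    -- features of dimension `0` cannot represent probabilities
    have hd₂ : 1 ≤ d₂ := M.one_le_of_T_eq hH feat.ψT (fun h s a => (B₁ h).mulVec (feat.φT h s a)) hT
    have hd₅ : 1 ≤ d₅ := by
      by_contra hd
      obtain rfl : d₅ = 0 := by omega
      have := M.μ_sum
      simp [hμ] at this
    have hrk : M.psrRank H ≤ D := (PSR.POMDP.psrRank_le hd₂ feat.ψT
      (fun h s a => (B₁ h).mulVec (feat.φT h s a)) hT).trans (by omega)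
    refine PSR.craneSucceeds_of_finrank_le (Y := Y) hm hmH hr hMF hF hα hreg hδ
      hδ1 hε hK (by omega) (PSR.finrank_span_kernelVec_le feat hlin) hY ?_
      (le_trans (by exact_mod_cast hrk) hDY) (hle 1) (hle 2) hHY (hle 4) (hle 5) (hle 6) hKε
    have e₁ : (d₁ : ℝ) ≤ Y := le_trans (by exact_mod_cast (by omega : d₁ ≤ D)) hDY
    have e₂ : (d₂ : ℝ) ≤ Y := le_trans (by exact_mod_cast (by omega : d₂ ≤ D)) hDY
    have e₃ : (d₃ : ℝ) ≤ Y := le_trans (by exact_mod_cast (by omega : d₃ ≤ D)) hDY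
    have e₄ : (d₄ : ℝ) ≤ Y := le_trans (by exact_mod_cast (by omega : d₄ ≤ D)) hDY
    have e₅ : (d₅ : ℝ) ≤ Y := le_trans (by exact_mod_cast (by omega : d₅ ≤ D)) hDY
    have h3 : Y ^ 3 ≤ Y ^ 4 := pow_le_pow_right₀ hY (by norm_num)
    have h1 : Y ≤ Y ^ 4 := le_self_pow₀ hY (by norm_num)
    push_cast
    calc (H : ℝ) * (d₂ * d₁) + (H * (d₄ * d₃) + d₅)
        ≤ Y * (Y * Y) + (Y * (Y * Y) + Y) := by gcongr
      _ = Y ^ 3 + (Y ^ 3 + Y) := by ring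
      _ ≤ 3 * Y ^ 4 := by linarith
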